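/- Let $n\ge 2$, let $-1\le d_0\le d_\infty<\frac1{n-1}$, and let $\kappa_i>0$, $\theta_i>0$ ($i=1,\dots,n$) be arbitrary. For $z\in\mathbb R$ write $\lceil z\rfloor^p=|z|^p\,\mathrm{sign}(z)$, and put $r_{0,i}=1-(n-i)d_0$, $r_{\infty,i}=1-(n-i)d_\infty$ for $1\le i\le n+1$, $$\varphi_i(s)=\kappa_i\lceil s\rfloor^{r_{0,i+1}/r_{0,i}}+\theta_i\lceil s\rfloor^{r_{\infty,i+1}/r_{\infty,i}},\qquad \phi_i=\varphi_i\circ\cdots\circ\varphi_1 .$$ For gains $k_1,\dots,k_n$ and a (noise-free) signal $f_0:[0,\infty)\to\mathbb R$ consider the differentiator $$\dot x_i=-k_i\phi_i(x_1-f_0(t))+x_{i+1}\ (1\le i\le n-1),\qquad \dot x_n=-k_n\phi_n(x_1-f_0(t)),$$ whose solutions are understood in the sense of Filippov. For $\Delta\ge 0$ let $\mathscr S^n_\Delta$ be the class of signals $f_0$ on $[0,\infty)$ that are $n-1$ times continuously differentiable with $f_0^{(n-1)}$ Lipschitz with constant $\Delta$ (in particular, all $n$ times differentiable $f_0$ with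 $|f_0^{(n)}|\le\Delta$); $\mathscr S^n_0$ consists of the polynomials of degree less than $n$. Let $\Delta\ge0$, and assume $d_0=-1$ or $\Delta=0$. Then there exist gains $k_1,\dots,k_n>0$, independent of the signal and of the initial state, such that the following holds. 1. For every $f_0\in\mathscr S^n_\Delta$: for every initial state there is a solution on $[0,\infty)$; every solution on a bounded interval $[0,\tau)$ extends to a solution on $[0,\infty)$; and every solution on $[0,\infty)$ satisfies $x_i(t)-f_0^{(i-1)}(t)\to0$ as $t\to\infty$ for $i=1,\dots,n$. 2. Convergence is in fixed time if either (a) $-1<d_0<0<d_\infty$ and $\Delta=0$ (polynomial signals), or (b) $d_0=-1$ and $0<d_\infty$ (signals in $\mathscr S^n_\Delta$): with the same gains there is $\bar T>0$ such that $x_i(t)=f_0^{(i-1)}(t)$ for all $t\ge\bar T$ and $i=1,\dots,n$, for every $f_0\in\mathscr S^n_\Delta$ and every solution $x$ on $[0,\infty)$, whatever its initial state. -/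

import Mathlib

open Set Filter Topology MeasureTheory

noncomputable section

/-- The signed power `⌈z⌋^p = |z|^p sign z`. -/
def signedPow (z p : ℝ) : ℝ := |z| ^ p * Real.sign z

/-- The weight `r_i = 1 - (n - i) d`, used for `1 ≤ i ≤ n + 1` (so `r_n = 1`, `r_{n+1} = 1 + d`). -/
def weight (n : ℕ) (d : ℝ) (i : ℕ) : ℝ := 1 - ((n : ℝ) - (i : ℝ)) * d

/-- `φ_i(s) = κ_i ⌈s⌋^{r_{0,i+1}/r_{0,i}} + θ_i ⌈s⌋^{r_{∞,i+1}/r_{∞,i}}`, indices `1 ≤ i ≤ n`. -/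
def varphi (n : ℕ) (d₀ dinf : ℝ) (κ θ : ℕ → ℝ) (i : ℕ) (s : ℝ) : ℝ :=
  κ i * signedPow s (weight n d₀ (i + 1) / weight n d₀ i)
    + θ i * signedPow s (weight n dinf (i + 1) / weight n dinf i)

/-- The output injection `φ_i ∘ ⋯ ∘ φ_2 ∘ φ_1` (the identity for `i = 0`). -/
def injection (n : ℕ) (d₀ dinf : ℝ) (κ θ : ℕ → ℝ) : ℕ → ℝ → ℝ
  | 0, z => z
  | i + 1, z => varphi n d₀ dinf κ θ (i + 1) (injection n d₀ dinf κ θ i z)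

/-- Zero-based coordinates of a state, padded by zero: `coord x j` is `x_{j+1}` for `j < n`,
and `coord x n = 0` plays the role of `x_{n+1} = 0`. -/
def coord {n : ℕ} (x : Fin n → ℝ) (j : ℕ) : ℝ := if h : j < n then x ⟨j, h⟩ else 0

/-- Right-hand side of the differentiator driven by the measured signal `f`:
`ẋ_i = -k_i ϕ_i(x_1 - f(t)) + x_{i+1}` for `i < n` and `ẋ_n = -k_n ϕ_n(x_1 - f(t))`.
The component `j : Fin n` is the one with one-based index `i = j + 1`. -/
def differentiatorField (n : ℕ) (d₀ dinf : ℝ) (κ θ k : ℕ → ℝ) (f : ℝ → ℝ)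
    (t : ℝ) (x : Fin n → ℝ) : Fin n → ℝ := fun j =>
  -k (j + 1) * injection n d₀ dinf κ θ (j + 1) (coord x 0 - f t) + coord x (j + 1)

/-- Filippov's regularization of a (possibly discontinuous) vector field `g`:
`F(t, x) = ⋂_{δ > 0} ⋂_{vol N = 0} closure (conv (g(t, B(x, δ) \ N)))`. -/
def filippov {n : ℕ} (g : ℝ → (Fin n → ℝ) → (Fin n → ℝ)) (t : ℝ) (x : Fin n → ℝ) :
    Set (Fin n → ℝ) :=
  ⋂ (δ : ℝ) (_ : 0 < δ) (N : Set (Fin n → ℝ)) (_ : volume N = 0),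
    closure (convexHull ℝ (g t '' (Metric.ball x δ \ N)))

/-- `x` is a Filippov solution of `ẋ = g(t, x)` on the interval `I`: it is absolutely continuous
on every compact subinterval of `I` and `ẋ(t) ∈ F(t, x(t))` for almost every `t ∈ I`. -/
structure IsFilippovSolution {n : ℕ} (g : ℝ → (Fin n → ℝ) → (Fin n → ℝ)) (I : Set ℝ)
    (x : ℝ → Fin n → ℝ) : Prop where
  absolutelyContinuous : ∀ a ∈ I, ∀ b ∈ I, AbsolutelyContinuousOnInterval x a b
  inclusion : ∀ᵐ t : ℝ, t ∈ I → ∃ v ∈ filippov g t (x t), HasDerivAt x v t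

/-- The `i`-th derivative of a signal on `[0, ∞)` (one-sided at `0`). -/
def signalDeriv (i : ℕ) (f : ℝ → ℝ) (t : ℝ) : ℝ := iteratedDerivWithin i f (Ici 0) t

/-- The class of `n`-Lipschitz signals (`n ≥ 1`) on `[0, ∞)`: `f` is `n - 1` times continuously
differentiable and its `(n-1)`-st derivative is Lipschitz with constant `Δ`. It contains every
`n` times differentiable `f` with `|f^{(n)}| ≤ Δ`; for `Δ = 0` it consists of the polynomials of
degree less than `n`. -/
structure IsLipschitzSignal (n : ℕ) (Δ : ℝ) (f : ℝ → ℝ) : Prop where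
  contDiffOn : ContDiffOn ℝ ((n - 1 : ℕ) : ℕ∞) f (Ici 0)
  lipschitz : ∀ s ∈ Ici (0 : ℝ), ∀ t ∈ Ici (0 : ℝ),
    |signalDeriv (n - 1) f t - signalDeriv (n - 1) f s| ≤ Δ * |t - s|

end

/-! Write `Φ_i` for the composed injection (`Φ_0` is the identity). The errors `e_i = x_i -
f₀^{(i-1)}` satisfy `ė_i = -k_i Φ_i(e_1) + e_{i+1}`, the last equation being an inclusion with a
disturbance of size at most `Δ`. Instead of a Lyapunov function, the proof contracts the boxes
`|e_i| ≤ k_{i-1} Φ_{i-1}(s)`, uniformly in the scale `s > 0`.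

Scaling. Put `y_i = e_i / (k_{i-1} Φ_{i-1}(s))`, `u_i = Φ_{i-1}(e_1) / Φ_{i-1}(s)` and `K_i = k_i /
k_{i-1}`. Then `ẏ_i = -K_i (Φ_i(s) / Φ_{i-1}(s)) (u_{i+1} - y_{i+1})`, with `u_1 = y_1` and `u_{i+1}
= ψ_i(u_i)`. At every scale `ψ_i` is a convex combination of the same two signed powers
(`exists_varphi_mul`), and all quotients `Φ_i(s) / Φ_{i-1}(s)` are comparable to one rate
(`exists_rate_comparable`). So `s` survives only as a unit of time, and estimates uniform over the
convex combinations replace homogeneity.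

Contraction (`cascadeContracts`). The gains are chosen from `K_n` down to `K_1`, each large compared
with those already chosen. Equation `m` is then fast: `ψ_m(u_m)` follows the slow `y_{m+1}`, that
is, `u_{m+1}` is close to `y_{m+1}`, which is the input condition of the chain starting at `m + 1`.
In the last equation the injection must dominate the disturbance: if `d₀ = -1` it jumps at zero, its
value at positive errors being at least `κ_n`, so a large `k_n` suffices; otherwise `Δ = 0`.
Unscaled (`exists_gains`), the box at scale `s` enters the box at scale `s / 2` after time `T / rate
s`.

Convergence. Iterating the halving drives the errors to zero. The total time is `T ∑ 1 / rate (s /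
2^j)`, which is bounded independently of `s` when `d₀ < 0 < dinf`, since the terms decay
geometrically away from `s = 1` on both sides (`exists_potential`).

Existence. Limits of Euler's scheme solve the inclusion for a truncated field; the boxes bound the
errors a priori, so the truncation is never active (`exists_solution_from`). The same bound makes
solutions on bounded intervals Lipschitz, hence extendable (`exists_extension`). -/

noncomputable section

/-! ### Absolutely continuous functions -/

theorem AbsolutelyContinuousOnInterval.sub_le_of_ae_deriv_le {w : ℝ → ℝ} {a b M : ℝ}
    (hab : a ≤ b) (hw : AbsolutelyContinuousOnInterval w a b)
    (h : ∀ᵐ t, t ∈ Icc a b → ∃ v, HasDerivAt w v t ∧ v ≤ M) : w b - w a ≤ M * (b - a) := by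
  rw [← hw.integral_deriv_eq_sub]
  have h1 : ∫ t in a..b, deriv w t ≤ ∫ _t in a..b, M := by
    apply intervalIntegral.integral_mono_ae_restrict hab hw.intervalIntegrable_deriv
      intervalIntegrable_const
    rw [EventuallyLE, ae_restrict_iff' measurableSet_Icc]
    filter_upwards [h] with t ht hmem
    obtain ⟨v, hv, hvM⟩ := ht hmem
    rwa [hv.deriv]
  simpa [mul_comm] using h1

theorem AbsolutelyContinuousOnInterval.mono_Icc {X : Type*} [PseudoMetricSpace X] {w : ℝ → X}
    {a b c d : ℝ} (hw : AbsolutelyContinuousOnInterval w a b) (hac : a ≤ c) (hcd : c ≤ d)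
    (hdb : d ≤ b) : AbsolutelyContinuousOnInterval w c d := by
  apply hw.mono
  rw [uIcc_of_le hcd, uIcc_of_le (hac.trans (hcd.trans hdb))]
  exact Icc_subset_Icc hac hdb

theorem AbsolutelyContinuousOnInterval.continuousOn_Icc {X : Type*} [SeminormedAddCommGroup X]
    {w : ℝ → X} {a b : ℝ} (hw : AbsolutelyContinuousOnInterval w a b) (hab : a ≤ b) :
    ContinuousOn w (Icc a b) := by
  have := hw.continuousOn
  rwa [uIcc_of_le hab] at this

theorem AbsolutelyContinuousOnInterval.abs_sub_le_of_ae_deriv_le {w : ℝ → ℝ} {a b M : ℝ}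
    (hab : a ≤ b) (hw : AbsolutelyContinuousOnInterval w a b)
    (h : ∀ᵐ t, t ∈ Icc a b → ∃ v, HasDerivAt w v t ∧ |v| ≤ M) : |w b - w a| ≤ M * (b - a) := by
  refine abs_le.2 ⟨?_, hw.sub_le_of_ae_deriv_le hab ?_⟩
  · have := hw.neg.sub_le_of_ae_deriv_le (M := M) hab (by
      filter_upwards [h] with t ht hmem
      obtain ⟨v, hv, hvM⟩ := ht hmem
      exact ⟨-v, hv.neg, by linarith [(abs_le.1 hvM).1]⟩)
    simp only [Pi.neg_apply] at this
    linarith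
  · filter_upwards [h] with t ht hmem
    obtain ⟨v, hv, hvM⟩ := ht hmem
    exact ⟨v, hv, (abs_le.1 hvM).2⟩

/-- A function decreasing at speed at least `α` above the level `c` falls below that level. -/
theorem AbsolutelyContinuousOnInterval.le_max_of_ae_deriv_le {w : ℝ → ℝ} {a b c α : ℝ}
    (hw : AbsolutelyContinuousOnInterval w a b) (hα : 0 ≤ α)
    (h : ∀ᵐ t, t ∈ Icc a b → c < w t → ∃ v, HasDerivAt w v t ∧ v ≤ -α) {t : ℝ}
    (ht : t ∈ Icc a b) : w t ≤ max c (w a - α * (t - a)) := by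
  by_contra! hlt
  obtain ⟨hc, hwt⟩ := max_lt_iff.1 hlt
  have hcont := (hw.mono_Icc le_rfl ht.1 ht.2).continuousOn_Icc ht.1
  by_cases hne : ∃ s ∈ Icc a t, w s ≤ c
  · set F := Icc a t ∩ w ⁻¹' Iic c
    have hFc : IsClosed F := hcont.preimage_isClosed_of_isClosed isClosed_Icc isClosed_Iic
    have hFcomp : IsCompact F := isCompact_Icc.of_isClosed_subset hFc inter_subset_left
    have hFne : F.Nonempty := by obtain ⟨s, hs, hsc⟩ := hne; exact ⟨s, hs, hsc⟩
    obtain ⟨r, hr, hmax⟩ := hFcomp.exists_isGreatest hFne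
    have hrt : r ≤ t := hr.1.2
    have := (hw.mono_Icc hr.1.1 hrt ht.2).sub_le_of_ae_deriv_le (M := 0) hrt (by
      have hr0 : ∀ᵐ s : ℝ, s ≠ r := by simp [ae_iff, measure_singleton]
      filter_upwards [h, hr0] with s hs hsr hmem
      have hcs : c < w s := by
        by_contra! hcs
        exact hsr (le_antisymm (hmax ⟨⟨hr.1.1.trans hmem.1, hmem.2⟩, hcs⟩) hmem.1)
      obtain ⟨v, hv, hvα⟩ := hs ⟨hr.1.1.trans hmem.1, hmem.2.trans ht.2⟩ hcs
      exact ⟨v, hv, by linarith⟩)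
    have hrc : w r ≤ c := hr.2
    linarith
  · push Not at hne
    have := (hw.mono_Icc le_rfl ht.1 ht.2).sub_le_of_ae_deriv_le (M := -α) ht.1 (by
      filter_upwards [h] with s hs hmem
      exact hs ⟨hmem.1, hmem.2.trans ht.2⟩ (hne s hmem))
    linarith

/-! ### Uniform families of increasing functions -/

/-- A family of odd increasing functions with common growth bounds and moduli of continuity. -/
structure UniformlyIncreasing (S : Set (ℝ → ℝ)) : Prop where
  odd : ∀ ψ ∈ S, ∀ x, ψ (-x) = -ψ x
  mono : ∀ ψ ∈ S, Monotone ψ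
  continuous : ∀ ψ ∈ S, Continuous ψ
  pos : ∀ b, 0 < b → ∃ β, 0 < β ∧ ∀ ψ ∈ S, β ≤ ψ b
  growth : ∀ C : ℝ, ∃ R, 0 < R ∧ ∀ ψ ∈ S, C ≤ ψ R
  bounded : ∀ C : ℝ, ∃ U, 0 < U ∧ ∀ ψ ∈ S, ψ C ≤ U
  modulus : ∀ C ε : ℝ, 0 < ε → ∃ η, 0 < η ∧
    ∀ ψ ∈ S, ∀ x h, |x| ≤ C → |h| ≤ η → |ψ (x + h) - ψ x| ≤ ε

theorem abs_le_of_odd_of_monotone {ψ : ℝ → ℝ} (hodd : ∀ x, ψ (-x) = -ψ x) (hmono : Monotone ψ)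
    {x C U : ℝ} (hx : |x| ≤ C) (hU : ψ C ≤ U) : |ψ x| ≤ U := by
  obtain ⟨h1, h2⟩ := abs_le.1 hx
  have h3 := hmono h1
  have h4 := hmono h2
  rw [hodd] at h3
  exact abs_le.2 ⟨by linarith, by linarith⟩

theorem exists_preimage_of_odd {ψ : ℝ → ℝ} (hodd : ∀ x, ψ (-x) = -ψ x) (hc : Continuous ψ)
    {R z C : ℝ} (hR : 0 < R) (hC : C ≤ ψ R) (hz : |z| ≤ C) : ∃ r, |r| ≤ R ∧ ψ r = z := by
  obtain ⟨h1, h2⟩ := abs_le.1 hz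
  obtain ⟨r, hr, hrz⟩ := intermediate_value_Icc (by linarith : -R ≤ R) hc.continuousOn
    (show z ∈ Icc (ψ (-R)) (ψ R) from ⟨by rw [hodd]; linarith, by linarith⟩)
  exact ⟨r, abs_le.2 hr, hrz⟩

/-! ### Cascades -/

/-- A chain of scalar equations `ẏ_i = -G_i (u_{i+1} - y_{i+1})`, `m ≤ i ≤ n`, in which the
injections satisfy `u_{i+1} = ψ_i (u_i)` for `i < n`, the last one is only known through sector
bounds, and `y_{n+1}` is a disturbance bounded by `δ`. -/
structure IsCascade (m n : ℕ) (ψ : ℕ → ℝ → ℝ) (β U : ℝ → ℝ) (δ : ℝ) (G : ℕ → ℝ)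
    (y u : ℕ → ℝ → ℝ) (a b : ℝ) : Prop where
  ac : ∀ i ∈ Finset.Icc m n, AbsolutelyContinuousOnInterval (y i) a b
  deriv : ∀ i ∈ Finset.Icc m n, ∀ᵐ t, t ∈ Icc a b →
    HasDerivAt (y i) (-G i * (u (i + 1) t - y (i + 1) t)) t
  output : ∀ i ∈ Finset.Ico m n, ∀ t ∈ Icc a b, u (i + 1) t = ψ i (u i t)
  disturbance : ∀ᵐ t, t ∈ Icc a b → |y (n + 1) t| ≤ δ
  last_pos : ∀ᵐ t, t ∈ Icc a b → ∀ r, 0 < r → r ≤ u n t → β r ≤ u (n + 1) t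
  last_neg : ∀ᵐ t, t ∈ Icc a b → ∀ r, 0 < r → u n t ≤ -r → u (n + 1) t ≤ -β r
  last_bdd : ∀ᵐ t, t ∈ Icc a b → ∀ C, |u n t| ≤ C → |u (n + 1) t| ≤ U C

theorem IsCascade.restrict {m n : ℕ} {ψ : ℕ → ℝ → ℝ} {β U : ℝ → ℝ} {δ : ℝ} {G : ℕ → ℝ}
    {y u : ℕ → ℝ → ℝ} {a b m' c d} (h : IsCascade m n ψ β U δ G y u a b) (hm : m ≤ m')
    (hac : a ≤ c) (hcd : c ≤ d) (hdb : d ≤ b) : IsCascade m' n ψ β U δ G y u c d := by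
  have hs : Icc c d ⊆ Icc a b := Icc_subset_Icc hac hdb
  have hI : ∀ i ∈ Finset.Icc m' n, i ∈ Finset.Icc m n := fun i hi => by
    simp only [Finset.mem_Icc] at *; omega
  refine ⟨fun i hi => (h.ac i (hI i hi)).mono_Icc hac hcd hdb, fun i hi => ?_,
    fun i hi t ht => h.output i ?_ t (hs ht), ?_, ?_, ?_, ?_⟩
  · filter_upwards [h.deriv i (hI i hi)] with t h1 ht using h1 (hs ht)
  · simp only [Finset.mem_Ico] at *; omega
  · filter_upwards [h.disturbance] with t h1 ht using h1 (hs ht)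
  · filter_upwards [h.last_pos] with t h1 ht using h1 (hs ht)
  · filter_upwards [h.last_neg] with t h1 ht using h1 (hs ht)
  · filter_upwards [h.last_bdd] with t h1 ht using h1 (hs ht)

/-- The cascade can be driven from the box `|y_i| ≤ A` into the box `|y_i| ≤ B`, for all
nonlinearities `ψ_i ∈ S_i` and all time scales `1 / ω`, by suitable gains `K_i`. -/
def CascadeContracts (S : ℕ → Set (ℝ → ℝ)) (β U : ℝ → ℝ) (c : ℝ) (m n : ℕ) : Prop :=
  -- The tolerance `δ` precedes the lower bound `M` on the gains, so `M` may depend on `δ`: a given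
  -- disturbance is made small relative to the last injection by raising the gain.
  ∀ A B, 0 < A → 0 < B → ∃ δ, 0 < δ ∧ ∀ M, ∃ K : ℕ → ℝ, (∀ i, M ≤ K i ∧ 1 ≤ K i) ∧
    ∃ η C T, 0 < η ∧ 0 < C ∧ 0 < T ∧ ∀ ψ : ℕ → ℝ → ℝ, (∀ i ∈ Finset.Ico m n, ψ i ∈ S i) →
      ∀ ω, 0 < ω → ∀ G : ℕ → ℝ,
      (∀ i ∈ Finset.Icc m n, ω * K i ≤ c * G i ∧ G i ≤ ω * (c * K i)) →
      ∀ (y u : ℕ → ℝ → ℝ) (a b : ℝ), a ≤ b → b ≤ a + T / ω → IsCascade m n ψ β U δ G y u a b →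
        (∀ i ∈ Finset.Icc m n, |y i a| ≤ A) → (∀ t ∈ Icc a b, |u m t - y m t| ≤ η) →
        (∀ i ∈ Finset.Icc m n, ∀ t ∈ Icc a b, |y i t| ≤ C) ∧
        (b = a + T / ω → ∀ i ∈ Finset.Icc m n, |y i b| ≤ B)

/-- The one-sided estimate for the last equation of a cascade. -/
theorem last_upper {w u v d : ℝ → ℝ} {a b B η b₀ δ G : ℝ} (hG : 0 < G)
    (hw : AbsolutelyContinuousOnInterval w a b) (hη : η ≤ B / 2) (hδ : δ ≤ b₀ / 2) (hb₀ : 0 < b₀)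
    (hd : ∀ᵐ t, t ∈ Icc a b → HasDerivAt w (-G * (v t - d t)) t)
    (hdist : ∀ᵐ t, t ∈ Icc a b → |d t| ≤ δ) (hu : ∀ t ∈ Icc a b, |u t - w t| ≤ η)
    (hv : ∀ᵐ t, t ∈ Icc a b → B / 2 ≤ u t → b₀ ≤ v t) {t : ℝ} (ht : t ∈ Icc a b) :
    w t ≤ max B (w a - G * (b₀ / 2) * (t - a)) := by
  refine hw.le_max_of_ae_deriv_le (by positivity) ?_ ht
  filter_upwards [hd, hdist, hv] with s h1 h2 h3 hs hlt
  refine ⟨_, h1 hs, ?_⟩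
  have h4 := h3 hs (by linarith [(abs_le.1 (hu s hs)).1])
  have h5 : b₀ / 2 ≤ v s - d s := by linarith [(abs_le.1 (h2 hs)).2]
  nlinarith

/-- Base of the induction. Outside the level `B` the sector bound exceeds the disturbance by a
factor two, so `|y_n|` decreases at a definite speed. -/
theorem cascadeContracts_last (S : ℕ → Set (ℝ → ℝ)) {β : ℝ → ℝ} (U : ℝ → ℝ) {c : ℝ} (n : ℕ)
    (hc : 0 < c) (hβ : ∀ r, 0 < r → 0 < β r) : CascadeContracts S β U c n n := by
  intro A B hA hB
  have hb := hβ (B / 2) (by positivity)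
  -- The speed is at least `G_n β(B/2) / 2` with `G_n ≥ ω K_n / c`; `T` is the time in which this
  -- removes `A`.
  refine ⟨β (B / 2) / 2, by positivity, fun M => ⟨fun _ => max M 1, fun i => ⟨le_max_left _ _,
    le_max_right _ _⟩, B / 2, max A B, c * A / (max M 1 * (β (B / 2) / 2)), by positivity,
    by positivity, by positivity, ?_⟩⟩
  intro ψ hψ ω hω G hG y u a b hab hbT h hA' hu
  obtain ⟨hG1, hG2⟩ := hG n (by simp)
  have hGpos : 0 < G n := by
    have : 0 < ω * max M 1 := by positivity
    by_contra! hneg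
    nlinarith
  have hn : n ∈ Finset.Icc n n := by simp
  have up : ∀ t ∈ Icc a b, y n t ≤ max B (y n a - G n * (β (B / 2) / 2) * (t - a)) := fun t ht =>
    last_upper (u := u n) hGpos (h.ac n hn) le_rfl le_rfl hb (h.deriv n hn) h.disturbance hu
      (by filter_upwards [h.last_pos] with s hs hm using hs hm _ (by positivity)) ht
  have lo : ∀ t ∈ Icc a b, -y n t ≤ max B (-y n a - G n * (β (B / 2) / 2) * (t - a)) :=
    fun t ht => last_upper (w := fun t => -y n t) (u := fun t => -u n t)
      (v := fun t => -u (n + 1) t) (d := fun t => -y (n + 1) t) hGpos (h.ac n hn).neg le_rfl le_rfl hb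
      (by
        filter_upwards [h.deriv n hn] with s hs hm
        convert! (hs hm).neg using 1
        ring)
      (by simpa using h.disturbance)
      (fun s hs => by
        rw [show -u n s - -y n s = -(u n s - y n s) by ring, abs_neg]; exact hu s hs)
      (by
        filter_upwards [h.last_neg] with s hs hm h2
        have := hs hm (B / 2) (by positivity) (by linarith)
        linarith) ht
  have hAn := abs_le.1 (hA' n hn)
  constructor
  · intro i hi t ht
    obtain rfl : i = n := by simp only [Finset.mem_Icc] at hi; omega
    have h1 := up t ht
    have h2 := lo t ht
    have h3 : 0 ≤ G i * (β (B / 2) / 2) * (t - a) :=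
      mul_nonneg (by positivity) (by linarith [ht.1])
    refine abs_le.2 ⟨?_, ?_⟩
    · rcases le_max_iff.1 h2 with h | h <;> linarith [le_max_left A B, le_max_right A B]
    · rcases le_max_iff.1 h1 with h | h <;> linarith [le_max_left A B, le_max_right A B]
  · intro hbe i hi
    obtain rfl : i = n := by simp only [Finset.mem_Icc] at hi; omega
    have hbm : b ∈ Icc a b := ⟨hab, le_rfl⟩
    have h1 := up b hbm
    have h2 := lo b hbm
    have h3 : A ≤ G i * (β (B / 2) / 2) * (b - a) := by
      have : b - a = c * A / (max M 1 * (β (B / 2) / 2)) / ω := by linarith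
      rw [this, mul_div_assoc', mul_div_assoc', le_div_iff₀ hω, le_div_iff₀ (by positivity)]
      nlinarith [mul_le_mul_of_nonneg_right hG1 (by positivity : 0 ≤ A * (β (B / 2) / 2))]
    refine abs_le.2 ⟨?_, ?_⟩
    · rcases le_max_iff.1 h2 with h | h <;> linarith
    · rcases le_max_iff.1 h1 with h | h <;> linarith

/-- Continuous induction: a bound that improves itself on initial segments holds throughout. -/
theorem le_of_improving_bound {g : ℝ → ℝ} {a b C C' : ℝ} (hg : ContinuousOn g (Icc a b))
    (hC : C' < C) (ha : g a ≤ C')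
    (h : ∀ b' ∈ Icc a b, (∀ t ∈ Icc a b', g t ≤ C) → ∀ t ∈ Icc a b', g t ≤ C') :
    ∀ t ∈ Icc a b, g t ≤ C' := by
  by_cases hne : ∃ s ∈ Icc a b, C ≤ g s
  · exfalso
    have hF : IsCompact (Icc a b ∩ g ⁻¹' Ici C) :=
      isCompact_Icc.of_isClosed_subset (hg.preimage_isClosed_of_isClosed isClosed_Icc isClosed_Ici)
        inter_subset_left
    -- At the first time `r` where the level `C` is reached, `g = C` by continuity, while `g ≤ C` on
    -- `[a, r]` improves to `g ≤ C' < C`.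
    obtain ⟨r, hr, hmin⟩ := hF.exists_isLeast (by obtain ⟨s, hs, hsc⟩ := hne; exact ⟨s, hs, hsc⟩)
    have hrC : C ≤ g r := hr.2
    obtain ⟨q, hq, hqC⟩ := intermediate_value_Icc hr.1.1
      (hg.mono (Icc_subset_Icc le_rfl hr.1.2)) (show C ∈ Icc (g a) (g r) from ⟨by linarith, hrC⟩)
    obtain rfl : q = r :=
      le_antisymm hq.2 (hmin ⟨⟨hq.1, hq.2.trans hr.1.2⟩, show C ≤ g q from hqC.ge⟩)
    have := h q hr.1 (fun t ht => ?_) q ⟨hr.1.1, le_rfl⟩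
    · linarith
    · by_contra! hlt
      obtain rfl : t = q := le_antisymm ht.2 (hmin ⟨⟨ht.1, ht.2.trans hr.1.2⟩, hlt.le⟩)
      linarith
  · push Not at hne
    intro t ht
    exact h b ⟨ht.1.trans ht.2, le_rfl⟩ (fun s hs => (hne s hs).le) t ht

/-! ### Fast scalar equations driven by slow inputs -/

/-- Where `w > r + η` one has `u > r`, so monotonicity leaves `ψ(u) - z ≥ ε` and `w` decreases at
speed `G ε`. The case `ε = 0` gives a bound for all times, the case `ε > 0` an entrance time. -/
theorem fast_upper {w u z ψ : ℝ → ℝ} {a b G ε r η c : ℝ} (hG : 0 ≤ G) (hε : 0 ≤ ε)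
    (hw : AbsolutelyContinuousOnInterval w a b) (hψ : Monotone ψ)
    (hd : ∀ᵐ t, t ∈ Icc a b → HasDerivAt w (-G * (ψ (u t) - z t)) t)
    (hu : ∀ t ∈ Icc a b, |u t - w t| ≤ η) (hz : ∀ t ∈ Icc a b, z t ≤ c) (hr : c + ε ≤ ψ r)
    {t : ℝ} (ht : t ∈ Icc a b) : w t ≤ max (r + η) (w a - G * ε * (t - a)) := by
  refine hw.le_max_of_ae_deriv_le (by positivity) ?_ ht
  filter_upwards [hd] with s h1 hs hlt
  refine ⟨_, h1 hs, ?_⟩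
  have h4 := hψ (by linarith [(abs_le.1 (hu s hs)).1] : r ≤ u s)
  have h5 : ε ≤ ψ (u s) - z s := by linarith [hz s hs]
  nlinarith

theorem fast_bounded {w u z ψ : ℝ → ℝ} {a b G R η A c : ℝ} (hG : 0 ≤ G)
    (hw : AbsolutelyContinuousOnInterval w a b) (hψ : Monotone ψ) (hodd : ∀ x, ψ (-x) = -ψ x)
    (hd : ∀ᵐ t, t ∈ Icc a b → HasDerivAt w (-G * (ψ (u t) - z t)) t)
    (hu : ∀ t ∈ Icc a b, |u t - w t| ≤ η) (hz : ∀ t ∈ Icc a b, |z t| ≤ c) (hr : c ≤ ψ R)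
    (hA : |w a| ≤ A) {t : ℝ} (ht : t ∈ Icc a b) : |w t| ≤ max (R + η) A := by
  have h1 := fast_upper hG le_rfl hw hψ hd hu (fun s hs => (abs_le.1 (hz s hs)).2)
    (by rwa [add_zero]) ht
  have h2 := fast_upper (w := fun t => -w t) (u := fun t => -u t) (z := fun t => -z t)
    (r := R) (c := c) hG le_rfl hw.neg hψ
    (by
      filter_upwards [hd] with s hs hm
      convert! (hs hm).neg using 1
      rw [hodd]; ring)
    (fun s hs => by rw [show -u s - -w s = -(u s - w s) by ring, abs_neg]; exact hu s hs)
    (fun s hs => by linarith [(abs_le.1 (hz s hs)).1]) (by rwa [add_zero]) ht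
  obtain ⟨h3, h4⟩ := abs_le.1 hA
  rw [mul_zero, zero_mul, sub_zero] at h1 h2
  refine abs_le.2 ⟨?_, ?_⟩
  · rcases le_max_iff.1 h2 with h | h <;>
      linarith [le_max_left (R + η) A, le_max_right (R + η) A]
  · rcases le_max_iff.1 h1 with h | h <;>
      linarith [le_max_left (R + η) A, le_max_right (R + η) A]

/-- A fast equation tracks the slowly varying `z`: one-sided version. -/
theorem fast_track_upper {w u z ψ : ℝ → ℝ} {a b G R ε η Cm τ : ℝ} (hG : 0 ≤ G) (hε : 0 ≤ ε)
    (hη : 0 ≤ η) (hR : 0 < R) (hw : AbsolutelyContinuousOnInterval w a b) (hψ : Monotone ψ)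
    (hodd : ∀ x, ψ (-x) = -ψ x) (hcont : Continuous ψ)
    (hd : ∀ᵐ t, t ∈ Icc a b → HasDerivAt w (-G * (ψ (u t) - z t)) t)
    (hu : ∀ t ∈ Icc a b, |u t - w t| ≤ η) (hwC : ∀ t ∈ Icc a b, |w t| ≤ Cm) (hRC : R ≤ Cm)
    (hτ : 0 ≤ τ) (hGτ : 2 * Cm ≤ G * ε * τ)
    (hmod : ∀ x h, |x| ≤ R → |h| ≤ 2 * η → |ψ (x + h) - ψ x| ≤ ε)
    {t : ℝ} (ht : t ∈ Icc (a + τ) b) (hz : ∀ s ∈ Icc (t - τ) t, z s ≤ z t + ε)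
    (hzR : |z t| + 2 * ε ≤ ψ R) :
    ψ (u t) ≤ z t + 3 * ε ∧ ∀ B B', z t ≤ B' → B' + 2 * ε < ψ B → w t ≤ B + η := by
  have ht' : t ∈ Icc a b := ⟨by linarith [ht.1], ht.2⟩
  have hsub : Icc (t - τ) t ⊆ Icc a b := Icc_subset_Icc (by linarith [ht.1]) ht.2
  -- `r` solves `ψ r = z t + 2 ε`. On the window `[t - τ, t]` the input stays below `z t + ε`, which
  -- leaves a margin `ε` for the decrease of `w` above `r + η`.
  obtain ⟨r, hrR, hr⟩ := exists_preimage_of_odd hodd hcont (z := z t + 2 * ε) hR hzR (by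
    refine (abs_add_le _ _).trans ?_
    rw [abs_of_nonneg (by positivity : 0 ≤ 2 * ε)])
  have hmem : t - τ ∈ Icc (t - τ) t := ⟨le_rfl, by linarith⟩
  have h1 := fast_upper (r := r) hG hε (hw.mono_Icc (by linarith [ht.1] : a ≤ t - τ)
    (by linarith) ht.2) hψ (by filter_upwards [hd] with s hs hm using hs (hsub hm))
    (fun s hs => hu s (hsub hs)) hz (by rw [hr]; linarith) (show t ∈ Icc (t - τ) t from
      ⟨by linarith, le_rfl⟩)
  have h2 : w t ≤ r + η := by
    rcases le_max_iff.1 h1 with h | h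
    · exact h
    -- A decrease throughout the window amounts to at least `2 Cm`, and would bring `w` below `-Cm ≤
    -- -R ≤ r`.
    · have h3 := (abs_le.1 (hwC _ (hsub hmem))).2
      have h4 := (abs_le.1 hrR).1
      rw [show t - (t - τ) = τ by ring] at h
      linarith
  constructor
  · have h3 : ψ (u t) ≤ ψ (r + 2 * η) := hψ (by linarith [(abs_le.1 (hu t ht')).2])
    have h4 := (abs_le.1 (hmod r (2 * η) hrR (by rw [abs_of_nonneg (by positivity)]))).2
    linarith
  · intro B B' hB' hlt
    have : r < B := by
      by_contra! hle
      linarith [hψ hle]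
    linarith

theorem fast_track {w u z ψ : ℝ → ℝ} {a b G R ε η Cm τ : ℝ} (hG : 0 ≤ G) (hε : 0 ≤ ε)
    (hη : 0 ≤ η) (hR : 0 < R) (hw : AbsolutelyContinuousOnInterval w a b) (hψ : Monotone ψ)
    (hodd : ∀ x, ψ (-x) = -ψ x) (hcont : Continuous ψ)
    (hd : ∀ᵐ t, t ∈ Icc a b → HasDerivAt w (-G * (ψ (u t) - z t)) t)
    (hu : ∀ t ∈ Icc a b, |u t - w t| ≤ η) (hwC : ∀ t ∈ Icc a b, |w t| ≤ Cm) (hRC : R ≤ Cm)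
    (hτ : 0 ≤ τ) (hGτ : 2 * Cm ≤ G * ε * τ)
    (hmod : ∀ x h, |x| ≤ R → |h| ≤ 2 * η → |ψ (x + h) - ψ x| ≤ ε)
    {t : ℝ} (ht : t ∈ Icc (a + τ) b) (hz : ∀ s ∈ Icc (t - τ) t, |z s - z t| ≤ ε)
    (hzR : |z t| + 2 * ε ≤ ψ R) :
    |ψ (u t) - z t| ≤ 3 * ε ∧ ∀ B B', |z t| ≤ B' → B' + 2 * ε < ψ B → |w t| ≤ B + η := by
  obtain ⟨h1, h2⟩ := fast_track_upper hG hε hη hR hw hψ hodd hcont hd hu hwC hRC hτ hGτ hmod ht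
    (fun s hs => by linarith [(abs_le.1 (hz s hs)).2]) hzR
  obtain ⟨h3, h4⟩ := fast_track_upper (w := fun t => -w t) (u := fun t => -u t)
    (z := fun t => -z t) hG hε hη hR hw.neg hψ hodd hcont
    (by
      filter_upwards [hd] with s hs hm
      convert! (hs hm).neg using 1
      rw [hodd]; ring)
    (fun s hs => by rw [show -u s - -w s = -(u s - w s) by ring, abs_neg]; exact hu s hs)
    (by simpa using hwC) hRC hτ hGτ hmod ht
    (fun s hs => by linarith [(abs_le.1 (hz s hs)).1]) (by rwa [abs_neg])
  rw [hodd] at h3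
  refine ⟨abs_le.2 ⟨by linarith, by linarith⟩, fun B B' hB hlt => ?_⟩
  obtain ⟨h5, h6⟩ := abs_le.1 hB
  have h7 := h2 B B' h6 hlt
  have h8 := h4 B B' (by linarith) hlt
  exact abs_le.2 ⟨by linarith, h7⟩

/-- The bound depends on the families and not on their members, so it is available before the gain
of the fast equation is chosen. -/
theorem exists_chain_bound {S : ℕ → Set (ℝ → ℝ)} {m k : ℕ}
    (hS : ∀ i ∈ Finset.Ico m (m + k), UniformlyIncreasing (S i)) (C : ℝ) :
    ∃ V, 0 < V ∧ ∀ ψ : ℕ → ℝ → ℝ, (∀ i ∈ Finset.Ico m (m + k), ψ i ∈ S i) → ∀ v : ℕ → ℝ,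
      |v m| ≤ C → (∀ i ∈ Finset.Ico m (m + k), v (i + 1) = ψ i (v i)) →
      ∀ i ∈ Finset.Icc m (m + k), |v i| ≤ V := by
  induction k with
  | zero =>
    refine ⟨max C 1, by positivity, fun ψ _ v hv _ i hi => ?_⟩
    obtain rfl : i = m := by simp only [Finset.mem_Icc] at hi; omega
    exact hv.trans (le_max_left _ _)
  | succ k ih =>
    have hsub : ∀ i ∈ Finset.Ico m (m + k), i ∈ Finset.Ico m (m + (k + 1)) := fun i hi => by
      simp only [Finset.mem_Ico] at *; omega
    obtain ⟨V, hV, h⟩ := ih (fun i hi => hS i (hsub i hi))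
    have hk : m + k ∈ Finset.Ico m (m + (k + 1)) := by simp
    obtain ⟨U, hU, hUψ⟩ := (hS _ hk).bounded V
    refine ⟨max V U, by positivity, fun ψ hψ v hv hvψ i hi => ?_⟩
    have h1 := h ψ (fun i hi => hψ i (hsub i hi)) v hv (fun i hi => hvψ i (hsub i hi))
    by_cases hik : i = m + k + 1
    · subst hik
      rw [hvψ _ hk]
      exact (abs_le_of_odd_of_monotone ((hS _ hk).odd _ (hψ _ hk)) ((hS _ hk).mono _ (hψ _ hk))
        (h1 (m + k) (by simp)) (hUψ _ (hψ _ hk))).trans (le_max_right _ _)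
    · exact (h1 i (by simp only [Finset.mem_Icc] at *; omega)).trans (le_max_left _ _)

set_option maxHeartbeats 1000000 in
-- Singular perturbation. During a short transient the slow variables `y_i`, `i > m`, hardly move,
-- while `ψ_m(u_m)` becomes close to `y_{m+1}`. From then on the slow variables form a contracting
-- cascade by induction, and at the end `y_m` is small because `y_{m+1}` is. The point is that the
-- speed of the slow variables is bounded independently of the gain `K_m`, which can therefore be
-- chosen last.
theorem cascadeContracts_succ {S : ℕ → Set (ℝ → ℝ)} {β U : ℝ → ℝ} {c : ℝ} {m n : ℕ}
    (hc : 1 ≤ c) (hmn : m < n) (hS : ∀ i ∈ Finset.Ico m n, UniformlyIncreasing (S i))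
    (ih : CascadeContracts S β U c (m + 1) n) : CascadeContracts S β U c m n := by
  intro A B hA hB
  have hm : m ∈ Finset.Ico m n := by simp [hmn]
  have hmI : m ∈ Finset.Icc m n := by simp [hmn.le]
  have hSm := hS m hm
  have hup : ∀ i ∈ Finset.Icc (m + 1) n, i ∈ Finset.Icc m n := fun i hi => by
    simp only [Finset.mem_Icc] at *; omega
  obtain ⟨β₀, hβ₀, hβ₀ψ⟩ := hSm.pos (B / 2) (by positivity)
  set B' := min B (β₀ / 3) with hB'
  have hB'0 : 0 < B' := by positivity
  -- The slow variables may grow from `A` to `2 A` in the transient. The target `B'` is small enough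
  -- that `ψ_m(B / 2)` exceeds `B' + 2 ε`, which forces `|y_m| ≤ B / 2 + η` at the end.
  obtain ⟨δ, hδ, ih⟩ := ih (2 * A) B' (by positivity) hB'0
  refine ⟨δ, hδ, fun M => ?_⟩
  obtain ⟨K, hK, η', C', T', hη', hC', hT', ih⟩ := ih M
  -- The extra `1` makes `C₁` a strictly weaker a priori bound, as the continuous induction
  -- requires.
  set C₁ := max C' (2 * A) + 1 with hC₁
  have hC₁0 : 0 < C₁ := by positivity
  obtain ⟨R, hR, hRψ⟩ := hSm.growth (C₁ + 2)
  set Cm := max (R + 1) A with hCm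
  have hCm0 : 0 < Cm := by positivity
  have hnm : m + (n - m) = n := by omega
  obtain ⟨V, hV, hVψ⟩ := exists_chain_bound (S := S) (m := m) (k := n - m) (by rwa [hnm]) (Cm + 1)
  rw [hnm] at hVψ
  set Kb := ∑ i ∈ Finset.Icc (m + 1) n, K i with hKb
  have hKi : ∀ i ∈ Finset.Icc (m + 1) n, K i ≤ Kb := fun i hi =>
    Finset.single_le_sum (fun j _ => by linarith [(hK j).2]) hi
  have hKb0 : 0 ≤ Kb := Finset.sum_nonneg (fun j _ => by linarith [(hK j).2])
  -- `W` bounds every `|u_{i+1} - y_{i+1}|` with `i > m`, so the slow variables move at speed at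
  -- most `ω Λ`.
  set W := V + |U V| + C₁ + δ with hW
  have hW0 : 0 < W := by positivity
  set Λ := c * Kb * W + 1 with hΛ
  have hΛ0 : 0 < Λ := by positivity
  set ε := min (min (η' / 3) (B' / 6)) 1 with hε
  have hε0 : 0 < ε := by positivity
  have hε1 : ε ≤ 1 := min_le_right _ _
  have hε2 : 3 * ε ≤ η' := by linarith [(min_le_left _ _ : ε ≤ _).trans (min_le_left _ _)]
  have hε3 : 6 * ε ≤ B' := by linarith [(min_le_left _ _ : ε ≤ _).trans (min_le_right _ _)]
  -- The length of the transient, in units of `1 / ω`: the slow variables change by at most `min ε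
  -- A` in it.
  set θ := min ε A / Λ with hθ
  have hθ0 : 0 < θ := by positivity
  have hΛθ : Λ * θ = min ε A := by rw [hθ]; field_simp
  obtain ⟨η₁, hη₁, hmod⟩ := hSm.modulus R ε hε0
  set η := min (η₁ / 2) (min 1 (B / 2)) with hη
  have hη0 : 0 < η := by positivity
  have hη2 : 2 * η ≤ η₁ := by linarith [(min_le_left _ _ : η ≤ _)]
  have hη1 : η ≤ 1 := (min_le_right _ _).trans (min_le_left _ _)
  have hηB : η ≤ B / 2 := (min_le_right _ _).trans (min_le_right _ _)
  -- Large enough for the fast equation to cross the range `[-Cm, Cm]` within the transient.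
  set Km := max (max M 1) (2 * Cm * c / (ε * θ)) with hKm
  have hKm1 : 2 * Cm * c ≤ Km * (ε * θ) := by
    rw [← div_le_iff₀ (by positivity)]; exact le_max_right _ _
  have hKm0 : 1 ≤ Km := (le_max_right M 1).trans (le_max_left _ _)
  have hKm2 : M ≤ Km := (le_max_left _ _).trans (le_max_left _ _)
  have hRCm : R + 1 ≤ Cm := le_max_left _ _
  have hηCm : max (R + η) A ≤ Cm := max_le_max (by linarith) le_rfl
  have hBB' : B' ≤ B := min_le_left _ _
  have hBβ : B' ≤ β₀ / 3 := min_le_right _ _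
  have hC'₁ : max C' (2 * A) < C₁ := by linarith
  clear_value Km η θ ε Λ W Kb Cm C₁ B'
  refine ⟨Function.update K m Km, fun i => ?_, η, max C₁ Cm, θ + T', hη0, by positivity,
    by positivity, ?_⟩
  · by_cases him : i = m
    · subst him
      rw [Function.update_self]
      exact ⟨hKm2, hKm0⟩
    · rw [Function.update_of_ne him]; exact hK i
  intro ψ hψ ω hω G hG y u a b hab hbT h hyA hu
  have hψm := hψ m hm
  have hGm : ω * Km ≤ c * G m := by simpa using (hG m hmI).1
  have hGm0 : 0 < G m := by
    have : 0 < ω * Km := by positivity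
    by_contra! hneg
    nlinarith
  have hGi : ∀ i ∈ Finset.Icc (m + 1) n, ω * K i ≤ c * G i ∧ G i ≤ ω * (c * K i) := by
    intro i hi
    have := hG i (hup i hi)
    rwa [Function.update_of_ne (by simp only [Finset.mem_Icc] at hi; omega)] at this
  have hGpos : ∀ i ∈ Finset.Icc (m + 1) n, 0 ≤ G i := fun i hi => by
    have h1 := (hGi i hi).1
    have : 0 < ω * K i := mul_pos hω (by linarith [(hK i).2])
    by_contra! hneg
    nlinarith
  -- All estimates are made under the a priori bound `C₁` on the slow variables, and return the
  -- better bound `max C' (2 A)`.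
  have key : ∀ b' ∈ Icc a b, (∀ i ∈ Finset.Icc (m + 1) n, ∀ t ∈ Icc a b', |y i t| ≤ C₁) →
      (∀ i ∈ Finset.Icc (m + 1) n, ∀ t ∈ Icc a b', |y i t| ≤ max C' (2 * A)) ∧
      (∀ t ∈ Icc a b', |y m t| ≤ Cm) ∧
      (b' = a + (θ + T') / ω → ∀ i ∈ Finset.Icc m n, |y i b'| ≤ B) := by
    intro b' hb' hyC
    have hh := h.restrict (le_refl m) le_rfl hb'.1 hb'.2
    have hsub : Icc a b' ⊆ Icc a b := Icc_subset_Icc le_rfl hb'.2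
    have hm1 : m + 1 ∈ Finset.Icc (m + 1) n := by simp; omega
    have hderm : ∀ᵐ t, t ∈ Icc a b' → HasDerivAt (y m) (-G m * (ψ m (u m t) - y (m + 1) t)) t := by
      filter_upwards [hh.deriv m hmI] with t ht hmem
      rw [← hh.output m hm t hmem]
      exact ht hmem
    have hRm := hRψ _ hψm
    have hyCm : ∀ t ∈ Icc a b', |y m t| ≤ Cm := fun t ht =>
      (fast_bounded hGm0.le (hh.ac m hmI) (hSm.mono _ hψm) (hSm.odd _ hψm) hderm
        (fun s hs => hu s (hsub hs)) (hyC _ hm1) (by linarith : C₁ ≤ ψ m R) (hyA m hmI) ht).trans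
        hηCm
    have huV : ∀ t ∈ Icc a b', ∀ i ∈ Finset.Icc m n, |u i t| ≤ V := fun t ht =>
      hVψ ψ hψ (fun i => u i t) (by
        have h1 := hyCm t ht
        have h2 := hu t (hsub ht)
        have h3 := abs_sub_abs_le_abs_sub (u m t) (y m t)
        linarith) (fun i hi => hh.output i hi t ht)
    have hrate : ∀ i ∈ Finset.Icc (m + 1) n, ∀ s ∈ Icc a b', ∀ t ∈ Icc a b', s ≤ t →
        t - s ≤ θ / ω → |y i t - y i s| ≤ min ε A := by
      intro i hi s hs t ht hst hle
      have h1 := ((hh.ac i (hup i hi)).mono_Icc hs.1 hst ht.2).abs_sub_le_of_ae_deriv_le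
        (M := ω * Λ) hst (by
        filter_upwards [hh.deriv i (hup i hi), hh.last_bdd, hh.disturbance] with r h1 h2 h3 hr
        have hr' : r ∈ Icc a b' := ⟨hs.1.trans hr.1, hr.2.trans ht.2⟩
        refine ⟨_, h1 hr', ?_⟩
        have hW' : |u (i + 1) r - y (i + 1) r| ≤ W := by
          refine (abs_sub _ _).trans ?_
          by_cases hin : i = n
          · subst hin
            have h4 := h2 hr' V (huV r hr' i (hup i hi))
            have h5 := h3 hr'
            have h6 := le_abs_self (U V)
            linarith
          · have hi' : i + 1 ∈ Finset.Icc (m + 1) n := by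
              simp only [Finset.mem_Icc] at *; omega
            have h4 := huV r hr' _ (hup _ hi')
            have h5 := hyC _ hi' r hr'
            have h6 := abs_nonneg (U V)
            linarith
        rw [abs_mul, abs_neg, abs_of_nonneg (hGpos i hi)]
        calc G i * |u (i + 1) r - y (i + 1) r| ≤ ω * (c * K i) * W :=
              mul_le_mul (hGi i hi).2 hW' (abs_nonneg _) ((hGpos i hi).trans (hGi i hi).2)
          _ ≤ ω * (c * Kb) * W := by gcongr; exact hKi i hi
          _ ≤ ω * Λ := by rw [hΛ]; nlinarith)
      refine h1.trans ?_
      rw [← hΛθ]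
      calc ω * Λ * (t - s) ≤ ω * Λ * (θ / ω) := by gcongr
        _ = Λ * θ := by field_simp
    have hθω : 0 < θ / ω := by positivity
    have htransient : ∀ i ∈ Finset.Icc (m + 1) n, ∀ t ∈ Icc a b', t ≤ a + θ / ω →
        |y i t| ≤ 2 * A := by
      intro i hi t ht hle
      have h1 := hrate i hi a ⟨le_rfl, hb'.1⟩ t ht ht.1 (by linarith)
      have h2 := hyA i (hup i hi)
      have h3 := abs_sub_abs_le_abs_sub (y i t) (y i a)
      linarith [min_le_right ε A]
    have htrack : ∀ t ∈ Icc (a + θ / ω) b', |ψ m (u m t) - y (m + 1) t| ≤ 3 * ε ∧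
        ∀ D D', |y (m + 1) t| ≤ D' → D' + 2 * ε < ψ m D → |y m t| ≤ D + η := by
      intro t ht
      have ht' : t ∈ Icc a b' := ⟨by linarith [ht.1], ht.2⟩
      refine fast_track (Cm := Cm) hGm0.le hε0.le hη0.le hR (hh.ac m hmI) (hSm.mono _ hψm)
        (hSm.odd _ hψm) (hSm.continuous _ hψm) hderm (fun s hs => hu s (hsub hs)) hyCm
        (by linarith) hθω.le ?_
        (fun x h hx hh' => hmod _ hψm x h hx (hh'.trans hη2)) ht (fun s hs => ?_) ?_
      · rw [mul_div_assoc', le_div_iff₀ hω]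
        have h1 : ω * (2 * Cm * c) ≤ c * (G m * ε * θ) := by
          calc ω * (2 * Cm * c) ≤ ω * (Km * (ε * θ)) := by gcongr
            _ = (ω * Km) * (ε * θ) := by ring
            _ ≤ c * G m * (ε * θ) := by gcongr
            _ = _ := by ring
        nlinarith
      · rw [abs_sub_comm]
        exact (hrate _ hm1 s ⟨by linarith [hs.1, ht.1], hs.2.trans ht.2⟩ t ht' hs.2
          (by linarith [hs.1])).trans (min_le_left _ _)
      · linarith [hyC _ hm1 t ht']
    -- After the transient `|u_{m+1} - y_{m+1}| ≤ 3 ε ≤ η'`, so the induction hypothesis applies to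
    -- the chain from `m + 1`.
    have htail : a + θ / ω ≤ b' →
        (∀ i ∈ Finset.Icc (m + 1) n, ∀ t ∈ Icc (a + θ / ω) b', |y i t| ≤ C') ∧
        (b' = a + θ / ω + T' / ω → ∀ i ∈ Finset.Icc (m + 1) n, |y i b'| ≤ B') := by
      intro hle
      refine ih ψ (fun i hi => hψ i (by simp only [Finset.mem_Ico] at *; omega)) ω hω G hGi y u
        (a + θ / ω) b' hle ?_ (h.restrict (by omega) (by linarith) hle hb'.2)
        (fun i hi => htransient i hi _ ⟨by linarith, hle⟩ le_rfl) (fun t ht => ?_)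
      · have := hb'.2.trans hbT
        rwa [add_div, ← add_assoc] at this
      · rw [hh.output m hm t ⟨by linarith [ht.1], ht.2⟩]
        exact (htrack t ht).1.trans hε2
    refine ⟨fun i hi t ht => ?_, hyCm, fun hbe i hi => ?_⟩
    · rcases le_total t (a + θ / ω) with hle | hle
      · exact (htransient i hi t ht hle).trans (le_max_right _ _)
      · exact ((htail (hle.trans ht.2)).1 i hi t ⟨hle, ht.2⟩).trans (le_max_left _ _)
    · have hT'ω : 0 < T' / ω := by positivity
      have hbe' : b' = a + θ / ω + T' / ω := by rw [hbe, add_div, add_assoc]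
      have hfin := (htail (by linarith)).2 hbe'
      by_cases him : i = m
      · subst him
        have h1 := (htrack b' ⟨by linarith, le_rfl⟩).2 (B / 2) B' (hfin _ hm1) (by
          have h2 := hβ₀ψ _ hψm
          linarith)
        linarith
      · exact (hfin i (by simp only [Finset.mem_Icc] at *; omega)).trans hBB'
  have hcontrol : ∀ i ∈ Finset.Icc (m + 1) n, ∀ t ∈ Icc a b, |y i t| ≤ max C' (2 * A) := by
    -- The slow variables are collected into one sup norm, to which the scalar continuous induction
    -- applies.
    have hnorm : ∀ (D : ℝ), 0 ≤ D → ∀ t, ‖fun i : Finset.Icc (m + 1) n => y i t‖ ≤ D ↔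
        ∀ i ∈ Finset.Icc (m + 1) n, |y i t| ≤ D := fun D hD t => by
      rw [pi_norm_le_iff_of_nonneg hD]
      simp [Real.norm_eq_abs]
    have hmax : 0 ≤ max C' (2 * A) := by positivity
    have hle := le_of_improving_bound (C := C₁) (C' := max C' (2 * A))
      (g := fun t => ‖fun i : Finset.Icc (m + 1) n => y i t‖) (a := a) (b := b)
      (ContinuousOn.norm (continuousOn_pi.2 fun i =>
        (h.ac i (hup i i.2)).continuousOn_Icc hab)) (by linarith)
      ((hnorm _ hmax a).2 fun i hi => (hyA i (hup i hi)).trans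
        (le_trans (by linarith) (le_max_right _ _)))
      (fun b' hb' hC t ht => (hnorm _ hmax t).2 fun i hi => (key b' hb' (fun i hi t ht =>
        (hnorm _ hC₁0.le t).1 (hC t ht) i hi)).1 i hi t ht)
    exact fun i hi t ht => (hnorm _ hmax t).1 (hle t ht) i hi
  obtain ⟨-, h2, h3⟩ := key b ⟨hab, le_rfl⟩ fun i hi t ht => (hcontrol i hi t ht).trans (by linarith)
  refine ⟨fun i hi t ht => ?_, h3⟩
  by_cases him : i = m
  · subst him
    exact (h2 t ht).trans (le_max_right _ _)
  · have h4 := hcontrol i (by simp only [Finset.mem_Icc] at *; omega) t ht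
    exact (h4.trans hC'₁.le).trans (le_max_left _ _)

theorem cascadeContracts {S : ℕ → Set (ℝ → ℝ)} {β U : ℝ → ℝ} {c : ℝ} {m n : ℕ}
    (hc : 1 ≤ c) (hmn : m ≤ n) (hS : ∀ i ∈ Finset.Ico m n, UniformlyIncreasing (S i))
    (hβ : ∀ r, 0 < r → 0 < β r) : CascadeContracts S β U c m n := by
  induction hmn using Nat.decreasingInduction with
  | of_succ m hm ih =>
    exact cascadeContracts_succ hc hm hS
      (ih fun i hi => hS i (by simp only [Finset.mem_Ico] at *; omega))
  | self => exact cascadeContracts_last S U n (by linarith) hβ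

/-! ### Signed powers -/

theorem signedPow_neg (z p : ℝ) : signedPow (-z) p = -signedPow z p := by
  simp [signedPow, Real.sign_neg]

theorem signedPow_zero_left (p : ℝ) : signedPow 0 p = 0 := by simp [signedPow]

theorem signedPow_of_pos {z : ℝ} (hz : 0 < z) (p : ℝ) : signedPow z p = z ^ p := by
  simp [signedPow, abs_of_pos hz, Real.sign_of_pos hz]

theorem signedPow_of_neg {z : ℝ} (hz : z < 0) (p : ℝ) : signedPow z p = -(-z) ^ p := by
  rw [← signedPow_of_pos (neg_pos.2 hz), signedPow_neg, neg_neg]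

theorem signedPow_nonneg {z : ℝ} (hz : 0 ≤ z) (p : ℝ) : 0 ≤ signedPow z p := by
  rcases hz.eq_or_lt with rfl | hz
  · rw [signedPow_zero_left]
  · rw [signedPow_of_pos hz]; positivity

theorem monotone_of_odd {f : ℝ → ℝ} (hodd : ∀ x, f (-x) = -f x) (hpos : ∀ x, 0 ≤ x → 0 ≤ f x)
    (h : ∀ x y, 0 < x → x ≤ y → f x ≤ f y) : Monotone f := by
  have h0 : ∀ x, x ≤ 0 → f x ≤ 0 := fun x hx => by
    have := hpos (-x) (by linarith)
    rw [hodd] at this; linarith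
  intro x y hxy
  rcases lt_or_ge 0 x with hx | hx
  · exact h x y hx hxy
  · rcases lt_or_ge y 0 with hy | hy
    · have := h (-y) (-x) (by linarith) (by linarith)
      rw [hodd, hodd] at this; linarith
    · exact (h0 x hx).trans (hpos y hy)

theorem signedPow_monotone {p : ℝ} (hp : 0 ≤ p) : Monotone fun z => signedPow z p :=
  monotone_of_odd (fun x => signedPow_neg x p) (fun _ hx => signedPow_nonneg hx p)
    fun x y hx hxy => by
      rw [signedPow_of_pos hx, signedPow_of_pos (hx.trans_le hxy)]
      exact Real.rpow_le_rpow hx.le hxy hp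

theorem continuous_signedPow {p : ℝ} (hp : 0 < p) : Continuous fun z => signedPow z p := by
  have h : (fun z => signedPow z p) = fun z => (max z 0) ^ p - (max (-z) 0) ^ p := by
    ext z
    rcases lt_trichotomy z 0 with hz | rfl | hz
    · rw [signedPow_of_neg hz, max_eq_right hz.le, max_eq_left (by linarith),
        Real.zero_rpow hp.ne', zero_sub]
    · simp [signedPow_zero_left]
    · rw [signedPow_of_pos hz, max_eq_left hz.le, max_eq_right (by linarith),
        Real.zero_rpow hp.ne', sub_zero]
  rw [h]
  exact ((continuous_id.max continuous_const).rpow_const fun _ => Or.inr hp.le).sub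
    ((continuous_neg.max continuous_const).rpow_const fun _ => Or.inr hp.le)

theorem signedPow_mul {c : ℝ} (hc : 0 < c) (z p : ℝ) :
    signedPow (c * z) p = c ^ p * signedPow z p := by
  rcases lt_trichotomy z 0 with hz | rfl | hz
  · rw [signedPow_of_neg hz, signedPow_of_neg (mul_neg_of_pos_of_neg hc hz), ← mul_neg,
      Real.mul_rpow hc.le (by linarith), mul_neg]
  · simp [signedPow_zero_left]
  · rw [signedPow_of_pos hz, signedPow_of_pos (mul_pos hc hz), Real.mul_rpow hc.le hz.le]

/-! ### Convex combinations of two signed powers -/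

/-- The convex combination `l ⌈x⌋^p + (1 - l) ⌈x⌋^q`. -/
def blend (p q l x : ℝ) : ℝ := l * signedPow x p + (1 - l) * signedPow x q

theorem blend_neg (p q l x : ℝ) : blend p q l (-x) = -blend p q l x := by
  simp only [blend, signedPow_neg]; ring

theorem blend_monotone {p q l : ℝ} (hp : 0 ≤ p) (hq : 0 ≤ q) (hl : l ∈ Icc (0 : ℝ) 1) :
    Monotone (blend p q l) := fun x y hxy => by
  have h1 := signedPow_monotone hp hxy
  have h2 := signedPow_monotone hq hxy
  have h3 : 0 ≤ 1 - l := by linarith [hl.2]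
  have h4 := hl.1
  simp only [blend] at *
  gcongr

theorem le_blend {p q l x b : ℝ} (hl : l ∈ Icc (0 : ℝ) 1) (h1 : b ≤ signedPow x p)
    (h2 : b ≤ signedPow x q) : b ≤ blend p q l x := by
  have h3 : 0 ≤ 1 - l := by linarith [hl.2]
  have h4 := hl.1
  unfold blend
  nlinarith

theorem blend_le {p q l x b : ℝ} (hl : l ∈ Icc (0 : ℝ) 1) (h1 : signedPow x p ≤ b)
    (h2 : signedPow x q ≤ b) : blend p q l x ≤ b := by
  have h3 : 0 ≤ 1 - l := by linarith [hl.2]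
  have h4 := hl.1
  unfold blend
  nlinarith

/-- The family of all convex combinations of `⌈x⌋^p` and `⌈x⌋^q`. -/
def blends (p q : ℝ) : Set (ℝ → ℝ) := blend p q '' Icc 0 1

theorem exists_modulus {f : ℝ → ℝ} (hf : Continuous f) (C ε : ℝ) (hε : 0 < ε) :
    ∃ η, 0 < η ∧ ∀ x h, |x| ≤ C → |h| ≤ η → |f (x + h) - f x| ≤ ε := by
  have hu := (isCompact_Icc (a := -C - 1) (b := C + 1)).uniformContinuousOn_of_continuous
    hf.continuousOn
  rw [Metric.uniformContinuousOn_iff] at hu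
  obtain ⟨δ, hδ, hu⟩ := hu ε hε
  refine ⟨min (δ / 2) 1, by positivity, fun x h hx hh => ?_⟩
  have h1 := abs_le.1 hx
  have h2 := abs_le.1 (hh.trans (min_le_right _ _))
  have h3 := hh.trans (min_le_left _ _)
  have := hu (x + h) ⟨by linarith, by linarith⟩ x ⟨by linarith, by linarith⟩ (by
    rw [Real.dist_eq, add_sub_cancel_left]; linarith)
  rw [Real.dist_eq] at this
  exact this.le

/-- Each property holds for the two powers and passes to convex combinations with the same
constants. Both exponents must be positive, which excludes the last injection: its exponent may
vanish, and it enters only through sector bounds. -/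
theorem uniformlyIncreasing_blends {p q : ℝ} (hp : 0 < p) (hq : 0 < q) :
    UniformlyIncreasing (blends p q) where
  odd := by rintro _ ⟨l, -, rfl⟩ x; exact blend_neg p q l x
  mono := by rintro _ ⟨l, hl, rfl⟩; exact blend_monotone hp.le hq.le hl
  continuous := by
    rintro _ ⟨l, -, rfl⟩
    exact ((continuous_signedPow hp).const_mul _).add ((continuous_signedPow hq).const_mul _)
  pos := fun b hb => ⟨min (b ^ p) (b ^ q), by positivity, by
    rintro _ ⟨l, hl, rfl⟩
    exact le_blend hl (by rw [signedPow_of_pos hb]; exact min_le_left _ _)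
      (by rw [signedPow_of_pos hb]; exact min_le_right _ _)⟩
  growth := fun C => by
    obtain ⟨R, hR, h1, h2⟩ := ((eventually_gt_atTop 0).and
      (((tendsto_rpow_atTop hp).eventually_ge_atTop C).and
        ((tendsto_rpow_atTop hq).eventually_ge_atTop C))).exists
    refine ⟨R, hR, ?_⟩
    rintro _ ⟨l, hl, rfl⟩
    exact le_blend hl (by rwa [signedPow_of_pos hR]) (by rwa [signedPow_of_pos hR])
  bounded := fun C => ⟨|signedPow C p| + |signedPow C q| + 1, by positivity, by
    rintro _ ⟨l, hl, rfl⟩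
    have h1 := abs_nonneg (signedPow C p)
    have h2 := abs_nonneg (signedPow C q)
    exact blend_le hl (by linarith [le_abs_self (signedPow C p)])
      (by linarith [le_abs_self (signedPow C q)])⟩
  modulus := fun C ε hε => by
    obtain ⟨η₁, h1, hη₁⟩ := exists_modulus (continuous_signedPow hp) C ε hε
    obtain ⟨η₂, h2, hη₂⟩ := exists_modulus (continuous_signedPow hq) C ε hε
    refine ⟨min η₁ η₂, by positivity, ?_⟩
    rintro _ ⟨l, hl, rfl⟩ x h hx hh
    have h3 := abs_le.1 (hη₁ x h hx (hh.trans (min_le_left _ _)))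
    have h4 := abs_le.1 (hη₂ x h hx (hh.trans (min_le_right _ _)))
    have h5 : 0 ≤ 1 - l := by linarith [hl.2]
    have h6 := hl.1
    unfold blend
    refine abs_le.2 ⟨by nlinarith, by nlinarith⟩

/-! ### Weights and injections -/

theorem weight_succ_eq (n : ℕ) (d : ℝ) (i : ℕ) : weight n d (i + 1) = weight n d i + d := by
  simp only [weight]; push_cast; ring

theorem weight_pos {n : ℕ} {d : ℝ} (hn : 2 ≤ n) (hd : d < 1 / ((n : ℝ) - 1)) {i : ℕ} (hi : 1 ≤ i)
    (hin : i ≤ n) : 0 < weight n d i := by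
  have hn' : (2 : ℝ) ≤ n := by exact_mod_cast hn
  have hi' : (1 : ℝ) ≤ i := by exact_mod_cast hi
  have hin' : (i : ℝ) ≤ n := by exact_mod_cast hin
  rw [lt_div_iff₀ (by linarith)] at hd
  unfold weight
  rcases le_total d 0 with h | h <;> nlinarith

theorem weight_last {n : ℕ} {d : ℝ} : weight n d (n + 1) = 1 + d := by
  simp only [weight]; push_cast; ring

theorem weight_nonneg {n : ℕ} {d : ℝ} (hn : 2 ≤ n) (hd : d < 1 / ((n : ℝ) - 1)) (hd' : -1 ≤ d)
    {i : ℕ} (hi : 1 ≤ i) (hin : i ≤ n + 1) : 0 ≤ weight n d i := by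
  rcases eq_or_lt_of_le hin with rfl | h
  · rw [weight_last]; linarith
  · exact (weight_pos hn hd hi (by omega)).le

/-- After cross-multiplication the terms in `d₀ * dinf` cancel and `d₀ ≤ dinf` remains. Hence the
`κ` power dominates near zero and the `θ` power near infinity. -/
theorem weight_ratio_le {n : ℕ} {d₀ dinf : ℝ} (hd : d₀ ≤ dinf) {i : ℕ}
    (h0 : 0 < weight n d₀ i) (h1 : 0 < weight n dinf i) :
    weight n d₀ (i + 1) / weight n d₀ i ≤ weight n dinf (i + 1) / weight n dinf i := by
  rw [div_le_div_iff₀ h0 h1, weight_succ_eq, weight_succ_eq]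
  simp only [weight]
  nlinarith

/-- The standing assumptions on the parameters of the differentiator. -/
structure Admissible (n : ℕ) (d₀ dinf : ℝ) (κ θ : ℕ → ℝ) : Prop where
  two_le : 2 ≤ n
  neg_one_le : -1 ≤ d₀
  le : d₀ ≤ dinf
  lt : dinf < 1 / ((n : ℝ) - 1)
  kappa_pos : ∀ i ∈ Finset.Icc 1 n, 0 < κ i
  theta_pos : ∀ i ∈ Finset.Icc 1 n, 0 < θ i

/-- The exponent `r_{i+1} / r_i`. -/
def expo (n : ℕ) (d : ℝ) (i : ℕ) : ℝ := weight n d (i + 1) / weight n d i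

namespace Admissible

variable {n : ℕ} {d₀ dinf : ℝ} {κ θ : ℕ → ℝ} (H : Admissible n d₀ dinf κ θ)
include H

theorem weight₀_pos {i : ℕ} (hi : 1 ≤ i) (hin : i ≤ n) : 0 < weight n d₀ i :=
  weight_pos H.two_le (H.le.trans_lt H.lt) hi hin

theorem weightInf_pos {i : ℕ} (hi : 1 ≤ i) (hin : i ≤ n) : 0 < weight n dinf i :=
  weight_pos H.two_le H.lt hi hin

theorem weight₀_nonneg {i : ℕ} (hi : 1 ≤ i) (hin : i ≤ n + 1) : 0 ≤ weight n d₀ i :=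
  weight_nonneg H.two_le (H.le.trans_lt H.lt) H.neg_one_le hi hin

theorem expo₀_nonneg {i : ℕ} (hi : 1 ≤ i) (hin : i ≤ n) : 0 ≤ expo n d₀ i :=
  div_nonneg (H.weight₀_nonneg (by omega) (by omega)) (H.weight₀_pos hi hin).le

theorem expo_le {i : ℕ} (hi : 1 ≤ i) (hin : i ≤ n) : expo n d₀ i ≤ expo n dinf i :=
  weight_ratio_le H.le (H.weight₀_pos hi hin) (H.weightInf_pos hi hin)

theorem expoInf_nonneg {i : ℕ} (hi : 1 ≤ i) (hin : i ≤ n) : 0 ≤ expo n dinf i :=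
  (H.expo₀_nonneg hi hin).trans (H.expo_le hi hin)

theorem expo₀_pos {i : ℕ} (hi : 1 ≤ i) (hin : i < n) : 0 < expo n d₀ i :=
  div_pos (H.weight₀_pos (by omega) (by omega)) (H.weight₀_pos hi hin.le)

theorem expoInf_pos {i : ℕ} (hi : 1 ≤ i) (hin : i < n) : 0 < expo n dinf i :=
  (H.expo₀_pos hi hin).trans_le (H.expo_le hi hin.le)

theorem kappa_pos' {i : ℕ} (hi : 1 ≤ i) (hin : i ≤ n) : 0 < κ i :=
  H.kappa_pos i (Finset.mem_Icc.2 ⟨hi, hin⟩)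

theorem theta_pos' {i : ℕ} (hi : 1 ≤ i) (hin : i ≤ n) : 0 < θ i :=
  H.theta_pos i (Finset.mem_Icc.2 ⟨hi, hin⟩)

omit H in
theorem varphi_eq (i : ℕ) (s : ℝ) : varphi n d₀ dinf κ θ i s =
    κ i * signedPow s (expo n d₀ i) + θ i * signedPow s (expo n dinf i) := rfl

omit H in
theorem varphi_of_pos {s : ℝ} (hs : 0 < s) (i : ℕ) : varphi n d₀ dinf κ θ i s =
    κ i * s ^ expo n d₀ i + θ i * s ^ expo n dinf i := by
  rw [varphi_eq, signedPow_of_pos hs, signedPow_of_pos hs]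

theorem varphi_monotone {i : ℕ} (hi : 1 ≤ i) (hin : i ≤ n) :
    Monotone (varphi n d₀ dinf κ θ i) := fun x y hxy => by
  have h1 := signedPow_monotone (H.expo₀_nonneg hi hin) hxy
  have h2 := signedPow_monotone (H.expoInf_nonneg hi hin) hxy
  have h3 := H.kappa_pos' hi hin
  have h4 := H.theta_pos' hi hin
  simp only [varphi_eq] at *
  gcongr

theorem varphi_pos {i : ℕ} (hi : 1 ≤ i) (hin : i ≤ n) {s : ℝ} (hs : 0 < s) :
    0 < varphi n d₀ dinf κ θ i s := by
  have h3 := H.kappa_pos' hi hin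
  have h4 := H.theta_pos' hi hin
  rw [varphi_of_pos hs]
  positivity

/-- The mixing coefficient of `φ_i` at the scale `Φ`. -/
theorem exists_varphi_mul {i : ℕ} (hi : 1 ≤ i) (hin : i ≤ n) {Φ : ℝ} (hΦ : 0 < Φ) :
    ∃ l ∈ Icc (0 : ℝ) 1, ∀ x, varphi n d₀ dinf κ θ i (Φ * x) =
      varphi n d₀ dinf κ θ i Φ * blend (expo n d₀ i) (expo n dinf i) l x := by
  have h3 := H.kappa_pos' hi hin
  have h4 := H.theta_pos' hi hin
  have hpos := H.varphi_pos hi hin hΦ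
  have heq := varphi_of_pos (n := n) (d₀ := d₀) (dinf := dinf) (κ := κ) (θ := θ) hΦ i
  -- The weight is the share of the `κ` term in the value at `Φ`; the `θ` term has the complementary
  -- share.
  refine ⟨κ i * Φ ^ expo n d₀ i / varphi n d₀ dinf κ θ i Φ, ⟨by positivity, ?_⟩, fun x => ?_⟩
  · rw [div_le_one hpos, heq]
    linarith [show 0 < θ i * Φ ^ expo n dinf i by positivity]
  · rw [varphi_eq, signedPow_mul hΦ, signedPow_mul hΦ, blend]
    have h5 : 1 - κ i * Φ ^ expo n d₀ i / varphi n d₀ dinf κ θ i Φ =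
        θ i * Φ ^ expo n dinf i / varphi n d₀ dinf κ θ i Φ := by
      rw [eq_div_iff hpos.ne', sub_mul, div_mul_cancel₀ _ hpos.ne', heq]; ring
    rw [h5]
    field_simp

theorem varphi_continuous {i : ℕ} (hi : 1 ≤ i) (hin : i < n) :
    Continuous (varphi n d₀ dinf κ θ i) :=
  ((continuous_signedPow (H.expo₀_pos hi hin)).const_mul _).add
    ((continuous_signedPow (H.expoInf_pos hi hin)).const_mul _)

theorem varphi_tendsto_atTop {i : ℕ} (hi : 1 ≤ i) (hin : i < n) :
    Tendsto (varphi n d₀ dinf κ θ i) atTop atTop := by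
  have h1 := (tendsto_rpow_atTop (H.expoInf_pos hi hin)).const_mul_atTop (H.theta_pos' hi hin.le)
  refine tendsto_atTop_mono' _ ?_ h1
  filter_upwards [eventually_gt_atTop 0] with s hs
  have h3 := H.kappa_pos' hi hin.le
  rw [varphi_of_pos hs]
  linarith [show 0 < κ i * s ^ expo n d₀ i by positivity]

omit H in
theorem varphi_neg (i : ℕ) (s : ℝ) :
    varphi n d₀ dinf κ θ i (-s) = -varphi n d₀ dinf κ θ i s := by
  simp only [varphi_eq, signedPow_neg]; ring

omit H in
theorem injection_neg (i : ℕ) (s : ℝ) :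
    injection n d₀ dinf κ θ i (-s) = -injection n d₀ dinf κ θ i s := by
  induction i with
  | zero => rfl
  | succ i ih => simp only [injection, ih, varphi_neg]

omit H in
theorem injection_zero_right (i : ℕ) : injection n d₀ dinf κ θ i 0 = 0 := by
  have := injection_neg (n := n) (d₀ := d₀) (dinf := dinf) (κ := κ) (θ := θ) i 0
  rw [neg_zero] at this
  linarith

theorem injection_pos {i : ℕ} (hin : i ≤ n) {s : ℝ} (hs : 0 < s) :
    0 < injection n d₀ dinf κ θ i s := by
  induction i with
  | zero => exact hs
  | succ i ih => exact H.varphi_pos (by omega) hin (ih (by omega))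

theorem injection_monotone {i : ℕ} (hin : i ≤ n) : Monotone (injection n d₀ dinf κ θ i) := by
  induction i with
  | zero => exact monotone_id
  | succ i ih => exact (H.varphi_monotone (by omega) hin).comp (ih (by omega))

theorem injection_continuous {i : ℕ} (hin : i < n) : Continuous (injection n d₀ dinf κ θ i) := by
  induction i with
  | zero => exact continuous_id
  | succ i ih => exact (H.varphi_continuous (by omega) hin).comp (ih (by omega))

theorem injection_tendsto_atTop {i : ℕ} (hin : i < n) :
    Tendsto (injection n d₀ dinf κ θ i) atTop atTop := by
  induction i with
  | zero => exact tendsto_id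
  | succ i ih => exact (H.varphi_tendsto_atTop (by omega) hin).comp (ih (by omega))

/-- Halving the argument reduces the injections at most by a constant factor. -/
theorem exists_injection_half {i : ℕ} (hin : i ≤ n) : ∃ B, 0 < B ∧ ∀ s, 0 < s →
    B * injection n d₀ dinf κ θ i s ≤ injection n d₀ dinf κ θ i (s / 2) := by
  induction i with
  | zero => exact ⟨1 / 2, by norm_num, fun s _ => by simp only [injection]; linarith⟩
  | succ i ih =>
    obtain ⟨B, hB, h⟩ := ih (by omega)
    refine ⟨min (B ^ expo n d₀ (i + 1)) (B ^ expo n dinf (i + 1)), by positivity, fun s hs => ?_⟩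
    have hΦ := H.injection_pos (by omega : i ≤ n) hs
    obtain ⟨l, hl, hmul⟩ := H.exists_varphi_mul (by omega : 1 ≤ i + 1) hin hΦ
    have h1 := H.varphi_monotone (by omega) hin (h s hs)
    rw [mul_comm B, hmul] at h1
    refine le_trans ?_ h1
    rw [mul_comm]
    refine mul_le_mul_of_nonneg_left ?_ (H.varphi_pos (by omega) hin hΦ).le
    exact le_blend hl (by rw [signedPow_of_pos hB]; exact min_le_left _ _)
      (by rw [signedPow_of_pos hB]; exact min_le_right _ _)

/-! ### Power-law asymptotics of the injections -/

omit H in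
-- Where the power `q` is dominated by the power `p`, applying the sum of the two powers to a
-- function comparable to `g` gives one comparable to `g ^ p`. It serves with `p` the exponent for
-- `d₀` at small scales and the one for `dinf` at large scales.
theorem comparable_step {D : Set ℝ} {x g : ℝ → ℝ} {a b p q M c₁ c₂ : ℝ} (ha : 0 < a) (hb : 0 ≤ b)
    (hp : 0 ≤ p) (hc₁ : 0 < c₁) (hc₂ : 0 < c₂) (hg : ∀ s ∈ D, 0 < g s)
    (h1 : ∀ s ∈ D, c₁ * g s ≤ x s) (h2 : ∀ s ∈ D, x s ≤ c₂ * g s)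
    (hM : ∀ s ∈ D, x s ^ q ≤ M * x s ^ p) (hM0 : 0 ≤ M) :
    ∃ e₁ e₂, 0 < e₁ ∧ 0 < e₂ ∧ ∀ s ∈ D, e₁ * g s ^ p ≤ a * x s ^ p + b * x s ^ q ∧
      a * x s ^ p + b * x s ^ q ≤ e₂ * g s ^ p := by
  refine ⟨a * c₁ ^ p, (a + b * M) * c₂ ^ p, by positivity, by positivity, fun s hs => ?_⟩
  have hgs := hg s hs
  have hx : 0 < x s := (by positivity : 0 < c₁ * g s).trans_le (h1 s hs)
  have h3 : c₁ ^ p * g s ^ p ≤ x s ^ p := by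
    rw [← Real.mul_rpow hc₁.le hgs.le]
    exact Real.rpow_le_rpow (by positivity) (h1 s hs) hp
  have h4 : x s ^ p ≤ c₂ ^ p * g s ^ p := by
    rw [← Real.mul_rpow hc₂.le hgs.le]
    exact Real.rpow_le_rpow hx.le (h2 s hs) hp
  constructor
  · have : 0 ≤ b * x s ^ q := by positivity
    nlinarith
  · calc a * x s ^ p + b * x s ^ q ≤ a * x s ^ p + b * (M * x s ^ p) := by gcongr; exact hM s hs
      _ = (a + b * M) * x s ^ p := by ring
      _ ≤ (a + b * M) * (c₂ ^ p * g s ^ p) := by gcongr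
      _ = _ := by ring

/-- For `s ≤ 1` the previous injection is bounded above, so the smaller exponent dominates; the
exponents `r_{j+1} / r_j` multiply and telescope. -/
theorem injection_comparable_small {i : ℕ} (hin : i ≤ n) : ∃ c₁ c₂, 0 < c₁ ∧ 0 < c₂ ∧
    ∀ s ∈ Ioc (0 : ℝ) 1,
      c₁ * s ^ (weight n d₀ (i + 1) / weight n d₀ 1) ≤ injection n d₀ dinf κ θ i s ∧
      injection n d₀ dinf κ θ i s ≤ c₂ * s ^ (weight n d₀ (i + 1) / weight n d₀ 1) := by
  have hw1 := H.weight₀_pos le_rfl (by linarith [H.two_le])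
  induction i with
  | zero => exact ⟨1, 1, one_pos, one_pos, fun s hs => by simp [div_self hw1.ne', injection]⟩
  | succ i ih =>
    obtain ⟨c₁, c₂, hc₁, hc₂, h⟩ := ih (by omega)
    have hwi := H.weight₀_pos (by omega : 1 ≤ i + 1) hin
    have hle : ∀ s ∈ Ioc (0 : ℝ) 1, injection n d₀ dinf κ θ i s ≤ c₂ := fun s hs =>
      (h s hs).2.trans (mul_le_of_le_one_right hc₂.le
        (Real.rpow_le_one hs.1.le hs.2 (by positivity)))
    obtain ⟨e₁, e₂, he₁, he₂, he⟩ := comparable_step (D := Ioc (0 : ℝ) 1)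
      (x := injection n d₀ dinf κ θ i) (g := fun s => s ^ (weight n d₀ (i + 1) / weight n d₀ 1))
      (q := expo n dinf (i + 1)) (M := c₂ ^ (expo n dinf (i + 1) - expo n d₀ (i + 1)))
      (H.kappa_pos' (by omega) hin) (H.theta_pos' (by omega) hin).le
      (H.expo₀_nonneg (by omega) hin) hc₁ hc₂ (fun s hs => Real.rpow_pos_of_pos hs.1 _)
      (fun s hs => (h s hs).1) (fun s hs => (h s hs).2) (fun s hs => by
        have hx := H.injection_pos (by omega : i ≤ n) hs.1
        rw [← sub_add_cancel (expo n dinf (i + 1)) (expo n d₀ (i + 1)), Real.rpow_add hx,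
          add_sub_cancel_right]
        gcongr
        · linarith [H.expo_le (by omega : 1 ≤ i + 1) hin]
        · exact hle s hs) (by positivity)
    refine ⟨e₁, e₂, he₁, he₂, fun s hs => ?_⟩
    have h1 := he s hs
    rw [← Real.rpow_mul hs.1.le, expo, div_mul_div_comm, mul_comm (weight n d₀ (i + 1)),
      mul_div_mul_right _ _ hwi.ne'] at h1
    rw [injection, varphi_of_pos (H.injection_pos (by omega) hs.1)]
    exact h1

/-- For `s ≥ 1` the previous injection is bounded away from zero, so the larger exponent dominates.
-/
theorem injection_comparable_large {i : ℕ} (hin : i ≤ n) : ∃ c₁ c₂, 0 < c₁ ∧ 0 < c₂ ∧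
    ∀ s ∈ Ici (1 : ℝ),
      c₁ * s ^ (weight n dinf (i + 1) / weight n dinf 1) ≤ injection n d₀ dinf κ θ i s ∧
      injection n d₀ dinf κ θ i s ≤ c₂ * s ^ (weight n dinf (i + 1) / weight n dinf 1) := by
  have hw1 := H.weightInf_pos le_rfl (by linarith [H.two_le])
  induction i with
  | zero => exact ⟨1, 1, one_pos, one_pos, fun s hs => by simp [div_self hw1.ne', injection]⟩
  | succ i ih =>
    obtain ⟨c₁, c₂, hc₁, hc₂, h⟩ := ih (by omega)
    have hwi := H.weightInf_pos (by omega : 1 ≤ i + 1) hin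
    have hle : ∀ s ∈ Ici (1 : ℝ), c₁ ≤ injection n d₀ dinf κ θ i s := fun s hs =>
      le_trans (le_mul_of_one_le_right hc₁.le
        (Real.one_le_rpow hs (by positivity))) (h s hs).1
    have hpos : ∀ s ∈ Ici (1 : ℝ), 0 < s := fun s hs => one_pos.trans_le hs
    obtain ⟨e₁, e₂, he₁, he₂, he⟩ := comparable_step (D := Ici (1 : ℝ))
      (x := injection n d₀ dinf κ θ i) (g := fun s => s ^ (weight n dinf (i + 1) / weight n dinf 1))
      (q := expo n d₀ (i + 1)) (M := c₁ ^ (expo n d₀ (i + 1) - expo n dinf (i + 1)))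
      (H.theta_pos' (by omega) hin) (H.kappa_pos' (by omega) hin).le
      (H.expoInf_nonneg (by omega) hin) hc₁ hc₂ (fun s hs => Real.rpow_pos_of_pos (hpos s hs) _)
      (fun s hs => (h s hs).1) (fun s hs => (h s hs).2) (fun s hs => by
        have hx := H.injection_pos (by omega : i ≤ n) (hpos s hs)
        rw [← sub_add_cancel (expo n d₀ (i + 1)) (expo n dinf (i + 1)), Real.rpow_add hx,
          add_sub_cancel_right]
        gcongr ?_ * _
        exact Real.rpow_le_rpow_of_nonpos hc₁ (hle s hs)
          (by linarith [H.expo_le (by omega : 1 ≤ i + 1) hin])) (by positivity)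
    refine ⟨e₁, e₂, he₁, he₂, fun s hs => ?_⟩
    have h1 := he s hs
    rw [← Real.rpow_mul (hpos s hs).le, expo, div_mul_div_comm, mul_comm (weight n dinf (i + 1)),
      mul_div_mul_right _ _ hwi.ne', add_comm (θ (i + 1) * _)] at h1
    rw [injection, varphi_of_pos (H.injection_pos (by omega) (hpos s hs))]
    exact h1

end Admissible

/-- The convergence rate of the differentiator at the scale `s`. -/
def rate (n : ℕ) (d₀ dinf s : ℝ) : ℝ :=
  if s ≤ 1 then s ^ (d₀ / weight n d₀ 1) else s ^ (dinf / weight n dinf 1)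

theorem rate_pos (n : ℕ) (d₀ dinf : ℝ) {s : ℝ} (hs : 0 < s) : 0 < rate n d₀ dinf s := by
  unfold rate; split_ifs <;> positivity

theorem ratio_comparable {x y g h r a b a' b' : ℝ} (hx : 0 < x) (hg : 0 < g) (hh : 0 < h)
    (hr : r = h / g) (ha : 0 < a) (hb : 0 < b) (ha' : 0 < a') (hb' : 0 < b')
    (h1 : a * g ≤ x) (h2 : x ≤ b * g) (h3 : a' * h ≤ y) (h4 : y ≤ b' * h) :
    r ≤ (b / a') * (y / x) ∧ y / x ≤ r * (b' / a) := by
  subst hr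
  constructor
  · rw [div_mul_div_comm, div_le_div_iff₀ hg (by positivity)]
    calc h * (a' * x) = x * (a' * h) := by ring
      _ ≤ (b * g) * y := by gcongr
      _ = _ := by ring
  · rw [div_mul_div_comm, div_le_div_iff₀ hx (by positivity)]
    calc y * (g * a) ≤ (b' * h) * (g * a) := by gcongr
      _ = (h * b') * (a * g) := by ring
      _ ≤ h * b' * x := by gcongr

namespace Admissible

variable {n : ℕ} {d₀ dinf : ℝ} {κ θ : ℕ → ℝ} (H : Admissible n d₀ dinf κ θ)
include H

/-- All quotients of consecutive injections are comparable to the rate. -/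
theorem exists_rate_comparable : ∃ c, 1 ≤ c ∧ ∀ s, 0 < s → ∀ i < n,
    rate n d₀ dinf s ≤ c * (injection n d₀ dinf κ θ (i + 1) s / injection n d₀ dinf κ θ i s) ∧
    injection n d₀ dinf κ θ (i + 1) s / injection n d₀ dinf κ θ i s ≤ rate n d₀ dinf s * c := by
  have hw0 := H.weight₀_pos le_rfl (by linarith [H.two_le])
  have hw1 := H.weightInf_pos le_rfl (by linarith [H.two_le])
  have key : ∀ i, ∃ c, 1 ≤ c ∧ (i < n → ∀ s, 0 < s →
      rate n d₀ dinf s ≤ c * (injection n d₀ dinf κ θ (i + 1) s / injection n d₀ dinf κ θ i s) ∧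
      injection n d₀ dinf κ θ (i + 1) s / injection n d₀ dinf κ θ i s ≤ rate n d₀ dinf s * c) := by
    intro i
    by_cases hin : i < n
    · obtain ⟨a, b, ha, hb, h⟩ := H.injection_comparable_small hin.le
      obtain ⟨a', b', ha', hb', h'⟩ := H.injection_comparable_small (i := i + 1) hin
      obtain ⟨e, f, he, hf, g⟩ := H.injection_comparable_large hin.le
      obtain ⟨e', f', he', hf', g'⟩ := H.injection_comparable_large (i := i + 1) hin
      have hc1 : 0 < b / a' := by positivity
      have hc2 : 0 < b' / a := by positivity
      have hc3 : 0 < f / e' := by positivity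
      have hc4 : 0 < f' / e := by positivity
      refine ⟨1 + b / a' + b' / a + f / e' + f' / e, by linarith, fun _ s hs => ?_⟩
      have hx := H.injection_pos hin.le hs
      have hy := H.injection_pos (i := i + 1) hin hs
      have hr := rate_pos n d₀ dinf hs
      have hyx : 0 < injection n d₀ dinf κ θ (i + 1) s / injection n d₀ dinf κ θ i s := by
        positivity
      rcases le_or_gt s 1 with hs1 | hs1
      · have hm : s ∈ Ioc (0 : ℝ) 1 := ⟨hs, hs1⟩
        -- Consecutive weights differ by `d₀`, so the quotient of the two model powers is `s ^ (d₀ /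
        -- r_1)`, the same for every `i`.
        have h1 := ratio_comparable (r := rate n d₀ dinf s) hx (by positivity) (by positivity)
          (by
            rw [rate, if_pos hs1, ← Real.rpow_sub hs, ← sub_div, weight_succ_eq n d₀ (i + 1),
              add_sub_cancel_left]) ha hb ha' hb' (h s hm).1 (h s hm).2 (h' s hm).1 (h' s hm).2
        constructor <;> nlinarith
      · have hm : s ∈ Ici (1 : ℝ) := hs1.le
        have h1 := ratio_comparable (r := rate n d₀ dinf s) hx (by positivity) (by positivity)
          (by
            rw [rate, if_neg hs1.not_ge, ← Real.rpow_sub hs, ← sub_div,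
              weight_succ_eq n dinf (i + 1), add_sub_cancel_left])
          he hf he' hf' (g s hm).1 (g s hm).2 (g' s hm).1 (g' s hm).2
        constructor <;> nlinarith
    · exact ⟨1, le_rfl, fun h => absurd h hin⟩
  choose c hc1 hc using key
  have hsum : ∀ i ∈ Finset.range n, c i ≤ 1 + ∑ j ∈ Finset.range n, c j := fun i hi => by
    have := Finset.single_le_sum (f := c) (fun j _ => by linarith [hc1 j]) hi
    linarith
  have hsum0 : 0 ≤ ∑ j ∈ Finset.range n, c j := Finset.sum_nonneg fun j _ => by linarith [hc1 j]
  refine ⟨1 + ∑ j ∈ Finset.range n, c j, by linarith, fun s hs i hi => ?_⟩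
  obtain ⟨h1, h2⟩ := hc i hi s hs
  have h3 := hsum i (Finset.mem_range.2 hi)
  have hx := H.injection_pos hi.le hs
  have hy := H.injection_pos (i := i + 1) hi hs
  have hr := rate_pos n d₀ dinf hs
  exact ⟨h1.trans (by gcongr), h2.trans (by gcongr)⟩

end Admissible

/-! ### Error trajectories -/

/-- The differentiation errors `e_1, …, e_n`. The function `w` is a selection of the graph of the
last injection completed at its jumps, and `e_{n+1}` is a disturbance bounded by `Δ`. -/
structure IsErrorTrajectory (n : ℕ) (d₀ dinf : ℝ) (κ θ k : ℕ → ℝ) (Δ : ℝ) (e : ℕ → ℝ → ℝ)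
    (w : ℝ → ℝ) (a b : ℝ) : Prop where
  ac : ∀ i ∈ Finset.Icc 1 n, AbsolutelyContinuousOnInterval (e i) a b
  deriv : ∀ i ∈ Finset.Ico 1 n, ∀ᵐ t, t ∈ Icc a b →
    HasDerivAt (e i) (-k i * injection n d₀ dinf κ θ i (e 1 t) + e (i + 1) t) t
  deriv_last : ∀ᵐ t, t ∈ Icc a b → HasDerivAt (e n) (-k n * w t + e (n + 1) t) t
  disturbance : ∀ᵐ t, t ∈ Icc a b → |e (n + 1) t| ≤ Δ
  w_le : ∀ᵐ t, t ∈ Icc a b → ∀ s, e 1 t < s → w t ≤ injection n d₀ dinf κ θ n s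
  le_w : ∀ᵐ t, t ∈ Icc a b → ∀ s, s < e 1 t → injection n d₀ dinf κ θ n s ≤ w t

theorem IsErrorTrajectory.restrict {n : ℕ} {d₀ dinf : ℝ} {κ θ k : ℕ → ℝ} {Δ : ℝ} {e : ℕ → ℝ → ℝ}
    {w : ℝ → ℝ} {a b c d : ℝ} (h : IsErrorTrajectory n d₀ dinf κ θ k Δ e w a b)
    (hac : a ≤ c) (hcd : c ≤ d) (hdb : d ≤ b) :
    IsErrorTrajectory n d₀ dinf κ θ k Δ e w c d := by
  have hs : Icc c d ⊆ Icc a b := Icc_subset_Icc hac hdb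
  refine ⟨fun i hi => (h.ac i hi).mono_Icc hac hcd hdb, fun i hi => ?_, ?_, ?_, ?_, ?_⟩
  · filter_upwards [h.deriv i hi] with t h1 ht using h1 (hs ht)
  · filter_upwards [h.deriv_last] with t h1 ht using h1 (hs ht)
  · filter_upwards [h.disturbance] with t h1 ht using h1 (hs ht)
  · filter_upwards [h.w_le] with t h1 ht using h1 (hs ht)
  · filter_upwards [h.le_w] with t h1 ht using h1 (hs ht)

/-- The box of size `C` at the scale `s`. -/
def InBox (n : ℕ) (d₀ dinf : ℝ) (κ θ k : ℕ → ℝ) (C s : ℝ) (x : ℕ → ℝ) : Prop :=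
  ∀ i < n, |x (i + 1)| ≤ C * (k i * injection n d₀ dinf κ θ i s)

/-- Boxes are contracted uniformly in the scale by error trajectories with gains `k`. -/
def Contracting (n : ℕ) (d₀ dinf : ℝ) (κ θ k : ℕ → ℝ) (Δ C T : ℝ) : Prop :=
  ∀ s, 0 < s → ∀ (e : ℕ → ℝ → ℝ) (w : ℝ → ℝ) (a b : ℝ), a ≤ b → b ≤ a + T / rate n d₀ dinf s →
    IsErrorTrajectory n d₀ dinf κ θ k Δ e w a b →
    InBox n d₀ dinf κ θ k 1 s (fun i => e i a) →
    (∀ t ∈ Icc a b, InBox n d₀ dinf κ θ k C s (fun i => e i t)) ∧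
    (b = a + T / rate n d₀ dinf s → InBox n d₀ dinf κ θ k 1 (s / 2) (fun i => e i b))

/-- The lower sector bound of the last injection. -/
def lastLower (p q r : ℝ) : ℝ := min ((r / 2) ^ p) ((r / 2) ^ q)

/-- The upper bound of the last injection. -/
def lastUpper (p q C : ℝ) : ℝ := max ((|C| + 1) ^ p) ((|C| + 1) ^ q)

theorem exists_pos_le_of_pos (f : ℕ → ℝ) (n : ℕ) (hf : ∀ i < n, 0 < f i) :
    ∃ B, 0 < B ∧ ∀ i < n, B ≤ f i := by
  induction n with
  | zero => exact ⟨1, one_pos, fun i hi => absurd hi (by omega)⟩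
  | succ n ih =>
    obtain ⟨B, hB, h⟩ := ih fun i hi => hf i (by omega)
    have hn := hf n (by omega)
    refine ⟨min B (f n), by positivity, fun i hi => ?_⟩
    rcases Nat.lt_succ_iff_lt_or_eq.1 hi with h1 | rfl
    · exact (min_le_left _ _).trans (h i h1)
    · exact min_le_right _ _

namespace Admissible

variable {n : ℕ} {d₀ dinf : ℝ} {κ θ : ℕ → ℝ} (H : Admissible n d₀ dinf κ θ)
include H

theorem exists_injection_succ_eq (s : ℝ) (hs : 0 < s) : ∃ l : ℕ → ℝ, (∀ i, l i ∈ Icc (0 : ℝ) 1) ∧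
    ∀ i < n, ∀ x, varphi n d₀ dinf κ θ (i + 1) (injection n d₀ dinf κ θ i s * x) =
      injection n d₀ dinf κ θ (i + 1) s *
        blend (expo n d₀ (i + 1)) (expo n dinf (i + 1)) (l (i + 1)) x := by
  have : ∀ i, ∃ l ∈ Icc (0 : ℝ) 1, i - 1 < n → 1 ≤ i →
      ∀ x, varphi n d₀ dinf κ θ i (injection n d₀ dinf κ θ (i - 1) s * x) =
      varphi n d₀ dinf κ θ i (injection n d₀ dinf κ θ (i - 1) s) *
        blend (expo n d₀ i) (expo n dinf i) l x := fun i => by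
    by_cases h : i - 1 < n ∧ 1 ≤ i
    · obtain ⟨l, hl, h'⟩ := H.exists_varphi_mul (i := i) h.2 (by omega)
        (H.injection_pos (i := i - 1) (by omega) hs)
      exact ⟨l, hl, fun _ _ => h'⟩
    · exact ⟨0, ⟨le_rfl, zero_le_one⟩, fun h1 h2 => absurd ⟨h1, h2⟩ h⟩
  choose l hl hlx using this
  exact ⟨l, hl, fun i hi x => hlx (i + 1) (by omega) (by omega) x⟩

/-- In the scaled variables the last injection satisfies sector bounds. -/
theorem lastLower_le {s z v r l : ℝ} (hs : 0 < s) (hr : 0 < r) {i : ℕ} (hin : i + 1 = n)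
    (hl : l ∈ Icc (0 : ℝ) 1)
    (hmul : ∀ x, varphi n d₀ dinf κ θ (i + 1) (injection n d₀ dinf κ θ i s * x) =
      injection n d₀ dinf κ θ (i + 1) s *
        blend (expo n d₀ (i + 1)) (expo n dinf (i + 1)) l x)
    (hv : ∀ y, y < z → injection n d₀ dinf κ θ n y ≤ v)
    (hz : r ≤ injection n d₀ dinf κ θ i z / injection n d₀ dinf κ θ i s) :
    lastLower (expo n d₀ n) (expo n dinf n) r ≤ v / injection n d₀ dinf κ θ n s := by
  subst hin
  have hΦ := H.injection_pos (i := i) (by omega) hs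
  have hΦ' := H.injection_pos (i := i + 1) le_rfl hs
  rw [le_div_iff₀ hΦ] at hz
  -- At a jump `v` is comparable only with values at points `y < z`. Giving up a factor two leaves
  -- room for such a `y`, by continuity of the previous injection.
  have hlt : r / 2 * injection (i + 1) d₀ dinf κ θ i s < injection (i + 1) d₀ dinf κ θ i z := by
    have : 0 < r * injection (i + 1) d₀ dinf κ θ i s := by positivity
    linarith
  have hev := ((H.injection_continuous (i := i) (by omega)).tendsto z).eventually_const_lt hlt
  obtain ⟨y, hy, hyz⟩ := ((hev.filter_mono nhdsWithin_le_nhds).and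
    (self_mem_nhdsWithin : Iio z ∈ 𝓝[<] z)).exists
  have h1 := H.varphi_monotone (by omega : 1 ≤ i + 1) le_rfl hy.le
  rw [mul_comm, hmul] at h1
  rw [le_div_iff₀ hΦ', mul_comm]
  refine le_trans ?_ (h1.trans (hv y hyz))
  refine mul_le_mul_of_nonneg_left ?_ hΦ'.le
  have hr2 : 0 < r / 2 := by positivity
  exact le_blend hl (by rw [signedPow_of_pos hr2]; exact min_le_left _ _)
    (by rw [signedPow_of_pos hr2]; exact min_le_right _ _)

theorem le_lastUpper {s z v C l : ℝ} (hs : 0 < s) {i : ℕ} (hin : i + 1 = n)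
    (hl : l ∈ Icc (0 : ℝ) 1)
    (hmul : ∀ x, varphi n d₀ dinf κ θ (i + 1) (injection n d₀ dinf κ θ i s * x) =
      injection n d₀ dinf κ θ (i + 1) s *
        blend (expo n d₀ (i + 1)) (expo n dinf (i + 1)) l x)
    (hv : ∀ y, z < y → v ≤ injection n d₀ dinf κ θ n y)
    (hz : injection n d₀ dinf κ θ i z / injection n d₀ dinf κ θ i s ≤ C) :
    v / injection n d₀ dinf κ θ n s ≤ lastUpper (expo n d₀ n) (expo n dinf n) C := by
  subst hin
  have hΦ := H.injection_pos (i := i) (by omega) hs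
  have hΦ' := H.injection_pos (i := i + 1) le_rfl hs
  rw [div_le_iff₀ hΦ] at hz
  have hlt : injection (i + 1) d₀ dinf κ θ i z <
      (|C| + 1) * injection (i + 1) d₀ dinf κ θ i s := by
    nlinarith [le_abs_self C]
  have hev := ((H.injection_continuous (i := i) (by omega)).tendsto z).eventually_lt_const hlt
  obtain ⟨y, hy, hyz⟩ := ((hev.filter_mono nhdsWithin_le_nhds).and
    (self_mem_nhdsWithin : Ioi z ∈ 𝓝[>] z)).exists
  have h1 := H.varphi_monotone (by omega : 1 ≤ i + 1) le_rfl hy.le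
  rw [mul_comm (|C| + 1), hmul] at h1
  rw [div_le_iff₀ hΦ', mul_comm]
  refine (hv y hyz).trans (h1.trans ?_)
  refine mul_le_mul_of_nonneg_left ?_ hΦ'.le
  have hr2 : 0 < |C| + 1 := by positivity
  exact blend_le hl (by rw [signedPow_of_pos hr2]; exact le_max_left _ _)
    (by rw [signedPow_of_pos hr2]; exact le_max_right _ _)

/-- Error trajectories become cascades in the scaled variables. -/
theorem isCascade_of_isErrorTrajectory {k K : ℕ → ℝ} {Δ δ s a b : ℝ} {e : ℕ → ℝ → ℝ} {w : ℝ → ℝ}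
    {l : ℕ → ℝ} (hs : 0 < s) (hk : ∀ i, 0 < k i) (hkK : ∀ i, k (i + 1) = K (i + 1) * k i)
    (hδ : Δ ≤ δ * (k n * injection n d₀ dinf κ θ n s)) (hl : ∀ i, l i ∈ Icc (0 : ℝ) 1)
    (hmul : ∀ i < n, ∀ x, varphi n d₀ dinf κ θ (i + 1) (injection n d₀ dinf κ θ i s * x) =
      injection n d₀ dinf κ θ (i + 1) s *
        blend (expo n d₀ (i + 1)) (expo n dinf (i + 1)) (l (i + 1)) x)
    (h : IsErrorTrajectory n d₀ dinf κ θ k Δ e w a b) :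
    IsCascade 1 n (fun i => blend (expo n d₀ i) (expo n dinf i) (l i))
      (lastLower (expo n d₀ n) (expo n dinf n)) (lastUpper (expo n d₀ n) (expo n dinf n)) δ
      (fun i => K i * (injection n d₀ dinf κ θ i s / injection n d₀ dinf κ θ (i - 1) s))
      (fun i t => e i t / (k (i - 1) * injection n d₀ dinf κ θ (i - 1) s))
      (fun i t => if i = n + 1 then w t / injection n d₀ dinf κ θ n s else
        injection n d₀ dinf κ θ (i - 1) (e 1 t) / injection n d₀ dinf κ θ (i - 1) s) a b := by
  have hΦ : ∀ i ≤ n, 0 < injection n d₀ dinf κ θ i s := fun i hi => H.injection_pos hi hs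
  have hn2 := H.two_le
  obtain ⟨N, hN⟩ : ∃ N, N + 1 = n := ⟨n - 1, by omega⟩
  have hnN : n - 1 = N := by omega
  have hneg : ∀ t, (∀ y, e 1 t < y → w t ≤ injection n d₀ dinf κ θ n y) →
      ∀ y, y < -e 1 t → injection n d₀ dinf κ θ n y ≤ -w t := fun t ht y hy => by
    have := ht (-y) (by linarith)
    rw [injection_neg] at this
    linarith
  have hneg' : ∀ t, (∀ y, y < e 1 t → injection n d₀ dinf κ θ n y ≤ w t) →
      ∀ y, -e 1 t < y → -w t ≤ injection n d₀ dinf κ θ n y := fun t ht y hy => by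
    have := ht (-y) (by linarith)
    rw [injection_neg] at this
    linarith
  refine ⟨fun i hi => ?_, fun i hi => ?_, fun i hi t ht => ?_, ?_, ?_, ?_, ?_⟩
  · simp only [div_eq_inv_mul]
    exact (h.ac i hi).const_mul _
  · obtain ⟨j, rfl⟩ : ∃ j, i = j + 1 := ⟨i - 1, by simp only [Finset.mem_Icc] at hi; omega⟩
    rw [Finset.mem_Icc] at hi
    have hΦj := (hΦ j (by omega)).ne'
    have hΦj1 := (hΦ (j + 1) (by omega)).ne'
    have hkj := (hk j).ne'
    have hkj1 := (hk (j + 1)).ne'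
    have hKj : K (j + 1) = k (j + 1) / k j := by rw [hkK]; field_simp
    by_cases hjn : j + 1 = n
    · filter_upwards [h.deriv_last] with t ht hm
      rw [hjn] at hΦj1 hkj1 hKj ⊢
      convert! (ht hm).div_const (k (n - 1) * injection n d₀ dinf κ θ (n - 1) s) using 1
      rw [if_pos rfl, hKj]
      simp only [← hjn, add_tsub_cancel_right] at *
      field_simp
      ring
    · filter_upwards [h.deriv (j + 1) (by simp only [Finset.mem_Ico]; omega)] with t ht hm
      convert! (ht hm).div_const (k (j + 1 - 1) * injection n d₀ dinf κ θ (j + 1 - 1) s) using 1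
      rw [if_neg (by omega), hKj]
      simp only [add_tsub_cancel_right]
      field_simp
      ring
  · obtain ⟨j, rfl⟩ : ∃ j, i = j + 1 := ⟨i - 1, by simp only [Finset.mem_Ico] at hi; omega⟩
    rw [Finset.mem_Ico] at hi
    have hΦj := (hΦ j (by omega)).ne'
    have hΦj1 := (hΦ (j + 1) (by omega)).ne'
    simp only [add_tsub_cancel_right]
    rw [if_neg (by omega), if_neg (by omega), div_eq_iff hΦj1, mul_comm, ← hmul j (by omega),
      mul_div_cancel₀ _ hΦj]
    rfl
  · filter_upwards [h.disturbance] with t ht hm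
    have hkn := hk n
    have hΦn := hΦ n le_rfl
    rw [add_tsub_cancel_right, abs_div, abs_of_pos (by positivity : 0 < k n * _),
      div_le_iff₀ (by positivity)]
    exact (ht hm).trans hδ
  · filter_upwards [h.le_w] with t ht hm r hr hle
    rw [if_pos rfl]
    rw [if_neg (by omega), hnN] at hle
    exact H.lastLower_le hs hr hN (hl _) (hmul N (by omega)) (ht hm) hle
  · filter_upwards [h.w_le] with t ht hm r hr hle
    rw [if_pos rfl]
    rw [if_neg (by omega), hnN] at hle
    have := H.lastLower_le hs hr hN (hl _) (hmul N (by omega)) (hneg t (ht hm))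
      (by rw [injection_neg, neg_div]; linarith)
    rw [neg_div] at this
    linarith
  · filter_upwards [h.w_le, h.le_w] with t ht ht' hm C hle
    rw [if_pos rfl]
    rw [if_neg (by omega), hnN] at hle
    obtain ⟨h1, h2⟩ := abs_le.1 hle
    have h3 := H.le_lastUpper hs hN (hl _) (hmul N (by omega)) (ht hm) h2
    have h4 := H.le_lastUpper hs hN (hl _) (hmul N (by omega)) (hneg' t (ht' hm)) (C := C)
      (by rw [injection_neg, neg_div]; linarith)
    rw [neg_div] at h4
    exact abs_le.2 ⟨by linarith, h3⟩

/-- For suitable gains, boxes are contracted uniformly in the scale. -/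
theorem exists_gains {Δ : ℝ} (hcase : d₀ = -1 ∨ Δ = 0) :
    ∃ k : ℕ → ℝ, (∀ i, 0 < k i) ∧ ∃ C T, 0 < C ∧ 0 < T ∧ Contracting n d₀ dinf κ θ k Δ C T := by
  have hn2 := H.two_le
  obtain ⟨c, hc, hrate⟩ := H.exists_rate_comparable
  have hhalf : ∀ i, ∃ B, 0 < B ∧ (i < n → ∀ s, 0 < s →
      B * injection n d₀ dinf κ θ i s ≤ injection n d₀ dinf κ θ i (s / 2)) := fun i => by
    by_cases hi : i < n
    · obtain ⟨B, hB, h⟩ := H.exists_injection_half hi.le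
      exact ⟨B, hB, fun _ => h⟩
    · exact ⟨1, one_pos, fun h => absurd h hi⟩
  choose Bf hBf hBhalf using hhalf
  obtain ⟨B, hB, hBle⟩ := exists_pos_le_of_pos Bf n fun i _ => hBf i
  -- Since `B Φ_i(s) ≤ Φ_i(s / 2)`, the box of size `B` at scale `s` lies in the unit box at scale
  -- `s / 2`.
  obtain ⟨δ, hδ, hcon⟩ := cascadeContracts (S := fun i => blends (expo n d₀ i) (expo n dinf i))
    (β := lastLower (expo n d₀ n) (expo n dinf n)) (U := lastUpper (expo n d₀ n) (expo n dinf n))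
    hc (by omega : 1 ≤ n) (fun i hi => by
      rw [Finset.mem_Ico] at hi
      exact uniformlyIncreasing_blends (H.expo₀_pos hi.1 hi.2) (H.expoInf_pos hi.1 hi.2))
    (fun r hr => by unfold lastLower; positivity) 1 B one_pos hB
  have hκn := H.kappa_pos' (by omega : 1 ≤ n) le_rfl
  have hθn := H.theta_pos' (by omega : 1 ≤ n) le_rfl
  -- With this lower bound, `k_n ≥ K_n` gives `Δ ≤ δ k_n κ_n`.
  obtain ⟨K, hK, η, C, T, hη, hC, hT, hcon⟩ := hcon (Δ / (δ * κ n))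
  have hK0 : ∀ i, 0 < K i := fun i => by linarith [(hK i).2]
  set k : ℕ → ℝ := fun i => ∏ j ∈ Finset.range i, K (j + 1) with hk
  have hk0 : ∀ i, 0 < k i := fun i => Finset.prod_pos fun j _ => hK0 _
  have hk1 : ∀ i, 1 ≤ k i := fun i => Finset.one_le_prod fun j _ => (hK (j + 1)).2
  have hkK : ∀ i, k (i + 1) = K (i + 1) * k i := fun i => by
    rw [hk]; simp only [Finset.prod_range_succ]; ring
  obtain ⟨N, hN⟩ : ∃ N, N + 1 = n := ⟨n - 1, by omega⟩
  have hdist : ∀ s, 0 < s → Δ ≤ δ * (k n * injection n d₀ dinf κ θ n s) := by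
    intro s hs
    have hkn := hk0 n
    have hΦn := H.injection_pos le_rfl hs
    rcases hcase with h1 | h1
    -- For `d₀ = -1` the exponent `r_{0,n+1} / r_{0,n}` is zero: the last injection stays above
    -- `κ_n` at every positive scale, so one gain handles the disturbance at all scales.
    · have h2 : κ n ≤ injection n d₀ dinf κ θ n s := by
        have hΦN := H.injection_pos (by omega : N ≤ n) hs
        have he : expo n d₀ n = 0 := by rw [expo, weight_last, h1]; norm_num
        conv_rhs => rw [← hN, injection]
        rw [hN, varphi_of_pos hΦN, he, Real.rpow_zero]
        linarith [show 0 < θ n * injection n d₀ dinf κ θ N s ^ expo n dinf n by positivity]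
      have h3 : Δ / (δ * κ n) ≤ k n := by
        have h4 : k n = K n * k N := by
          conv_lhs => rw [← hN, hkK, hN]
        rw [h4]
        nlinarith [hk1 N, hK0 n, (hK n).1]
      rw [div_le_iff₀ (by positivity)] at h3
      calc Δ ≤ k n * (δ * κ n) := h3
        _ ≤ k n * (δ * injection n d₀ dinf κ θ n s) := by gcongr
        _ = _ := by ring
    · rw [h1]; positivity
  refine ⟨k, hk0, C, T, hC, hT, fun s hs e w a b hab hbT h hbox => ?_⟩
  obtain ⟨l, hl, hmul⟩ := H.exists_injection_succ_eq s hs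
  have hcas := H.isCascade_of_isErrorTrajectory hs hk0 hkK (hdist s hs) hl hmul h
  have hscale : ∀ i < n, 0 < k i * injection n d₀ dinf κ θ i s := fun i hi =>
    mul_pos (hk0 i) (H.injection_pos hi.le hs)
  have hequiv : ∀ D t, InBox n d₀ dinf κ θ k D s (fun i => e i t) ↔ ∀ i ∈ Finset.Icc 1 n,
      |e i t / (k (i - 1) * injection n d₀ dinf κ θ (i - 1) s)| ≤ D := fun D t => by
    constructor
    · intro hD i hi
      rw [Finset.mem_Icc] at hi
      have := hD (i - 1) (by omega)
      rw [show i - 1 + 1 = i by omega] at this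
      rwa [abs_div, abs_of_pos (hscale (i - 1) (by omega)), div_le_iff₀ (hscale _ (by omega))]
    · intro hD i hi
      have := hD (i + 1) (Finset.mem_Icc.2 ⟨by omega, by omega⟩)
      rwa [add_tsub_cancel_right, abs_div, abs_of_pos (hscale i hi),
        div_le_iff₀ (hscale i hi)] at this
  obtain ⟨h1, h2⟩ := hcon _ (fun i _ => ⟨l i, hl i, rfl⟩) (rate n d₀ dinf s)
    (rate_pos n d₀ dinf hs) _ (fun i hi => by
      rw [Finset.mem_Icc] at hi
      have := hrate s hs (i - 1) (by omega)
      rw [show i - 1 + 1 = i by omega] at this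
      have hKi := (hK0 i).le
      constructor
      · calc rate n d₀ dinf s * K i ≤ _ := mul_le_mul_of_nonneg_right this.1 hKi
          _ = _ := by ring
      · calc _ ≤ K i * (rate n d₀ dinf s * c) := mul_le_mul_of_nonneg_left this.2 hKi
          _ = _ := by ring) _ _ a b hab hbT hcas ((hequiv 1 a).1 hbox) (fun t ht => by
      -- The input condition holds exactly, `u_1 = y_1`, because `k_0 = 1` and `Φ_0` is the
      -- identity.
      rw [if_neg (by omega)]
      have hk00 : k 0 = 1 := by simp [hk]
      simp [hk00, injection, hη.le])
  refine ⟨fun t ht => (hequiv C t).2 fun i hi => h1 i hi t ht, fun hb i hi => ?_⟩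
  refine ((hequiv B b).2 (h2 hb) i hi).trans ?_
  have h3 := hBhalf i hi s hs
  have h4 := hBle i hi
  have h5 := hk0 i
  have h6 := H.injection_pos hi.le hs
  calc B * (k i * injection n d₀ dinf κ θ i s)
      ≤ Bf i * (k i * injection n d₀ dinf κ θ i s) := by gcongr
    _ = k i * (Bf i * injection n d₀ dinf κ θ i s) := by ring
    _ ≤ k i * injection n d₀ dinf κ θ i (s / 2) := by gcongr
    _ = _ := by ring

end Admissible

/-! ### Convergence of error trajectories -/

namespace Admissible

variable {n : ℕ} {d₀ dinf : ℝ} {κ θ : ℕ → ℝ} (H : Admissible n d₀ dinf κ θ)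
include H

theorem inBox_mono {k : ℕ → ℝ} {C s s' : ℝ} {x : ℕ → ℝ} (hk : ∀ i, 0 < k i) (hC : 0 ≤ C)
    (hs : s ≤ s') (h : InBox n d₀ dinf κ θ k C s x) : InBox n d₀ dinf κ θ k C s' x := fun i hi => by
  have h1 := H.injection_monotone hi.le hs
  have h2 := (hk i).le
  exact (h i hi).trans (by gcongr)

/-- Only the injections of index below `n` bound the box, and these are unbounded. -/
theorem exists_inBox {k : ℕ → ℝ} (hk : ∀ i, 0 < k i) (x : ℕ → ℝ) :
    ∃ s, 0 < s ∧ InBox n d₀ dinf κ θ k 1 s x := by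
  have h : ∀ i ∈ Finset.range n, ∀ᶠ s in atTop,
      |x (i + 1)| ≤ 1 * (k i * injection n d₀ dinf κ θ i s) := fun i hi => by
    have := (H.injection_tendsto_atTop (Finset.mem_range.1 hi)).const_mul_atTop (hk i)
    simpa using this.eventually_ge_atTop |x (i + 1)|
  obtain ⟨s, hs, h⟩ :=
    ((eventually_gt_atTop 0).and ((Filter.eventually_all_finset _).2 h)).exists
  exact ⟨s, hs, fun i hi => h i (Finset.mem_range.2 hi)⟩

/-- Boxes are forward invariant up to a constant factor. -/
theorem inBox_of_inBox {k : ℕ → ℝ} {Δ C T s a b : ℝ} {e : ℕ → ℝ → ℝ} {w : ℝ → ℝ}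
    (hk : ∀ i, 0 < k i) (hT : 0 < T) (hcon : Contracting n d₀ dinf κ θ k Δ C T)
    (hs : 0 < s) (h : IsErrorTrajectory n d₀ dinf κ θ k Δ e w a b)
    (hbox : InBox n d₀ dinf κ θ k 1 s (fun i => e i a)) :
    ∀ t ∈ Icc a b, InBox n d₀ dinf κ θ k C s (fun i => e i t) := by
  set τ := T / rate n d₀ dinf s with hτ
  have hτ0 : 0 < τ := div_pos hT (rate_pos n d₀ dinf hs)
  -- Each window of length `τ` ends in the box at scale `s / 2`, hence in the one at scale `s`, and
  -- the next window can start.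
  have key : ∀ N : ℕ, ∀ a', a ≤ a' → InBox n d₀ dinf κ θ k 1 s (fun i => e i a') →
      ∀ t ∈ Icc a' b, t ≤ a' + N * τ → InBox n d₀ dinf κ θ k C s (fun i => e i t) := by
    intro N
    induction N with
    | zero =>
      intro a' ha' hbox' t ht htN
      obtain rfl : t = a' := le_antisymm (by simpa using htN) ht.1
      exact (hcon s hs e w t t le_rfl (by linarith) (h.restrict ha' le_rfl ht.2) hbox').1 t
        ⟨le_rfl, le_rfl⟩
    | succ N ih =>
      intro a' ha' hbox' t ht htN
      rcases le_total t (a' + τ) with hle | hle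
      · exact (hcon s hs e w a' t ht.1 hle (h.restrict ha' ht.1 ht.2) hbox').1 t ⟨ht.1, le_rfl⟩
      · have h1 := (hcon s hs e w a' (a' + τ) (by linarith) le_rfl
          (h.restrict ha' (by linarith) (hle.trans ht.2)) hbox').2 rfl
        push_cast at htN
        exact ih (a' + τ) (by linarith) (H.inBox_mono hk zero_le_one (by linarith) h1) t
          ⟨hle, ht.2⟩ (by linarith)
  intro t ht
  obtain ⟨N, hN⟩ := exists_nat_ge ((t - a) / τ)
  rw [div_le_iff₀ hτ0] at hN
  exact key N a le_rfl hbox t ht (by linarith)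

omit H in
-- The explicit bound on the entrance time is what fixed-time convergence needs; plain convergence
-- ignores it.
theorem inBox_half_pow {k : ℕ → ℝ} {Δ C T s : ℝ} {e : ℕ → ℝ → ℝ} {w : ℝ → ℝ} (hT : 0 < T)
    (hcon : Contracting n d₀ dinf κ θ k Δ C T) (hs : 0 < s)
    (h : ∀ b, 0 ≤ b → IsErrorTrajectory n d₀ dinf κ θ k Δ e w 0 b)
    (hbox : InBox n d₀ dinf κ θ k 1 s (fun i => e i 0)) (j : ℕ) :
    ∃ t, 0 ≤ t ∧ t ≤ T * ∑ i ∈ Finset.range j, 1 / rate n d₀ dinf (s / 2 ^ i) ∧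
      InBox n d₀ dinf κ θ k 1 (s / 2 ^ j) (fun i => e i t) := by
  induction j with
  | zero => exact ⟨0, le_rfl, by simp, by simpa using hbox⟩
  | succ j ih =>
    obtain ⟨t, ht, htΨ, hbox'⟩ := ih
    have hsj : 0 < s / 2 ^ j := by positivity
    have hr := rate_pos n d₀ dinf hsj
    have h0 : 0 < T / rate n d₀ dinf (s / 2 ^ j) := by positivity
    have h1 := (hcon _ hsj e w t (t + T / rate n d₀ dinf (s / 2 ^ j)) (by linarith) le_rfl
      ((h _ (by linarith)).restrict ht (by linarith) le_rfl) hbox').2 rfl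
    rw [div_div, ← pow_succ] at h1
    refine ⟨_, by linarith, ?_, h1⟩
    rw [Finset.sum_range_succ, mul_add, mul_one_div]
    linarith

theorem tendsto_box {k : ℕ → ℝ} {C : ℝ} (s : ℝ) {i : ℕ} (hi : i < n) :
    Tendsto (fun j : ℕ => C * (k i * injection n d₀ dinf κ θ i (s / 2 ^ j))) atTop (𝓝 0) := by
  have h1 : Tendsto (fun j : ℕ => s / 2 ^ j) atTop (𝓝 0) := by
    have := (tendsto_pow_atTop_nhds_zero_of_lt_one (by norm_num : (0 : ℝ) ≤ 1 / 2)
      (by norm_num)).const_mul s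
    simpa [div_eq_mul_inv] using this
  have h2 := ((H.injection_continuous hi).tendsto 0).comp h1
  rw [injection_zero_right] at h2
  simpa using (h2.const_mul (k i)).const_mul C

/-- Error trajectories tend to zero. -/
theorem tendsto_error {k : ℕ → ℝ} {Δ C T : ℝ} {e : ℕ → ℝ → ℝ} {w : ℝ → ℝ}
    (hk : ∀ i, 0 < k i) (hT : 0 < T) (hcon : Contracting n d₀ dinf κ θ k Δ C T)
    (h : ∀ b, 0 ≤ b → IsErrorTrajectory n d₀ dinf κ θ k Δ e w 0 b) {i : ℕ} (hi : i < n) :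
    Tendsto (e (i + 1)) atTop (𝓝 0) := by
  obtain ⟨s, hs, hbox⟩ := H.exists_inBox hk fun i => e i 0
  rw [Metric.tendsto_atTop]
  intro ε hε
  obtain ⟨j, hj⟩ := ((H.tendsto_box (k := k) (C := C) s hi).eventually_lt_const hε).exists
  obtain ⟨t₀, ht₀, -, hbox'⟩ := inBox_half_pow hT hcon hs h hbox j
  refine ⟨t₀, fun t ht => ?_⟩
  have := H.inBox_of_inBox hk hT hcon (by positivity)
    ((h t (ht₀.trans ht)).restrict ht₀ ht le_rfl) hbox' t ⟨ht, le_rfl⟩ i hi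
  rw [Real.dist_eq, sub_zero]
  exact this.trans_lt hj

/-- A bounded potential whose decrease over a halving of the scale dominates the time scale. -/
theorem exists_potential (h0 : d₀ < 0) (h1 : 0 < dinf) : ∃ (Ψ : ℝ → ℝ) (P : ℝ), 0 < P ∧
    (∀ s, 0 < s → 0 ≤ Ψ s ∧ Ψ s ≤ P) ∧
    ∀ s, 0 < s → 1 / rate n d₀ dinf s ≤ Ψ s - Ψ (s / 2) := by
  have hn2 := H.two_le
  have hw0 := H.weight₀_pos le_rfl (by omega)
  have hw1 := H.weightInf_pos le_rfl (by omega)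
  obtain ⟨α, hα⟩ : ∃ α, α = -(d₀ / weight n d₀ 1) := ⟨_, rfl⟩
  obtain ⟨γ, hγ⟩ : ∃ γ, γ = dinf / weight n dinf 1 := ⟨_, rfl⟩
  have hα0 : 0 < α := by rw [hα]; exact neg_pos.2 (div_neg_of_neg_of_pos h0 hw0)
  have hγ0 : 0 < γ := by rw [hγ]; exact div_pos h1 hw1
  have hA : 1 < (2 : ℝ) ^ α := Real.one_lt_rpow (by norm_num) hα0
  have hG : 1 < (2 : ℝ) ^ γ := Real.one_lt_rpow (by norm_num) hγ0
  -- `A` and `G` come from summing geometric series: they make the decrease of the potential exactly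
  -- `s ^ α` below `1`, and exactly `s ^ (-γ)` when `s / 2 > 1`.
  obtain ⟨A, hAdef⟩ : ∃ A, A = (2 : ℝ) ^ α / ((2 : ℝ) ^ α - 1) := ⟨_, rfl⟩
  obtain ⟨G, hGdef⟩ : ∃ G, G = 1 / ((2 : ℝ) ^ γ - 1) := ⟨_, rfl⟩
  have hA0 : 0 < A := by rw [hAdef]; exact div_pos (by linarith) (by linarith)
  have hG0 : 0 < G := by rw [hGdef]; exact div_pos one_pos (by linarith)
  have hA1 : A - A / (2 : ℝ) ^ α = 1 := by
    have : (2 : ℝ) ^ α - 1 ≠ 0 := by linarith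
    rw [hAdef]; field_simp
  have hG1 : G * (2 : ℝ) ^ γ - G = 1 := by
    have : (2 : ℝ) ^ γ - 1 ≠ 0 := by linarith
    rw [hGdef]; field_simp
  have hone : ∀ s : ℝ, 1 < s → (s ^ γ)⁻¹ ≤ 1 := fun s hs =>
    inv_le_one_of_one_le₀ (Real.one_le_rpow hs.le hγ0.le)
  have hle1 : ∀ s : ℝ, 0 < s → s ≤ 1 → s ^ α ≤ 1 := fun s hs hs1 =>
    Real.rpow_le_one hs.le hs1 hα0.le
  refine ⟨fun s => if s ≤ 1 then A * s ^ α else 1 + A + G - G * (s ^ γ)⁻¹, 1 + A + G,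
    by positivity, fun s hs => ?_, fun s hs => ?_⟩
  · dsimp only
    split_ifs with hs1
    · have := hle1 s hs hs1
      exact ⟨by positivity, by nlinarith⟩
    · have h2 := hone s (not_le.1 hs1)
      have h3 : 0 < (s ^ γ)⁻¹ := by positivity
      exact ⟨by nlinarith, by nlinarith⟩
  · dsimp only
    rcases le_or_gt s 1 with hs1 | hs1
    · rw [if_pos hs1, if_pos (by linarith), rate, if_pos hs1, Real.div_rpow hs.le (by norm_num),
        one_div, ← Real.rpow_neg hs.le, ← hα]
      have : A * s ^ α - A * (s ^ α / 2 ^ α) = (A - A / 2 ^ α) * s ^ α := by ring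
      rw [this, hA1, one_mul]
    · rw [if_neg hs1.not_ge, rate, if_neg hs1.not_ge, ← hγ, one_div]
      have h2 := hone s hs1
      have h3 : 0 < (s ^ γ)⁻¹ := by positivity
      rcases le_or_gt (s / 2) 1 with hs2 | hs2
      -- Across the threshold, the offset `1 + A + G` makes the potential at least `1 + A` at `s`
      -- and at most `A` at `s / 2`; the drop of at least `1` covers `s ^ (-γ)`.
      · rw [if_pos hs2]
        have := hle1 (s / 2) (by positivity) hs2
        nlinarith
      · rw [if_neg hs2.not_ge, Real.div_rpow hs.le (by norm_num), inv_div]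
        have : 1 + A + G - G * (s ^ γ)⁻¹ - (1 + A + G - G * (2 ^ γ / s ^ γ)) =
            (G * 2 ^ γ - G) * (s ^ γ)⁻¹ := by ring
        rw [this, hG1, one_mul]

/-- Error trajectories vanish after a fixed time. -/
theorem exists_fixed_time {k : ℕ → ℝ} {Δ C T : ℝ} (hk : ∀ i, 0 < k i) (hT : 0 < T)
    (hcon : Contracting n d₀ dinf κ θ k Δ C T) (h0 : d₀ < 0) (h1 : 0 < dinf) :
    ∃ Tbar, 0 < Tbar ∧ ∀ (e : ℕ → ℝ → ℝ) (w : ℝ → ℝ),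
      (∀ b, 0 ≤ b → IsErrorTrajectory n d₀ dinf κ θ k Δ e w 0 b) →
      ∀ t, Tbar ≤ t → ∀ i < n, e (i + 1) t = 0 := by
  obtain ⟨Ψ, P, hP, hΨ, hΨr⟩ := H.exists_potential h0 h1
  refine ⟨T * P, by positivity, fun e w h t ht i hi => ?_⟩
  obtain ⟨s, hs, hbox⟩ := H.exists_inBox hk fun i => e i 0
  -- The entrance times into all the boxes are at most `T P`, so from then on the errors lie in
  -- arbitrarily small boxes.
  have key : ∀ j : ℕ, |e (i + 1) t| ≤ C * (k i * injection n d₀ dinf κ θ i (s / 2 ^ j)) := by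
    intro j
    have hsj : 0 < s / 2 ^ j := by positivity
    obtain ⟨t₀, ht₀, htΨ, hbox'⟩ := inBox_half_pow hT hcon hs h hbox j
    have hsum : ∑ i ∈ Finset.range j, 1 / rate n d₀ dinf (s / 2 ^ i) ≤ Ψ s - Ψ (s / 2 ^ j) := by
      have h3 := Finset.sum_range_sub' (fun i : ℕ => Ψ (s / 2 ^ i)) j
      rw [pow_zero, div_one] at h3
      rw [← h3]
      refine Finset.sum_le_sum fun i _ => ?_
      have h4 := hΨr (s / 2 ^ i) (by positivity)
      rwa [div_div, ← pow_succ] at h4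
    have h2 : t₀ ≤ t := by
      have := mul_le_mul_of_nonneg_left
        (hsum.trans (by linarith [(hΨ s hs).2, (hΨ _ hsj).1] : _ ≤ P)) hT.le
      linarith
    exact H.inBox_of_inBox hk hT hcon hsj ((h t (ht₀.trans h2)).restrict ht₀ h2 le_rfl) hbox' t
      ⟨h2, le_rfl⟩ i hi
  have := ge_of_tendsto' (H.tendsto_box (k := k) (C := C) s hi) key
  exact abs_eq_zero.1 (le_antisymm this (abs_nonneg _))

end Admissible

/-! ### Filippov's regularization in coordinates -/

theorem AbsolutelyContinuousOnInterval.pi_apply {n : ℕ} {x : ℝ → Fin n → ℝ} {a b : ℝ}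
    (h : AbsolutelyContinuousOnInterval x a b) (j : Fin n) :
    AbsolutelyContinuousOnInterval (fun t => x t j) a b := by
  refine squeeze_zero (fun E => Finset.sum_nonneg fun i _ => dist_nonneg) (fun E => ?_) h
  exact Finset.sum_le_sum fun i _ => dist_le_pi_dist _ _ j

/-- A closed half-space containing nearby values of the field contains their closed convex hull.
With `σ = 1` and `σ = -1` this gives upper and lower bounds. -/
theorem mul_le_of_mem_filippov {n : ℕ} {g : ℝ → (Fin n → ℝ) → (Fin n → ℝ)} {t : ℝ}
    {x v : Fin n → ℝ} (hv : v ∈ filippov g t x) (j : Fin n) (σ c : ℝ)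
    (h : ∀ᶠ y in 𝓝 x, σ * g t y j ≤ c) : σ * v j ≤ c := by
  obtain ⟨δ, hδ, hball⟩ := Metric.eventually_nhds_iff_ball.1 h
  simp only [filippov, mem_iInter] at hv
  have h1 := hv δ hδ ∅ measure_empty
  have hclosed : IsClosed {y : Fin n → ℝ | σ * y j ≤ c} :=
    isClosed_le (by fun_prop) continuous_const
  have hconv : Convex ℝ {y : Fin n → ℝ | σ * y j ≤ c} := by
    have := convex_halfSpace_le (𝕜 := ℝ) (f := fun y : Fin n → ℝ => σ * y j)
      ⟨fun x y => by simp [mul_add], fun r x => by simp; ring⟩ c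
    exact this
  refine closure_minimal (convexHull_min ?_ hconv) hclosed h1
  rintro _ ⟨y, hy, rfl⟩
  exact hball y hy.1

theorem apply_eq_of_mem_filippov {n : ℕ} {g : ℝ → (Fin n → ℝ) → (Fin n → ℝ)} {t : ℝ}
    {x v : Fin n → ℝ} (hv : v ∈ filippov g t x) (j : Fin n)
    (h : ContinuousAt (fun y => g t y j) x) : v j = g t x j := by
  refine le_antisymm (le_of_forall_gt_imp_ge_of_dense fun c hc => ?_)
    (le_of_forall_lt_imp_le_of_dense fun c hc => ?_)
  · have := mul_le_of_mem_filippov hv j 1 c (by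
      filter_upwards [h.eventually_lt_const hc] with y hy
      linarith)
    linarith
  · have := mul_le_of_mem_filippov hv j (-1) (-c) (by
      filter_upwards [h.eventually_const_lt hc] with y hy
      linarith)
    linarith

/-- A nonempty open half ball is not contained in a null set. -/
theorem exists_mem_ball_coord {n : ℕ} (x : Fin n → ℝ) (i : Fin n) {ρ : ℝ} (hρ : 0 < ρ)
    {N : Set (Fin n → ℝ)} (hN : volume N = 0) (σ : ℝ) (hσ : σ = 1 ∨ σ = -1) :
    ∃ y ∈ Metric.ball x ρ \ N, σ * x i < σ * y i := by
  set V := Metric.ball x ρ ∩ {y : Fin n → ℝ | σ * x i < σ * y i}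
  have hVo : IsOpen V := Metric.isOpen_ball.inter (isOpen_lt continuous_const (by fun_prop))
  have hVne : V.Nonempty := by
    refine ⟨fun j => x j + σ * (ρ / 2), ?_, ?_⟩
    · rw [Metric.mem_ball, dist_pi_lt_iff hρ]
      intro j
      rw [Real.dist_eq, add_sub_cancel_left, abs_mul, abs_of_pos (by positivity : 0 < ρ / 2)]
      rcases hσ with rfl | rfl <;> norm_num <;> linarith
    · show σ * x i < σ * (x i + σ * (ρ / 2))
      rcases hσ with rfl | rfl <;> linarith
  by_contra! hcon
  have hsub : V ⊆ N := fun y hy => by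
    by_contra hyN
    exact absurd hy.2 (not_lt.2 (hcon y ⟨hy.1, hyN⟩))
  exact (hVo.measure_pos volume hVne).ne' (measure_mono_null hsub hN)

/-- A vector belongs to Filippov's set if all its coordinates but the last are limits of the field
and the last one lies between values taken on both sides of a hyperplane `y_i = x_i`. -/
theorem mem_filippov_of_between {n : ℕ} {g : ℝ → (Fin n → ℝ) → (Fin n → ℝ)} {t : ℝ}
    {x v : Fin n → ℝ} (i l : Fin n)
    (hv : ∀ j, j ≠ l → v j = g t x j ∧ ContinuousAt (fun y => g t y j) x)
    (hlo : ∀ y, x i < y i → g t y l ≤ v l) (hhi : ∀ y, y i < x i → v l ≤ g t y l) :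
    v ∈ filippov g t x := by
  simp only [filippov, mem_iInter]
  intro δ hδ N hN
  rw [Metric.mem_closure_iff]
  intro ε hε
  have hev : ∀ᶠ y in 𝓝 x, ∀ j, j ≠ l → |g t y j - v j| < ε := by
    rw [eventually_all]
    intro j
    by_cases hj : j = l
    · exact Eventually.of_forall fun y h => absurd hj h
    · obtain ⟨h1, h2⟩ := hv j hj
      have := Metric.tendsto_nhds.1 h2 ε hε
      filter_upwards [this] with y hy _
      rw [h1]
      exact hy
  obtain ⟨ρ, hρ, hball⟩ := Metric.eventually_nhds_iff_ball.1 hev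
  have hρδ : 0 < min ρ δ := by positivity
  obtain ⟨y₁, hy₁, hlt₁⟩ := exists_mem_ball_coord x i hρδ hN 1 (Or.inl rfl)
  obtain ⟨y₂, hy₂, hlt₂⟩ := exists_mem_ball_coord x i hρδ hN (-1) (Or.inr rfl)
  have hl₁ := hlo y₁ (by linarith)
  have hl₂ := hhi y₂ (by linarith)
  have hmem : ∀ y ∈ Metric.ball x (min ρ δ) \ N, g t y ∈ convexHull ℝ (g t '' (Metric.ball x δ \ N)) ∧
      ∀ j, j ≠ l → |g t y j - v j| < ε := fun y hy =>
    ⟨subset_convexHull ℝ _ ⟨y, ⟨Metric.ball_subset_ball (min_le_right _ _) hy.1, hy.2⟩, rfl⟩,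
      hball y (Metric.ball_subset_ball (min_le_left _ _) hy.1)⟩
  obtain ⟨hc₁, he₁⟩ := hmem y₁ hy₁
  obtain ⟨hc₂, he₂⟩ := hmem y₂ hy₂
  -- The convex combination matches the coordinate `l` exactly; the other coordinates are within `ε`
  -- at both points, hence also at the combination.
  obtain ⟨a, b, ha, hb, hab, hcomb⟩ : ∃ a b : ℝ, 0 ≤ a ∧ 0 ≤ b ∧ a + b = 1 ∧
      a * g t y₁ l + b * g t y₂ l = v l := by
    have hseg : v l ∈ segment ℝ (g t y₁ l) (g t y₂ l) := by
      rw [segment_eq_Icc (hl₁.trans hl₂)]; exact ⟨hl₁, hl₂⟩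
    obtain ⟨a, b, ha, hb, hab, h⟩ := hseg
    exact ⟨a, b, ha, hb, hab, h⟩
  refine ⟨a • g t y₁ + b • g t y₂, (convex_convexHull ℝ _) hc₁ hc₂ ha hb hab, ?_⟩
  rw [dist_pi_lt_iff hε]
  intro j
  rw [dist_comm, Real.dist_eq]
  simp only [Pi.add_apply, Pi.smul_apply, smul_eq_mul]
  by_cases hj : j = l
  · subst hj; rw [hcomb]; simpa using hε
  · have h1 := abs_lt.1 (he₁ j hj)
    have h2 := abs_lt.1 (he₂ j hj)
    have h3 : a * g t y₁ j + b * g t y₂ j - v j =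
        a * (g t y₁ j - v j) + b * (g t y₂ j - v j) := by
      linear_combination v j * hab
    rw [h3]
    have hb' : b = 1 - a := by linarith
    subst hb'
    refine abs_lt.2 ⟨?_, ?_⟩
    · rcases ha.eq_or_lt with rfl | ha'
      · simpa using h2.1
      · nlinarith
    · rcases ha.eq_or_lt with rfl | ha'
      · simpa using h2.2
      · nlinarith

/-! ### Existence of solutions by Euler's scheme -/

/-- Euler's scheme with step `h`. -/
def eulerStep {n : ℕ} (g : ℝ → (Fin n → ℝ) → (Fin n → ℝ)) (t₀ h : ℝ) (ξ : Fin n → ℝ) :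
    ℕ → Fin n → ℝ
  | 0 => ξ
  | k + 1 => eulerStep g t₀ h ξ k + h • g (t₀ + k * h) (eulerStep g t₀ h ξ k)

theorem norm_eulerStep_sub_le {n : ℕ} {g : ℝ → (Fin n → ℝ) → (Fin n → ℝ)} {t₀ h M b : ℝ}
    {ξ : Fin n → ℝ} (hh : 0 ≤ h) (hM : ∀ t ∈ Icc t₀ b, ∀ x, ‖g t x‖ ≤ M) {k l : ℕ} (hkl : k ≤ l)
    (hl : t₀ + l * h ≤ b) :
    ‖eulerStep g t₀ h ξ l - eulerStep g t₀ h ξ k‖ ≤ M * ((l - k) * h) := by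
  induction l, hkl using Nat.le_induction with
  | base => simp
  | succ l hkl ih =>
    push_cast at hl ⊢
    have h1 := ih (by nlinarith)
    have h2 := hM (t₀ + l * h) ⟨by nlinarith [(Nat.cast_nonneg l : (0 : ℝ) ≤ l)], by nlinarith⟩
      (eulerStep g t₀ h ξ l)
    rw [eulerStep, add_sub_right_comm]
    refine (norm_add_le _ _).trans ?_
    rw [norm_smul, Real.norm_of_nonneg hh]
    nlinarith

/-- A discrete mean value inequality, which transfers coordinate bounds on the field to difference
quotients of the limit. -/
theorem mul_eulerStep_sub_le {n : ℕ} {g : ℝ → (Fin n → ℝ) → (Fin n → ℝ)} {t₀ h σ c : ℝ}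
    {ξ : Fin n → ℝ} (hh : 0 ≤ h) (j : Fin n) {k l : ℕ} (hkl : k ≤ l)
    (hc : ∀ m, k ≤ m → m < l → σ * g (t₀ + m * h) (eulerStep g t₀ h ξ m) j ≤ c) :
    σ * (eulerStep g t₀ h ξ l j - eulerStep g t₀ h ξ k j) ≤ c * ((l - k) * h) := by
  induction l, hkl using Nat.le_induction with
  | base => simp
  | succ l hkl ih =>
    have h1 := ih fun m hm hml => hc m hm (by omega)
    have h2 := mul_le_mul_of_nonneg_right (hc l hkl (by omega)) hh
    simp only [eulerStep, Pi.add_apply, Pi.smul_apply, smul_eq_mul]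
    push_cast
    nlinarith

/-- The piecewise constant interpolation of Euler's scheme. -/
def eulerApprox {n : ℕ} (g : ℝ → (Fin n → ℝ) → (Fin n → ℝ)) (t₀ h : ℝ) (ξ : Fin n → ℝ) (t : ℝ) :
    Fin n → ℝ := eulerStep g t₀ h ξ ⌊(t - t₀) / h⌋₊

theorem floor_div_mul_mem {s h : ℝ} (hs : 0 ≤ s) (hh : 0 < h) :
    (⌊s / h⌋₊ : ℝ) * h ≤ s ∧ s < ⌊s / h⌋₊ * h + h := by
  have h1 := Nat.floor_le (div_nonneg hs hh.le)
  have h2 := Nat.lt_floor_add_one (s / h)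
  rw [le_div_iff₀ hh] at h1
  rw [div_lt_iff₀ hh] at h2
  exact ⟨h1, by linarith⟩

theorem norm_eulerApprox_sub_le {n : ℕ} {g : ℝ → (Fin n → ℝ) → (Fin n → ℝ)} {t₀ h M b : ℝ}
    {ξ : Fin n → ℝ} (hh : 0 < h) (hM : ∀ t ∈ Icc t₀ b, ∀ x, ‖g t x‖ ≤ M) (hM0 : 0 ≤ M) {s t : ℝ}
    (hs : t₀ ≤ s) (hst : s ≤ t) (ht : t ≤ b) :
    ‖eulerApprox g t₀ h ξ t - eulerApprox g t₀ h ξ s‖ ≤ M * (t - s + h) := by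
  have h1 := floor_div_mul_mem (by linarith : 0 ≤ s - t₀) hh
  have h2 := floor_div_mul_mem (by linarith : 0 ≤ t - t₀) hh
  refine (norm_eulerStep_sub_le hh.le hM (Nat.floor_mono (by gcongr)) (by linarith)).trans ?_
  gcongr
  linarith

/-- For a locally bounded field, Euler's scheme has locally Lipschitz limits, whose derivatives
satisfy every coordinate bound that the field satisfies nearby. -/
theorem exists_euler_limit {n : ℕ} (g : ℝ → (Fin n → ℝ) → (Fin n → ℝ)) (t₀ : ℝ) (ξ : Fin n → ℝ)
    (hg : ∀ b, ∃ M, ∀ t ∈ Icc t₀ b, ∀ x, ‖g t x‖ ≤ M) :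
    ∃ x : ℝ → Fin n → ℝ, x t₀ = ξ ∧
      (∀ b, ∃ M, 0 ≤ M ∧ ∀ s t, t₀ ≤ s → s ≤ t → t ≤ b → ‖x t - x s‖ ≤ M * (t - s)) ∧
      ∀ t, t₀ ≤ t → ∀ v, HasDerivAt x v t → ∀ j σ c,
        (∀ᶠ p in 𝓝 (t, x t), σ * g p.1 p.2 j ≤ c) → σ * v j ≤ c := by
  have hg' : ∀ b, ∃ M, 0 ≤ M ∧ ∀ t ∈ Icc t₀ b, ∀ x, ‖g t x‖ ≤ M := fun b => by
    obtain ⟨M, hM⟩ := hg b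
    exact ⟨max M 0, le_max_right _ _, fun t ht x => (hM t ht x).trans (le_max_left _ _)⟩
  set h : ℕ → ℝ := fun m => 1 / ((m : ℝ) + 1)
  have hh : ∀ m, 0 < h m := fun m => by positivity
  have hh1 : ∀ m, h m ≤ 1 := fun m => by
    rw [div_le_one (by positivity)]; linarith [(Nat.cast_nonneg m : (0 : ℝ) ≤ m)]
  -- Limits along one nonprincipal ultrafilter exist at all times simultaneously, by boundedness; no
  -- subsequence has to be extracted.
  have hh0 : Tendsto h (hyperfilter ℕ) (𝓝 0) :=
    tendsto_one_div_add_atTop_nhds_zero_nat.mono_left Nat.hyperfilter_le_atTop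
  set X : ℕ → ℝ → Fin n → ℝ := fun m => eulerApprox g t₀ (h m) ξ
  have hX0 : ∀ m, X m t₀ = ξ := fun m => by simp [X, eulerApprox, eulerStep]
  have hlim : ∀ t, ∃ x, t₀ ≤ t → Tendsto (fun m => X m t) (hyperfilter ℕ) (𝓝 x) := by
    intro t
    by_cases ht : t₀ ≤ t
    · obtain ⟨M, hM0, hM⟩ := hg' t
      have hmem : ∀ m, X m t ∈ Metric.closedBall ξ (M * (t - t₀ + 1)) := fun m => by
        rw [Metric.mem_closedBall, dist_eq_norm]
        have h1 := norm_eulerApprox_sub_le (ξ := ξ) (hh m) hM hM0 le_rfl ht le_rfl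
        have h2 := hX0 m
        simp only [X] at h2 ⊢
        rw [h2] at h1
        refine h1.trans ?_
        gcongr
        exact hh1 m
      obtain ⟨x, -, hx⟩ := (isCompact_closedBall ξ (M * (t - t₀ + 1))).ultrafilter_le_nhds
        ((hyperfilter ℕ).map fun m => X m t) (by
          rw [le_principal_iff]
          exact Filter.mem_map.2 (Filter.univ_mem' hmem))
      exact ⟨x, fun _ => hx⟩
    · exact ⟨0, fun h => absurd h ht⟩
  choose x hx using hlim
  have hLip : ∀ b, ∀ M, 0 ≤ M → (∀ t ∈ Icc t₀ b, ∀ x, ‖g t x‖ ≤ M) → ∀ s t, t₀ ≤ s → s ≤ t →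
      t ≤ b → ‖x t - x s‖ ≤ M * (t - s) := by
    intro b M hM0 hM s t hs hst ht
    have h1 : Tendsto (fun m => ‖X m t - X m s‖) (hyperfilter ℕ) (𝓝 ‖x t - x s‖) :=
      ((hx t (hs.trans hst)).sub (hx s hs)).norm
    have h2 : Tendsto (fun m => M * (t - s + h m)) (hyperfilter ℕ) (𝓝 (M * (t - s + 0))) :=
      (hh0.const_add _).const_mul _
    rw [add_zero] at h2
    exact le_of_tendsto_of_tendsto' h1 h2 fun m =>
      norm_eulerApprox_sub_le (hh m) hM hM0 hs hst ht
  refine ⟨x, ?_, fun b => ?_, ?_⟩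
  · refine tendsto_nhds_unique (hx t₀ le_rfl) ?_
    simp only [hX0]
    exact tendsto_const_nhds
  · obtain ⟨M, hM0, hM⟩ := hg' b
    exact ⟨M, hM0, hLip b M hM0 hM⟩
  · intro t ht v hv j σ c hev
    obtain ⟨δ, hδ, hball⟩ := Metric.eventually_nhds_iff.1 hev
    obtain ⟨M, hM0, hM⟩ := hg' (t + 1)
    -- Over a time `δ'` plus one step, the Euler iterates starting within `δ / 2` of `x t` stay in
    -- the `δ`-ball where the bound on the field holds.
    obtain ⟨δ', hδ', hδ1, hδ2, hδ3⟩ : ∃ δ', 0 < δ' ∧ δ' ≤ 1 ∧ δ' ≤ δ / 2 ∧ M * (2 * δ') ≤ δ / 2 := by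
      refine ⟨min 1 (min (δ / 2) (δ / (4 * (M + 1)))), by positivity, min_le_left _ _,
        (min_le_right _ _).trans (min_le_left _ _), ?_⟩
      have h1 : min 1 (min (δ / 2) (δ / (4 * (M + 1)))) ≤ δ / (4 * (M + 1)) :=
        (min_le_right _ _).trans (min_le_right _ _)
      calc _ ≤ (M + 1) * (2 * (δ / (4 * (M + 1)))) := by gcongr; linarith
        _ = δ / 2 := by field_simp; ring
    have hright : ∀ t', t < t' → t' < t + δ' → σ * (x t' j - x t j) ≤ c * (t' - t) := by
      intro t' htt' ht'
      have h1 : Tendsto (fun m => σ * (X m t' j - X m t j)) (hyperfilter ℕ)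
          (𝓝 (σ * (x t' j - x t j))) :=
        (((tendsto_pi_nhds.1 (hx t' (by linarith))) j).sub
          ((tendsto_pi_nhds.1 (hx t ht)) j)).const_mul σ
      have h2 : Tendsto (fun m => c * (t' - t) + |c| * h m) (hyperfilter ℕ)
          (𝓝 (c * (t' - t) + |c| * 0)) := (hh0.const_mul _).const_add _
      rw [mul_zero, add_zero] at h2
      refine le_of_tendsto_of_tendsto h1 h2 ?_
      have h3 : ∀ᶠ m in hyperfilter ℕ, dist (X m t) (x t) < δ / 2 :=
        (hx t ht).eventually (Metric.ball_mem_nhds _ (by positivity))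
      filter_upwards [h3, hh0.eventually_lt_const hδ'] with m hm1 hm2
      obtain ⟨h5, h6⟩ := floor_div_mul_mem (by linarith : 0 ≤ t - t₀) (hh m)
      obtain ⟨h7, h8⟩ := floor_div_mul_mem (by linarith : 0 ≤ t' - t₀) (hh m)
      have hkl : ⌊(t - t₀) / h m⌋₊ ≤ ⌊(t' - t₀) / h m⌋₊ :=
        Nat.floor_mono (div_le_div_of_nonneg_right (by linarith) (hh m).le)
      have h9 := mul_eulerStep_sub_le (g := g) (t₀ := t₀) (σ := σ) (c := c) (ξ := ξ) (hh m).le j hkl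
        (fun p hkp hpl => by
          have hkp' : (⌊(t - t₀) / h m⌋₊ : ℝ) * h m ≤ p * h m :=
            mul_le_mul_of_nonneg_right (by exact_mod_cast hkp) (hh m).le
          have hpl' : (p : ℝ) * h m ≤ ⌊(t' - t₀) / h m⌋₊ * h m :=
            mul_le_mul_of_nonneg_right (by exact_mod_cast hpl.le) (hh m).le
          apply hball (y := (t₀ + p * h m, eulerStep g t₀ (h m) ξ p))
          rw [Prod.dist_eq, max_lt_iff]
          constructor
          · rw [Real.dist_eq, abs_lt]
            exact ⟨by linarith, by linarith⟩
          · have h10 := norm_eulerStep_sub_le (ξ := ξ) (hh m).le hM hkp (by linarith)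
            rw [← dist_eq_norm] at h10
            have h11 : M * ((p - ⌊(t - t₀) / h m⌋₊) * h m) ≤ M * (2 * δ') := by
              refine mul_le_mul_of_nonneg_left ?_ hM0
              linarith
            have hm1' : dist (eulerStep g t₀ (h m) ξ ⌊(t - t₀) / h m⌋₊) (x t) < δ / 2 := hm1
            have := dist_triangle (eulerStep g t₀ (h m) ξ p)
              (eulerStep g t₀ (h m) ξ ⌊(t - t₀) / h m⌋₊) (x t)
            simp only
            linarith)
      -- Rounding to grid points changes the elapsed time by at most one step, an error that
      -- vanishes in the limit.
      have h12 : |((⌊(t' - t₀) / h m⌋₊ : ℝ) - ⌊(t - t₀) / h m⌋₊) * h m - (t' - t)| ≤ h m :=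
        abs_le.2 ⟨by linarith, by linarith⟩
      have h13 : c * (((⌊(t' - t₀) / h m⌋₊ : ℝ) - ⌊(t - t₀) / h m⌋₊) * h m - (t' - t)) ≤
          |c| * h m := (le_abs_self _).trans (by rw [abs_mul]; gcongr)
      simp only [X, eulerApprox]
      linarith
    have hvj : HasDerivAt (fun s => x s j) (v j) t := hasDerivAt_pi.1 hv j
    have hslope := (hasDerivAt_iff_tendsto_slope.1 hvj).mono_left
      (nhdsWithin_mono t (fun y (hy : y ∈ Ioi t) => (ne_of_gt hy : y ≠ t)))
    refine le_of_tendsto (hslope.const_mul σ) ?_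
    have hmem : Ioo t (t + δ') ∈ 𝓝[>] t := Ioo_mem_nhdsGT (by linarith)
    filter_upwards [hmem] with t' ht'
    rw [slope_def_field, mul_div_assoc', div_le_iff₀ (by linarith [ht'.1])]
    exact hright t' ht'.1 ht'.2

/-! ### Signals -/

namespace IsLipschitzSignal

variable {n : ℕ} {Δ : ℝ} {f : ℝ → ℝ} (hf : IsLipschitzSignal n Δ f)
include hf

theorem continuousOn_signalDeriv {i : ℕ} (hi : i < n) :
    ContinuousOn (signalDeriv i f) (Ici 0) :=
  hf.contDiffOn.continuousOn_iteratedDerivWithin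
    (by exact_mod_cast (by omega : i ≤ n - 1)) (uniqueDiffOn_Ici 0)

theorem continuousAt_signalDeriv {i : ℕ} (hi : i < n) {t : ℝ} (ht : 0 < t) :
    ContinuousAt (signalDeriv i f) t :=
  (hf.continuousOn_signalDeriv hi).continuousAt (Ici_mem_nhds ht)

theorem hasDerivWithinAt_signalDeriv {i : ℕ} (hi : i + 1 < n) {t : ℝ} (ht : 0 ≤ t) :
    HasDerivWithinAt (signalDeriv i f) (signalDeriv (i + 1) f t) (Ici 0) t := by
  have h := hf.contDiffOn.differentiableOn_iteratedDerivWithin (m := i)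
    (by exact_mod_cast (by omega : i < n - 1)) (uniqueDiffOn_Ici 0) t ht
  have h1 : signalDeriv (i + 1) f t = derivWithin (iteratedDerivWithin i f (Ici 0)) (Ici 0) t := by
    rw [signalDeriv, iteratedDerivWithin_succ]
  rw [h1]
  exact h.hasDerivWithinAt

theorem hasDerivAt_signalDeriv {i : ℕ} (hi : i + 1 < n) {t : ℝ} (ht : 0 < t) :
    HasDerivAt (signalDeriv i f) (signalDeriv (i + 1) f t) t :=
  (hf.hasDerivWithinAt_signalDeriv hi ht.le).hasDerivAt (Ici_mem_nhds ht)

theorem lipschitzOnWith_signalDeriv_last (hΔ : 0 ≤ Δ) :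
    LipschitzOnWith Δ.toNNReal (signalDeriv (n - 1) f) (Ici 0) :=
  LipschitzOnWith.of_dist_le_mul fun x hx y hy => by
    rw [Real.dist_eq, Real.dist_eq, Real.coe_toNNReal _ hΔ]
    exact hf.lipschitz y hy x hx

theorem absolutelyContinuousOnInterval_signalDeriv (hΔ : 0 ≤ Δ) {i : ℕ} (hi : i < n) {a b : ℝ}
    (ha : 0 ≤ a) (hab : a ≤ b) : AbsolutelyContinuousOnInterval (signalDeriv i f) a b := by
  have hsub : uIcc a b ⊆ Ici 0 := by
    rw [uIcc_of_le hab]; exact fun t ht => ha.trans ht.1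
  by_cases hin : i = n - 1
  · subst hin
    exact ((hf.lipschitzOnWith_signalDeriv_last hΔ).mono hsub).absolutelyContinuousOnInterval
  · obtain ⟨C, hC⟩ := isCompact_uIcc.exists_bound_of_continuousOn
      ((hf.continuousOn_signalDeriv (by omega : i + 1 < n)).mono hsub)
    have hlip := (convex_uIcc a b).lipschitzOnWith_of_nnnorm_hasDerivWithin_le
      (C := C.toNNReal) (f := signalDeriv i f) (f' := signalDeriv (i + 1) f)
      (fun t ht => (hf.hasDerivWithinAt_signalDeriv (by omega) (hsub ht)).mono hsub)
      (fun t ht => by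
        rw [← NNReal.coe_le_coe, coe_nnnorm]
        exact (hC t ht).trans (Real.le_coe_toNNReal C))
    exact hlip.absolutelyContinuousOnInterval

theorem ae_hasDerivAt_signalDeriv_last (hn : 1 ≤ n) (hΔ : 0 ≤ Δ) {a b : ℝ} (ha : 0 ≤ a)
    (hab : a ≤ b) : ∀ᵐ t, t ∈ Icc a b →
      HasDerivAt (signalDeriv (n - 1) f) (signalDeriv n f t) t ∧ |signalDeriv n f t| ≤ Δ := by
  have hac := hf.absolutelyContinuousOnInterval_signalDeriv hΔ (by omega : n - 1 < n) ha hab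
  -- At `t = 0` the signal has only one-sided derivatives; discarding this point turns them into
  -- ordinary ones.
  have h0 : ∀ᵐ t : ℝ, t ≠ 0 := by simp [ae_iff, measure_singleton]
  filter_upwards [hac.ae_differentiableAt, h0] with t ht ht0 hm
  have htpos : 0 < t := lt_of_le_of_ne (ha.trans hm.1) (Ne.symm ht0)
  have hd := ht (by rwa [uIcc_of_le hab])
  have heq : signalDeriv n f t = deriv (signalDeriv (n - 1) f) t := by
    obtain ⟨m, rfl⟩ : ∃ m, n = m + 1 := ⟨n - 1, by omega⟩
    rw [signalDeriv, iteratedDerivWithin_succ, derivWithin_of_mem_nhds (Ici_mem_nhds htpos)]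
    rfl
  rw [heq]
  refine ⟨hd.hasDerivAt, ?_⟩
  have := norm_deriv_le_of_lipschitzOn (Ici_mem_nhds htpos) (hf.lipschitzOnWith_signalDeriv_last hΔ)
  rwa [Real.coe_toNNReal _ hΔ] at this

end IsLipschitzSignal

/-! ### From solutions to error trajectories -/

theorem IsFilippovSolution.mono {n : ℕ} {g : ℝ → (Fin n → ℝ) → (Fin n → ℝ)} {I J : Set ℝ}
    {x : ℝ → Fin n → ℝ} (h : IsFilippovSolution g J x) (hIJ : I ⊆ J) :
    IsFilippovSolution g I x :=
  ⟨fun a ha b hb => h.absolutelyContinuous a (hIJ ha) b (hIJ hb), by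
    filter_upwards [h.inclusion] with t ht hm using ht (hIJ hm)⟩

theorem coord_of_lt {n : ℕ} (x : Fin n → ℝ) {j : ℕ} (h : j < n) : coord x j = x ⟨j, h⟩ :=
  dif_pos h

theorem coord_self {n : ℕ} (x : Fin n → ℝ) : coord x n = 0 := dif_neg (lt_irrefl n)

theorem continuous_coord {n : ℕ} (j : ℕ) : Continuous fun x : Fin n → ℝ => coord x j := by
  by_cases h : j < n
  · simp only [coord_of_lt _ h]; fun_prop
  · simp only [coord, dif_neg h]; fun_prop

/-- The differentiation error with one-based index `i ≥ 1`. -/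
def diffError {n : ℕ} (f : ℝ → ℝ) (x : ℝ → Fin n → ℝ) (i : ℕ) (t : ℝ) : ℝ :=
  coord (x t) (i - 1) - signalDeriv (i - 1) f t

/-- The selection of the last injection realised by a solution. -/
def lastSelection {n : ℕ} (k : ℕ → ℝ) (x : ℝ → Fin n → ℝ) (t : ℝ) : ℝ :=
  -deriv (fun s => coord (x s) (n - 1)) t / k n

theorem diffError_one {n : ℕ} (f : ℝ → ℝ) (x : ℝ → Fin n → ℝ) (t : ℝ) :
    diffError f x 1 t = coord (x t) 0 - f t := by
  simp [diffError, signalDeriv]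

namespace Admissible

variable {n : ℕ} {d₀ dinf : ℝ} {κ θ : ℕ → ℝ} (H : Admissible n d₀ dinf κ θ)
include H

theorem continuous_differentiatorField {k : ℕ → ℝ} {f : ℝ → ℝ} (t : ℝ) {j : Fin n}
    (hj : (j : ℕ) + 1 < n) :
    Continuous fun y => differentiatorField n d₀ dinf κ θ k f t y j := by
  have h1 := H.injection_continuous hj
  have h2 := continuous_coord (n := n) 0
  have h3 := continuous_coord (n := n) ((j : ℕ) + 1)
  unfold differentiatorField
  exact (continuous_const.mul (h1.comp (h2.sub continuous_const))).add h3

/-- All coordinates of the field but the last are continuous in the state, so the inclusion is an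
equation there. In the last one it yields comparisons with the injection at points strictly on
either side of `e_1`, which is all that is kept of the selection `w`. -/
theorem isErrorTrajectory_of_isFilippovSolution {k : ℕ → ℝ} {Δ : ℝ} {f : ℝ → ℝ} (hΔ : 0 ≤ Δ)
    (hk : ∀ i, 0 < k i) (hf : IsLipschitzSignal n Δ f) {x : ℝ → Fin n → ℝ} {a b : ℝ} (ha : 0 ≤ a)
    (hab : a ≤ b)
    (h : IsFilippovSolution (differentiatorField n d₀ dinf κ θ k f) (Icc a b) x) :
    IsErrorTrajectory n d₀ dinf κ θ k Δ (diffError f x) (lastSelection k x) a b := by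
  have hn2 := H.two_le
  have hk0 := hk n
  have hac := h.absolutelyContinuous a ⟨le_rfl, hab⟩ b ⟨hab, le_rfl⟩
  have hlast : n - 1 + 1 = n := by omega
  have hselect : ∀ᵐ t, t ∈ Icc a b →
      HasDerivAt (fun s => coord (x s) (n - 1)) (-k n * lastSelection k x t) t ∧
      (∀ s, coord (x t) 0 - f t < s → lastSelection k x t ≤ injection n d₀ dinf κ θ n s) ∧
      (∀ s, s < coord (x t) 0 - f t → injection n d₀ dinf κ θ n s ≤ lastSelection k x t) := by
    filter_upwards [h.inclusion] with t ht hm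
    obtain ⟨v, hvF, hv⟩ := ht hm
    have hv' : HasDerivAt (fun s => coord (x s) (n - 1)) (v ⟨n - 1, by omega⟩) t := by
      simp only [coord_of_lt _ (by omega : n - 1 < n)]
      exact hasDerivAt_pi.1 hv _
    have hvw : v ⟨n - 1, by omega⟩ = -k n * lastSelection k x t := by
      rw [lastSelection, hv'.deriv]; field_simp
    have hfield : ∀ y, differentiatorField n d₀ dinf κ θ k f t y ⟨n - 1, by omega⟩ =
        -k n * injection n d₀ dinf κ θ n (coord y 0 - f t) := fun y => by
      simp only [differentiatorField, hlast, coord_self, add_zero]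
    have hcont : Continuous fun y : Fin n → ℝ => coord y 0 - f t :=
      (continuous_coord 0).sub continuous_const
    refine ⟨hvw ▸ hv', fun s hs => ?_, fun s hs => ?_⟩
    · have := mul_le_of_mem_filippov hvF ⟨n - 1, by omega⟩ (-1)
        (k n * injection n d₀ dinf κ θ n s) (by
          filter_upwards [(hcont.tendsto (x t)).eventually_lt_const hs] with y hy
          rw [hfield]
          nlinarith [H.injection_monotone le_rfl hy.le])
      rw [hvw] at this
      nlinarith
    · have := mul_le_of_mem_filippov hvF ⟨n - 1, by omega⟩ 1
        (-(k n * injection n d₀ dinf κ θ n s)) (by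
          filter_upwards [(hcont.tendsto (x t)).eventually_const_lt hs] with y hy
          rw [hfield]
          nlinarith [H.injection_monotone le_rfl hy.le])
      rw [hvw] at this
      nlinarith
  refine ⟨fun i hi => ?_, fun i hi => ?_, ?_, ?_, ?_, ?_⟩
  · rw [Finset.mem_Icc] at hi
    have h1 := hac.pi_apply ⟨i - 1, by omega⟩
    have h2 := hf.absolutelyContinuousOnInterval_signalDeriv hΔ (by omega : i - 1 < n) ha hab
    have h3 : diffError f x i = (fun t => x t ⟨i - 1, by omega⟩) - signalDeriv (i - 1) f := by
      ext t; simp [diffError, coord_of_lt _ (by omega : i - 1 < n)]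
    rw [h3]
    exact h1.sub h2
  · rw [Finset.mem_Ico] at hi
    obtain ⟨j, rfl⟩ : ∃ j, i = j + 1 := ⟨i - 1, by omega⟩
    have h0 : ∀ᵐ t : ℝ, t ≠ 0 := by simp [ae_iff, measure_singleton]
    filter_upwards [h.inclusion, h0] with t ht ht0 hm
    have htpos : 0 < t := lt_of_le_of_ne (ha.trans hm.1) (Ne.symm ht0)
    obtain ⟨v, hvF, hv⟩ := ht hm
    have h1 := apply_eq_of_mem_filippov hvF ⟨j, by omega⟩
      (H.continuous_differentiatorField t (j := ⟨j, by omega⟩) hi.2).continuousAt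
    have h2 := (hasDerivAt_pi.1 hv ⟨j, by omega⟩).sub (hf.hasDerivAt_signalDeriv hi.2 htpos)
    rw [h1] at h2
    have h3 : diffError f x (j + 1) = (fun s => x s ⟨j, by omega⟩) - signalDeriv j f := by
      ext t; simp [diffError, coord_of_lt _ (by omega : j < n)]
    rw [h3]
    convert! h2 using 1
    rw [diffError_one, diffError, differentiatorField]
    simp only [add_tsub_cancel_right]
    ring
  · filter_upwards [hselect, hf.ae_hasDerivAt_signalDeriv_last (by omega) hΔ ha hab] with t h1 h2 hm
    convert! (h1 hm).1.sub (h2 hm).1 using 1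
    simp [diffError, coord_self]
    ring
  · filter_upwards [hf.ae_hasDerivAt_signalDeriv_last (by omega) hΔ ha hab] with t h2 hm
    simpa [diffError, coord_self] using (h2 hm).2
  · filter_upwards [hselect] with t h1 hm
    rw [diffError_one]
    exact (h1 hm).2.1
  · filter_upwards [hselect] with t h1 hm
    rw [diffError_one]
    exact (h1 hm).2.2

/-- A vector satisfying all coordinate bounds that hold for the field near `(t, x)` belongs to
Filippov's set. -/
theorem mem_filippov_of_coordinate_bounds {k : ℕ → ℝ} {f : ℝ → ℝ} (hk : ∀ i, 0 < k i)
    {t : ℝ} {x v : Fin n → ℝ} (hft : ContinuousAt f t)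
    (h : ∀ j σ c, (∀ᶠ p in 𝓝 (t, x), σ * differentiatorField n d₀ dinf κ θ k f p.1 p.2 j ≤ c) →
      σ * v j ≤ c) : v ∈ filippov (differentiatorField n d₀ dinf κ θ k f) t x := by
  have hn2 := H.two_le
  have hk0 := hk n
  have hlast : n - 1 + 1 = n := by omega
  have hfield : ∀ s y, differentiatorField n d₀ dinf κ θ k f s y ⟨n - 1, by omega⟩ =
      -k n * injection n d₀ dinf κ θ n (coord y 0 - f s) := fun s y => by
    simp only [differentiatorField, hlast, coord_self, add_zero]
  have herr : ContinuousAt (fun p : ℝ × (Fin n → ℝ) => coord p.2 0 - f p.1) (t, x) :=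
    ((continuous_coord 0).continuousAt.comp continuousAt_snd).sub
      (ContinuousAt.comp (g := f) hft continuousAt_fst)
  have hx0 : ∀ y : Fin n → ℝ, coord y 0 = y ⟨0, by omega⟩ := fun y => coord_of_lt y (by omega)
  refine mem_filippov_of_between ⟨0, by omega⟩ ⟨n - 1, by omega⟩ (fun j hj => ?_)
    (fun y hy => ?_) (fun y hy => ?_)
  · have hjn : (j : ℕ) + 1 < n := by
      have : (j : ℕ) ≠ n - 1 := fun he => hj (Fin.ext he)
      omega
    refine ⟨?_, (H.continuous_differentiatorField t hjn).continuousAt⟩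
    have hcont : ContinuousAt (fun p : ℝ × (Fin n → ℝ) =>
        differentiatorField n d₀ dinf κ θ k f p.1 p.2 j) (t, x) := by
      unfold differentiatorField
      exact (continuousAt_const.mul ((H.injection_continuous hjn).continuousAt.comp herr)).add
        ((continuous_coord _).continuousAt.comp continuousAt_snd)
    refine le_antisymm (le_of_forall_gt_imp_ge_of_dense fun c hc => ?_)
      (le_of_forall_lt_imp_le_of_dense fun c hc => ?_)
    · have := h j 1 c (by
        filter_upwards [hcont.eventually_lt_const hc] with p hp
        linarith)
      linarith
    · have := h j (-1) (-c) (by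
        filter_upwards [hcont.eventually_const_lt hc] with p hp
        linarith)
      linarith
  · rw [hfield]
    -- Near `(t, x)` the error stays below that of `y`, so monotonicity of the injection gives the
    -- bound even across a jump.
    have := h ⟨n - 1, by omega⟩ (-1) (k n * injection n d₀ dinf κ θ n (coord y 0 - f t)) (by
      have hlt : coord x 0 - f t < coord y 0 - f t := by rw [hx0, hx0]; linarith
      filter_upwards [herr.eventually_lt_const hlt] with p hp
      rw [hfield]
      nlinarith [H.injection_monotone le_rfl hp.le])
    linarith
  · rw [hfield]
    have := h ⟨n - 1, by omega⟩ 1 (-(k n * injection n d₀ dinf κ θ n (coord y 0 - f t))) (by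
      have hlt : coord y 0 - f t < coord x 0 - f t := by rw [hx0, hx0]; linarith
      filter_upwards [herr.eventually_const_lt hlt] with p hp
      rw [hfield]
      nlinarith [H.injection_monotone le_rfl hp.le])
    linarith

end Admissible

/-! ### Existence and extension of solutions -/

theorem lipschitzOnWith_of_norm_sub_le {n : ℕ} {x : ℝ → Fin n → ℝ} {I : Set ℝ} {M : ℝ}
    (hM : 0 ≤ M) (h : ∀ s ∈ I, ∀ t ∈ I, s ≤ t → ‖x t - x s‖ ≤ M * (t - s)) :
    LipschitzOnWith M.toNNReal x I := by
  refine LipschitzOnWith.of_dist_le_mul fun s hs t ht => ?_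
  rw [Real.coe_toNNReal _ hM]
  rcases le_total s t with hst | hst
  · rw [dist_comm, dist_eq_norm, dist_comm, Real.dist_eq, abs_of_nonneg (by linarith)]
    exact h s hs t ht hst
  · rw [dist_eq_norm, Real.dist_eq, abs_of_nonneg (by linarith)]
    exact h t ht s hs hst

theorem absolutelyContinuousOnInterval_of_norm_sub_le {n : ℕ} {x : ℝ → Fin n → ℝ} {a b M : ℝ}
    (hM : 0 ≤ M)
    (h : ∀ s t, min a b ≤ s → s ≤ t → t ≤ max a b → ‖x t - x s‖ ≤ M * (t - s)) :
    AbsolutelyContinuousOnInterval x a b :=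
  (lipschitzOnWith_of_norm_sub_le hM fun s hs t ht hst =>
    h s t hs.1 hst ht.2).absolutelyContinuousOnInterval

theorem isFilippovSolution_Ici {n : ℕ} {g : ℝ → (Fin n → ℝ) → (Fin n → ℝ)} {t₀ : ℝ}
    {x : ℝ → Fin n → ℝ} (h : ∀ b, t₀ ≤ b → IsFilippovSolution g (Icc t₀ b) x) :
    IsFilippovSolution g (Ici t₀) x := by
  refine ⟨fun a ha b hb => (h (max a b) (ha.trans (le_max_left _ _))).absolutelyContinuous a
    ⟨ha, le_max_left _ _⟩ b ⟨hb, le_max_right _ _⟩, ?_⟩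
  have : ∀ᵐ t : ℝ, ∀ N : ℕ, t ∈ Icc t₀ (t₀ + N) → ∃ v ∈ filippov g t (x t), HasDerivAt x v t :=
    ae_all_iff.2 fun N => (h (t₀ + N) (by simp)).inclusion
  filter_upwards [this] with t ht hm
  obtain ⟨N, hN⟩ := exists_nat_ge (t - t₀)
  exact ht N ⟨hm, by linarith⟩

/-! ### Truncated fields and a priori bounds -/

/-- Truncation to `[-R, R]`. -/
def clampTo (R z : ℝ) : ℝ := max (-R) (min R z)

theorem abs_clampTo_le {R : ℝ} (hR : 0 ≤ R) (z : ℝ) : |clampTo R z| ≤ R :=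
  abs_le.2 ⟨le_max_left _ _, max_le (by linarith) (min_le_left _ _)⟩

theorem clampTo_of_abs_le {R z : ℝ} (h : |z| ≤ R) : clampTo R z = z := by
  obtain ⟨h1, h2⟩ := abs_le.1 h
  rw [clampTo, min_eq_right h2, max_eq_right h1]

/-- The differentiator field truncated at errors of size `R`. -/
def truncatedField (n : ℕ) (d₀ dinf : ℝ) (κ θ k : ℕ → ℝ) (f : ℝ → ℝ) (R : ℝ)
    (t : ℝ) (x : Fin n → ℝ) : Fin n → ℝ := fun j =>
  -k (j + 1) * injection n d₀ dinf κ θ (j + 1) (clampTo R (coord x 0 - f t)) +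
    if (j : ℕ) + 1 < n then
      signalDeriv (j + 1) f t + clampTo R (coord x (j + 1) - signalDeriv (j + 1) f t)
    else 0

theorem exists_signalDeriv_bound {n : ℕ} {Δ : ℝ} {f : ℝ → ℝ} (hf : IsLipschitzSignal n Δ f)
    (b : ℝ) : ∃ D, 0 ≤ D ∧ ∀ i < n, ∀ t ∈ Icc 0 b, |signalDeriv i f t| ≤ D := by
  have : ∀ i, ∃ D, 0 ≤ D ∧ (i < n → ∀ t ∈ Icc 0 b, |signalDeriv i f t| ≤ D) := fun i => by
    by_cases hi : i < n
    · obtain ⟨C, hC⟩ := (isCompact_Icc (a := (0 : ℝ)) (b := b)).exists_bound_of_continuousOn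
        ((hf.continuousOn_signalDeriv hi).mono Icc_subset_Ici_self)
      exact ⟨max C 0, le_max_right _ _, fun _ t ht => (hC t ht).trans (le_max_left _ _)⟩
    · exact ⟨0, le_rfl, fun h => absurd h hi⟩
  choose D hD0 hD using this
  refine ⟨∑ i ∈ Finset.range n, D i, Finset.sum_nonneg fun i _ => hD0 i, fun i hi t ht => ?_⟩
  exact (hD i hi t ht).trans
    (Finset.single_le_sum (fun j _ => hD0 j) (Finset.mem_range.2 hi))

namespace Admissible

variable {n : ℕ} {d₀ dinf : ℝ} {κ θ : ℕ → ℝ} (H : Admissible n d₀ dinf κ θ)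
include H

theorem abs_injection_le {i : ℕ} (hi : i ≤ n) {z R : ℝ} (hz : |z| ≤ R) :
    |injection n d₀ dinf κ θ i z| ≤ injection n d₀ dinf κ θ i R :=
  abs_le_of_odd_of_monotone (fun x => injection_neg i x) (H.injection_monotone hi) hz le_rfl

theorem exists_truncatedField_bound {k : ℕ → ℝ} {Δ R : ℝ} {f : ℝ → ℝ} (hk : ∀ i, 0 < k i)
    (hf : IsLipschitzSignal n Δ f) (hR : 0 ≤ R) {t₀ : ℝ} (ht₀ : 0 ≤ t₀) (b : ℝ) :
    ∃ M, ∀ t ∈ Icc t₀ b, ∀ x, ‖truncatedField n d₀ dinf κ θ k f R t x‖ ≤ M := by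
  obtain ⟨D, hD0, hD⟩ := exists_signalDeriv_bound hf b
  have hnn : ∀ i < n, 0 ≤ k (i + 1) * injection n d₀ dinf κ θ (i + 1) R := fun i hi =>
    mul_nonneg (hk _).le ((abs_nonneg _).trans (H.abs_injection_le (i := i + 1) hi
      (z := R) (abs_of_nonneg hR).le))
  refine ⟨∑ i ∈ Finset.range n, k (i + 1) * injection n d₀ dinf κ θ (i + 1) R + (D + R),
    fun t ht x => ?_⟩
  have hsum := Finset.sum_nonneg fun i hi => hnn i (Finset.mem_range.1 hi)
  rw [pi_norm_le_iff_of_nonneg (by linarith)]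
  intro j
  rw [Real.norm_eq_abs, truncatedField]
  refine (abs_add_le _ _).trans (add_le_add ?_ ?_)
  · rw [abs_mul, abs_neg, abs_of_pos (hk _)]
    have h1 := H.abs_injection_le (i := (j : ℕ) + 1) j.2 (abs_clampTo_le hR (coord x 0 - f t))
    refine (mul_le_mul_of_nonneg_left h1 (hk _).le).trans ?_
    exact Finset.single_le_sum
      (f := fun i => k (i + 1) * injection n d₀ dinf κ θ (i + 1) R)
      (fun i hi => hnn i (Finset.mem_range.1 hi)) (Finset.mem_range.2 j.2)
  · split_ifs with hj
    · exact (abs_add_le _ _).trans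
        (add_le_add (hD _ hj t ⟨ht₀.trans ht.1, ht.2⟩) (abs_clampTo_le hR _))
    · rw [abs_zero]; linarith

omit H in
theorem eventually_truncatedField_eq {k : ℕ → ℝ} {Δ R : ℝ} {f : ℝ → ℝ} (hn : 1 ≤ n)
    (hf : IsLipschitzSignal n Δ f) {t : ℝ} (ht : 0 < t) {x : Fin n → ℝ}
    (hx : ∀ i < n, |coord x i - signalDeriv i f t| < R) :
    ∀ᶠ p in 𝓝 (t, x), truncatedField n d₀ dinf κ θ k f R p.1 p.2 =
      differentiatorField n d₀ dinf κ θ k f p.1 p.2 := by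
  have hev : ∀ᶠ p : ℝ × (Fin n → ℝ) in 𝓝 (t, x), ∀ i ∈ Finset.range n,
      |coord p.2 i - signalDeriv i f p.1| < R := by
    rw [Filter.eventually_all_finset]
    intro i hi
    have hi' := Finset.mem_range.1 hi
    have hc : ContinuousAt (fun p : ℝ × (Fin n → ℝ) => |coord p.2 i - signalDeriv i f p.1|)
        (t, x) :=
      (((continuous_coord i).continuousAt.comp continuousAt_snd).sub
        (ContinuousAt.comp (g := signalDeriv i f) (hf.continuousAt_signalDeriv hi' ht)
          continuousAt_fst)).abs
    exact hc.eventually_lt_const (hx i hi')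
  filter_upwards [hev] with p hp
  ext j
  have h0 := hp 0 (Finset.mem_range.2 hn)
  rw [show signalDeriv 0 f p.1 = f p.1 by simp [signalDeriv]] at h0
  rw [truncatedField, differentiatorField, clampTo_of_abs_le h0.le]
  congr 1
  split_ifs with hj
  · rw [clampTo_of_abs_le (hp _ (Finset.mem_range.2 hj)).le]; ring
  · rw [show (j : ℕ) + 1 = n by omega, coord_self]

/-- The size of the errors in a box. -/
theorem abs_le_of_inBox {k : ℕ → ℝ} {C s : ℝ} {x : ℕ → ℝ} (hk : ∀ i, 0 < k i) (hC : 0 ≤ C)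
    (hs : 0 < s) (h : InBox n d₀ dinf κ θ k C s x) {i : ℕ} (hi : i < n) :
    |x (i + 1)| ≤ ∑ j ∈ Finset.range n, (C + 1) * (k j * injection n d₀ dinf κ θ j s) := by
  have hnn : ∀ j < n, 0 ≤ k j * injection n d₀ dinf κ θ j s := fun j hj =>
    mul_nonneg (hk j).le (H.injection_pos hj.le hs).le
  have h1 : C * (k i * injection n d₀ dinf κ θ i s) ≤
      (C + 1) * (k i * injection n d₀ dinf κ θ i s) := by nlinarith [hnn i hi]
  exact (h i hi).trans (h1.trans (Finset.single_le_sum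
    (f := fun j => (C + 1) * (k j * injection n d₀ dinf κ θ j s))
    (fun j hj => mul_nonneg (by linarith) (hnn j (Finset.mem_range.1 hj)))
    (Finset.mem_range.2 hi)))

/-- Solutions exist on `[t₀, ∞)` from every initial state, and can be chosen locally Lipschitz. -/
theorem exists_solution_from {k : ℕ → ℝ} {Δ C T : ℝ} {f : ℝ → ℝ} (hΔ : 0 ≤ Δ)
    (hk : ∀ i, 0 < k i) (hC : 0 < C) (hT : 0 < T) (hcon : Contracting n d₀ dinf κ θ k Δ C T)
    (hf : IsLipschitzSignal n Δ f) {t₀ : ℝ} (ht₀ : 0 ≤ t₀) (ξ : Fin n → ℝ) :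
    ∃ x : ℝ → Fin n → ℝ, x t₀ = ξ ∧
      (∀ b, ∃ M, 0 ≤ M ∧ ∀ s t, t₀ ≤ s → s ≤ t → t ≤ b → ‖x t - x s‖ ≤ M * (t - s)) ∧
      IsFilippovSolution (differentiatorField n d₀ dinf κ θ k f) (Ici t₀) x := by
  have hn2 := H.two_le
  obtain ⟨s, hs, hbox⟩ := H.exists_inBox hk fun i => coord ξ (i - 1) - signalDeriv (i - 1) f t₀
  -- The factor `C + 1` lets the same sum bound both the initial errors, in the box of size `1`, and
  -- the later ones, in the box of size `C`.
  obtain ⟨R', hR'⟩ : ∃ R', R' =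
    ∑ j ∈ Finset.range n, (C + 1) * (k j * injection n d₀ dinf κ θ j s) := ⟨_, rfl⟩
  have hR'0 : 0 ≤ R' := hR' ▸ Finset.sum_nonneg fun j hj => mul_nonneg (by linarith)
    (mul_nonneg (hk j).le (H.injection_pos (Finset.mem_range.1 hj).le hs).le)
  obtain ⟨x, hx0, hxL, hxd⟩ := exists_euler_limit (truncatedField n d₀ dinf κ θ k f (R' + 2)) t₀ ξ
    (H.exists_truncatedField_bound hk hf (by linarith) ht₀)
  have hac : ∀ a b, t₀ ≤ a → t₀ ≤ b → AbsolutelyContinuousOnInterval x a b := fun a b ha hb => by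
    obtain ⟨M, hM, h⟩ := hxL (max a b)
    exact absolutelyContinuousOnInterval_of_norm_sub_le hM fun s t hs hst ht =>
      h s t ((le_min ha hb).trans hs) hst ht
  have hbox0 : InBox n d₀ dinf κ θ k 1 s (fun i => diffError f x i t₀) := by
    simp only [diffError, hx0]; exact hbox
  -- While the errors are at most `R' + 1`, strictly below the truncation level `R' + 2`, both
  -- fields agree near the trajectory. The contraction then improves the bound to `R'`, which closes
  -- the continuous induction.
  have hsol : ∀ b, t₀ ≤ b → (∀ t ∈ Icc t₀ b, ∀ i < n, |diffError f x (i + 1) t| ≤ R' + 1) →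
      IsFilippovSolution (differentiatorField n d₀ dinf κ θ k f) (Icc t₀ b) x := by
    intro b hb he
    refine ⟨fun a ha c hc => hac a c ha.1 hc.1, ?_⟩
    have h0 : ∀ᵐ t : ℝ, t ≠ 0 := by simp [ae_iff, measure_singleton]
    have hdiff : ∀ᵐ t : ℝ, ∀ j, t ∈ uIcc t₀ b → DifferentiableAt ℝ (fun t => x t j) t :=
      ae_all_iff.2 fun j => ((hac t₀ b le_rfl hb).pi_apply j).ae_differentiableAt
    filter_upwards [h0, hdiff] with t htne hd hm
    have htpos : 0 < t := lt_of_le_of_ne (ht₀.trans hm.1) (Ne.symm htne)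
    have hv : HasDerivAt x (fun j => deriv (fun t => x t j) t) t := by
      rw [hasDerivAt_pi]
      intro j
      exact (hd j (by rwa [uIcc_of_le hb])).hasDerivAt
    refine ⟨_, H.mem_filippov_of_coordinate_bounds hk ?_ fun j σ c hev => ?_, hv⟩
    · have := hf.continuousAt_signalDeriv (by omega : 0 < n) htpos
      rwa [show signalDeriv 0 f = f by ext t; simp [signalDeriv]] at this
    · refine hxd t hm.1 _ hv j σ c ?_
      have heq := eventually_truncatedField_eq (d₀ := d₀) (dinf := dinf) (κ := κ) (θ := θ) (k := k)
        (R := R' + 2) (by omega : 1 ≤ n) hf htpos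
        (x := x t) (fun i hi => (he t hm i hi).trans_lt (by linarith))
      filter_upwards [heq, hev] with p hp1 hp2
      rwa [hp1]
  have hnorm : ∀ (D : ℝ), 0 ≤ D → ∀ t, ‖fun i : Fin n => diffError f x (i + 1) t‖ ≤ D ↔
      ∀ i < n, |diffError f x (i + 1) t| ≤ D := fun D hD t => by
    rw [pi_norm_le_iff_of_nonneg hD]
    exact ⟨fun h i hi => h ⟨i, hi⟩, fun h i => h i i.2⟩
  refine ⟨x, hx0, hxL, isFilippovSolution_Ici fun b hb => hsol b hb fun t ht => ?_⟩
  have hcont : ContinuousOn (fun t => ‖fun i : Fin n => diffError f x (i + 1) t‖) (Icc t₀ b) := by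
    refine ContinuousOn.norm (continuousOn_pi.2 fun i => ?_)
    have h1 := (continuous_coord (i : ℕ)).comp_continuousOn
      ((hac t₀ b le_rfl hb).continuousOn_Icc hb)
    have h2 := (hf.continuousOn_signalDeriv i.2).mono
      (fun t (ht : t ∈ Icc t₀ b) => show t ∈ Ici (0 : ℝ) from ht₀.trans ht.1)
    exact h1.sub h2
  have hle := le_of_improving_bound (C := R' + 1) (C' := R') hcont (by linarith)
    ((hnorm R' hR'0 t₀).2 fun i hi => by
      have h1 := hbox0 i hi
      have h2 : InBox n d₀ dinf κ θ k (C + 1) s (fun i => diffError f x i t₀) := fun i hi =>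
        (hbox0 i hi).trans (mul_le_mul_of_nonneg_right (by linarith)
          (mul_nonneg (hk i).le (H.injection_pos hi.le hs).le))
      refine (h2 i hi).trans ?_
      rw [hR']
      exact Finset.single_le_sum
        (f := fun j => (C + 1) * (k j * injection n d₀ dinf κ θ j s))
        (fun j hj => mul_nonneg (by linarith)
          (mul_nonneg (hk j).le (H.injection_pos (Finset.mem_range.1 hj).le hs).le))
        (Finset.mem_range.2 hi))
    (fun b' hb' hb1 t ht => (hnorm R' hR'0 t).2 fun i hi => by
      have htraj := H.isErrorTrajectory_of_isFilippovSolution hΔ hk hf ht₀ hb'.1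
        (hsol b' hb'.1 fun t ht => (hnorm _ (by linarith) t).1 (hb1 t ht))
      have := H.inBox_of_inBox hk hT hcon hs htraj hbox0 t ht
      rw [hR']
      exact H.abs_le_of_inBox hk hC.le hs this hi)
  intro i hi
  exact ((hnorm R' hR'0 t).1 (hle t ht) i hi).trans (by linarith)

/-- A solution with bounded errors on a bounded interval is Lipschitz. -/
theorem lipschitz_of_bounded_error {k : ℕ → ℝ} {Δ τ R : ℝ} {f : ℝ → ℝ}
    (hk : ∀ i, 0 < k i) (hf : IsLipschitzSignal n Δ f) {x : ℝ → Fin n → ℝ}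
    (h : IsFilippovSolution (differentiatorField n d₀ dinf κ θ k f) (Ico 0 τ) x)
    (hR : 0 ≤ R) (he : ∀ t ∈ Ico 0 τ, ∀ i < n, |diffError f x (i + 1) t| ≤ R) :
    ∃ M, 0 ≤ M ∧ ∀ s ∈ Ico 0 τ, ∀ t ∈ Ico 0 τ, s ≤ t → ‖x t - x s‖ ≤ M * (t - s) := by
  have hn2 := H.two_le
  obtain ⟨D, hD0, hD⟩ := exists_signalDeriv_bound hf τ
  have hnn : ∀ i < n, 0 ≤ k (i + 1) * injection n d₀ dinf κ θ (i + 1) (R + 1) := fun i hi =>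
    mul_nonneg (hk _).le ((abs_nonneg _).trans (H.abs_injection_le (i := i + 1) hi
      (z := R + 1) (abs_of_nonneg (by linarith)).le))
  obtain ⟨M, hM⟩ : ∃ M, M = ∑ i ∈ Finset.range n,
    k (i + 1) * injection n d₀ dinf κ θ (i + 1) (R + 1) + (R + D + 1) := ⟨_, rfl⟩
  have hsum := Finset.sum_nonneg fun i hi => hnn i (Finset.mem_range.1 hi)
  have hM0 : 0 ≤ M := by rw [hM]; linarith
  have hfield : ∀ t ∈ Ico 0 τ, ∀ j, ∀ᶠ y in 𝓝 (x t),
      |differentiatorField n d₀ dinf κ θ k f t y j| ≤ M := by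
    intro t ht j
    have h0 : |coord (x t) 0 - f t| < R + 1 := by
      have := he t ht 0 (by omega)
      rw [zero_add, diffError_one] at this
      linarith
    have h1 : |coord (x t) ((j : ℕ) + 1)| < R + D + 1 := by
      by_cases hj : (j : ℕ) + 1 < n
      · have h2 := he t ht _ hj
        have h3 := hD _ hj t ⟨ht.1, ht.2.le⟩
        have h4 := abs_add_le (diffError f x ((j : ℕ) + 1 + 1) t) (signalDeriv ((j : ℕ) + 1) f t)
        rw [diffError, add_tsub_cancel_right, sub_add_cancel] at h4
        rw [diffError, add_tsub_cancel_right] at h2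
        linarith
      · rw [show (j : ℕ) + 1 = n by omega, coord_self, abs_zero]; linarith
    have hc0 : Continuous fun y : Fin n → ℝ => |coord y 0 - f t| :=
      ((continuous_coord 0).sub continuous_const).abs
    have hc1 : Continuous fun y : Fin n → ℝ => |coord y ((j : ℕ) + 1)| :=
      (continuous_coord _).abs
    filter_upwards [(hc0.tendsto (x t)).eventually_lt_const h0,
      (hc1.tendsto (x t)).eventually_lt_const h1] with y hy0 hy1
    rw [differentiatorField, hM]
    refine (abs_add_le _ _).trans (add_le_add ?_ hy1.le)
    rw [abs_mul, abs_neg, abs_of_pos (hk _)]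
    refine (mul_le_mul_of_nonneg_left (H.abs_injection_le (i := (j : ℕ) + 1) j.2 hy0.le)
      (hk _).le).trans ?_
    exact Finset.single_le_sum
      (f := fun i => k (i + 1) * injection n d₀ dinf κ θ (i + 1) (R + 1))
      (fun i hi => hnn i (Finset.mem_range.1 hi)) (Finset.mem_range.2 j.2)
  refine ⟨M, hM0, fun s hs t ht hst => ?_⟩
  rw [pi_norm_le_iff_of_nonneg (mul_nonneg hM0 (by linarith))]
  intro j
  refine ((h.absolutelyContinuous s hs t ht).pi_apply j).abs_sub_le_of_ae_deriv_le hst ?_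
  filter_upwards [h.inclusion] with r hr hm
  have hr' : r ∈ Ico 0 τ := ⟨hs.1.trans hm.1, hm.2.trans_lt ht.2⟩
  obtain ⟨v, hvF, hv⟩ := hr hr'
  refine ⟨v j, hasDerivAt_pi.1 hv j, abs_le.2 ⟨?_, ?_⟩⟩
  · have := mul_le_of_mem_filippov hvF j (-1) M (by
      filter_upwards [hfield r hr' j] with y hy
      linarith [(abs_le.1 hy).1])
    linarith
  · have := mul_le_of_mem_filippov hvF j 1 M (by
      filter_upwards [hfield r hr' j] with y hy
      linarith [(abs_le.1 hy).2])
    linarith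

/-- Solutions on bounded intervals extend to `[0, ∞)`. -/
theorem exists_extension {k : ℕ → ℝ} {Δ C T τ : ℝ} {f : ℝ → ℝ} (hΔ : 0 ≤ Δ)
    (hk : ∀ i, 0 < k i) (hC : 0 < C) (hT : 0 < T) (hcon : Contracting n d₀ dinf κ θ k Δ C T)
    (hf : IsLipschitzSignal n Δ f) (hτ : 0 < τ) {x : ℝ → Fin n → ℝ}
    (h : IsFilippovSolution (differentiatorField n d₀ dinf κ θ k f) (Ico 0 τ) x) :
    ∃ y : ℝ → Fin n → ℝ,
      IsFilippovSolution (differentiatorField n d₀ dinf κ θ k f) (Ici 0) y ∧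
      EqOn y x (Ico 0 τ) := by
  obtain ⟨s, hs, hbox⟩ := H.exists_inBox hk fun i => diffError f x i 0
  have hpos : 0 ≤ ∑ j ∈ Finset.range n, (C + 1) * (k j * injection n d₀ dinf κ θ j s) :=
    Finset.sum_nonneg fun j hj => mul_nonneg (by linarith)
      (mul_nonneg (hk j).le (H.injection_pos (Finset.mem_range.1 hj).le hs).le)
  obtain ⟨M, hM0, hM⟩ := H.lipschitz_of_bounded_error hk hf h hpos fun t ht i hi => by
    have htraj := H.isErrorTrajectory_of_isFilippovSolution hΔ hk hf le_rfl ht.1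
      (h.mono fun r hr => ⟨hr.1, hr.2.trans_lt ht.2⟩)
    exact H.abs_le_of_inBox hk hC.le hs
      (H.inBox_of_inBox hk hT hcon hs htraj hbox t ⟨ht.1, le_rfl⟩) hi
  -- A Lipschitz extension supplies the value at `τ` from which a new solution starts; what it does
  -- beyond `τ` is discarded.
  obtain ⟨z, hzL, hzx⟩ := (lipschitzOnWith_of_norm_sub_le hM0 hM).extend_pi
  replace hzx := hzx.symm
  have hz : ∀ r t, r ≤ t → ‖z t - z r‖ ≤ M * (t - r) := fun r t hrt => by
    have := hzL.dist_le_mul t r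
    rwa [Real.coe_toNNReal _ hM0, dist_eq_norm, Real.dist_eq, abs_of_nonneg (by linarith)] at this
  obtain ⟨x', hx'0, hx'L, hx'⟩ := H.exists_solution_from hΔ hk hC hT hcon hf hτ.le (z τ)
  refine ⟨fun t => if t < τ then z t else x' t, ⟨fun a ha b hb => ?_, ?_⟩, fun t ht => ?_⟩
  · obtain ⟨M', hM'0, hM'⟩ := hx'L (max a b)
    refine absolutelyContinuousOnInterval_of_norm_sub_le (M := M + M') (by positivity)
      fun r t _ hrt ht => ?_
    have hnn : 0 ≤ M * (t - r) := mul_nonneg hM0 (by linarith)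
    have hnn' : 0 ≤ M' * (t - r) := mul_nonneg hM'0 (by linarith)
    rcases lt_or_ge t τ with h1 | h1
    · rw [if_pos h1, if_pos (hrt.trans_lt h1)]
      linarith [hz r t hrt]
    · rw [if_neg h1.not_gt]
      rcases lt_or_ge r τ with h2 | h2
      · rw [if_pos h2]
        have h3 := hM' τ t le_rfl h1 ht
        have h4 := hz r τ h2.le
        rw [hx'0] at h3
        have h5 := norm_sub_le_norm_sub_add_norm_sub (x' t) (z τ) (z r)
        nlinarith
      · rw [if_neg h2.not_gt]
        linarith [hM' r t h2 hrt ht]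
  · have h0 : ∀ᵐ t : ℝ, t ≠ 0 := by simp [ae_iff, measure_singleton]
    have h1 : ∀ᵐ t : ℝ, t ≠ τ := by simp [ae_iff, measure_singleton]
    filter_upwards [h.inclusion, hx'.inclusion, h0, h1] with t ht1 ht2 ht3 ht4 hm
    have htpos : 0 < t := lt_of_le_of_ne hm (Ne.symm ht3)
    rcases lt_or_gt_of_ne ht4 with hlt | hgt
    · obtain ⟨v, hvF, hv⟩ := ht1 ⟨hm, hlt⟩
      rw [if_pos hlt, hzx ⟨hm, hlt⟩]
      refine ⟨v, hvF, hv.congr_of_eventuallyEq ?_⟩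
      filter_upwards [Ioo_mem_nhds htpos hlt] with r hr
      rw [if_pos hr.2, hzx ⟨hr.1.le, hr.2⟩]
    · obtain ⟨v, hvF, hv⟩ := ht2 hgt.le
      rw [if_neg hgt.not_gt]
      refine ⟨v, hvF, hv.congr_of_eventuallyEq ?_⟩
      filter_upwards [Ioi_mem_nhds hgt] with r hr
      rw [if_neg (not_lt.2 (le_of_lt hr))]
  · simp only [if_pos ht.2]
    exact hzx ht

end Admissible

end

/-! ### The convergence theorem -/

theorem theorem1 (n : ℕ) (hn : 2 ≤ n) (d₀ dinf Δ : ℝ)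
    (hd₀ : -1 ≤ d₀) (hd : d₀ ≤ dinf) (hdinf : dinf < 1 / ((n : ℝ) - 1))
    (κ θ : ℕ → ℝ) (hκ : ∀ i ∈ Finset.Icc 1 n, 0 < κ i) (hθ : ∀ i ∈ Finset.Icc 1 n, 0 < θ i)
    (hΔ : 0 ≤ Δ) (hcase : d₀ = -1 ∨ Δ = 0) :
    ∃ k : ℕ → ℝ, (∀ i ∈ Finset.Icc 1 n, 0 < k i) ∧
      (∀ f₀ : ℝ → ℝ, IsLipschitzSignal n Δ f₀ →
        (∀ ξ : Fin n → ℝ, ∃ x : ℝ → Fin n → ℝ,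
          IsFilippovSolution (differentiatorField n d₀ dinf κ θ k f₀) (Ici 0) x ∧ x 0 = ξ) ∧
        (∀ τ : ℝ, 0 < τ → ∀ x : ℝ → Fin n → ℝ,
          IsFilippovSolution (differentiatorField n d₀ dinf κ θ k f₀) (Ico 0 τ) x →
          ∃ y : ℝ → Fin n → ℝ,
            IsFilippovSolution (differentiatorField n d₀ dinf κ θ k f₀) (Ici 0) y ∧
            EqOn y x (Ico 0 τ)) ∧
        (∀ x : ℝ → Fin n → ℝ,
          IsFilippovSolution (differentiatorField n d₀ dinf κ θ k f₀) (Ici 0) x →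
          ∀ i : Fin n, Tendsto (fun t => x t i - signalDeriv i f₀ t) atTop (𝓝 0))) ∧
      ((-1 < d₀ ∧ d₀ < 0 ∧ 0 < dinf ∧ Δ = 0) ∨ (d₀ = -1 ∧ 0 < dinf) →
        ∃ Tbar : ℝ, 0 < Tbar ∧ ∀ f₀ : ℝ → ℝ, IsLipschitzSignal n Δ f₀ →
          ∀ x : ℝ → Fin n → ℝ,
            IsFilippovSolution (differentiatorField n d₀ dinf κ θ k f₀) (Ici 0) x →
            ∀ t : ℝ, Tbar ≤ t → ∀ i : Fin n, x t i = signalDeriv i f₀ t) := by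
  have H : Admissible n d₀ dinf κ θ := ⟨hn, hd₀, hd, hdinf, hκ, hθ⟩
  obtain ⟨k, hk, C, T, hC, hT, hcon⟩ := H.exists_gains hcase
  refine ⟨k, fun i _ => hk i, fun f₀ hf => ⟨fun ξ => ?_, fun τ hτ x hx => ?_, fun x hx i => ?_⟩,
    fun hfix => ?_⟩
  · obtain ⟨x, hx0, -, hx⟩ := H.exists_solution_from hΔ hk hC hT hcon hf le_rfl ξ
    exact ⟨x, hx, hx0⟩
  · exact H.exists_extension hΔ hk hC hT hcon hf hτ hx
  · have := H.tendsto_error hk hT hcon (fun b hb => H.isErrorTrajectory_of_isFilippovSolution hΔ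
      hk hf le_rfl hb (hx.mono Icc_subset_Ici_self)) i.2
    refine this.congr fun t => ?_
    rw [diffError, add_tsub_cancel_right, coord_of_lt _ i.2]
  -- Both cases reduce to `d₀ < 0 < dinf`; the disturbance has already been absorbed by the choice
  -- of gains.
  · obtain ⟨h0, h1⟩ : d₀ < 0 ∧ 0 < dinf := by
      rcases hfix with h | h
      · exact ⟨h.2.1, h.2.2.1⟩
      · exact ⟨by linarith [h.1], h.2⟩
    obtain ⟨Tbar, hTbar, h⟩ := H.exists_fixed_time hk hT hcon h0 h1
    refine ⟨Tbar, hTbar, fun f₀ hf x hx t ht i => ?_⟩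
    have := h _ _ (fun b hb => H.isErrorTrajectory_of_isFilippovSolution hΔ hk hf le_rfl hb
      (hx.mono Icc_subset_Ici_self)) t ht i i.2
    rw [diffError, add_tsub_cancel_right, coord_of_lt _ i.2] at this
    linarith
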